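/- **Setting (the logical framework CompLF).** Fix a set of sorts. *Scopes* are lists $\gamma=x_1::\delta_1\to s_1,\dots,x_k::\delta_k\to s_k$ with each $\delta_i$ a scope and $s_i$ a sort. A *pre-signature* is a finite list of constants $c::\delta\to s$ (term level) and $c::\delta\to\square$ (type level), together with an injective assignment of a sort $\|c\|$ to each constant. Over a pre-signature, *terms* $t\in\mathrm{Tm}\,\gamma\,s$ are $x(\mathbf t)$ or $c(\mathbf t)$, where $x::\delta\to s\in\gamma$ resp. $c::\delta\to s$ and $\mathbf t\in\mathrm{Sp}\,\gamma\,\delta$; *spines* are $\varepsilon\in\mathrm{Sp}\,\gamma\,()$ and $(\mathbf t,\vec x_{\theta}.t)\in\mathrm{Sp}\,\gamma\,(\delta,x::\theta\to s)$ for $\mathbf t\in\mathrm{Sp}\,\gamma\,\delta$, $t\in\mathrm{Tm}\,(\gamma.\theta)\,s$; *types* are $c(\mathbf t)\in\mathrm{Ty}\,\gamma$ for $c::\delta\to\square$, $\mathbf t\in\mathrm{Sp}\,\gamma\,\delta$, with erasure $|c(\mathbf t)|=\|c\|$; *contexts* are lists of entries $x:\Delta\to T$, with erasure $|\Gamma,x:\Delta\to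 T|=|\Gamma|,x::|\Delta|\to|T|$. Substitution $e[\mathbf t]$ of a spine is hereditary: $x(\mathbf v)[\mathbf t]=\mathbf t_x[\mathbf v[\mathbf t]]$ when $x$ is substituted. A *signature* $\Sigma$ assigns to each constant $c$ an entry $c:\Delta_\nu\to T$ or $c:\Delta_\nu\to\square$ using only earlier constants, where $\Delta$ is a closed context and $\nu$ says which arguments are erased from the syntax; the arity $\delta$ of $c$ in $|\Sigma|$ consists of the arguments not erased, and $\nu\cdot\mathbf t$ denotes $\mathbf t$ with the erased arguments removed. A *rewrite system* $\mathcal R$ is a set of rules $l\longmapsto r$ between terms of the same scope and sort, with $l$ a higher-order pattern and $\mathrm{fv}(r)\subseteq\mathrm{fv}(l)$; $\longrightarrow$ is its closure under substitution and under all term, spine, type and context formers, and $\equiv$ is the equivalence relation generated by $\longrightarrow$. A *theory* is a pair $\mathbb T=(\Sigma,\mathcal R)$; its judgments $\Gamma\vdash$, $\Gamma\vdash T$, $\Gamma\vdash t:T$, $\Gamma\vdash\mathbf t:\Delta$ are generated by: - $()\vdash$; if $\Gamma.\Gamma'\vdash T$ then $\Gamma,x:\Gamma'\to T\vdash$; -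 if $c:\Delta_\nu\to\square\in\Sigma$ and $\Gamma\vdash\mathbf t:\Delta$ then $\Gamma\vdash c(\nu\cdot\mathbf t)$; if $c:\Delta_\nu\to T\in\Sigma$ and $\Gamma\vdash\mathbf t:\Delta$ then $\Gamma\vdash c(\nu\cdot\mathbf t):T[\mathbf t]$; if $x:\Delta\to T\in\Gamma$ and $\Gamma\vdash\mathbf t:\Delta$ then $\Gamma\vdash x(\mathbf t):T[\mathbf t]$; - if $\Gamma\vdash t:T$, $\Gamma\vdash U$ and $T\equiv U$ then $\Gamma\vdash t:U$; - if $\Gamma\vdash$ then $\Gamma\vdash\varepsilon:()$; if $\Gamma\vdash\mathbf t:\Delta$ and $\Gamma.\Gamma'[\mathbf t]\vdash t:T[\mathbf t]$ then $\Gamma\vdash(\mathbf t,\vec x.t):(\Delta,x:\Gamma'\to T)$. $\mathbb T$ is *confluent* if $\longrightarrow$ is confluent on terms; *strongly normalising* if no well-typed term has an infinite reduction sequence; it satisfies *subject reduction* if $\Gamma\vdash t:T$ and $t\longrightarrow t'$ imply $\Gamma\vdash t':T$. For a constant $c$, $\mathbb T_{<c}$ is the theory formed by the declarations before $c$ and the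 rules that only use these. **Patterns and matching.** *Fully applied patterns* with flexible variables $\gamma$ and rigid variables $\gamma_0$ are generated by: $c(\mathbf p)$ with $c$ a constant (a term if $c$ is term-level, a type if it is type-level); a flexible variable $x(\mathrm{id}_{\gamma_0})$, with flexible scope $(x::\gamma_0\to s)$; $\varepsilon$, with flexible scope $()$; and $\mathbf p,\vec x_{\gamma_x}.p$, where $\mathbf p$ has flexible scope $\gamma_1.\gamma_{12}$ and rigid scope $\gamma_0$, $p$ has flexible scope $\gamma_{12}.\gamma_2$ and rigid scope $\gamma_0.\gamma_x$, and the result has flexible scope $\gamma_1.\gamma_{12}.\gamma_2$ and rigid scope $\gamma_0$. A pattern is *rigid* if none of its constants has an erased argument or is the head symbol of the left-hand side of a rule. Fix a *reduction strategy* $\mathfrak S$, that is, a functional relation $\longrightarrow_{\mathfrak S}\ \subseteq\ \longrightarrow^{+}$ with the same normal forms as $\longrightarrow$; write $\mathrm{nf}_{\mathfrak S}(e)$ for the $\mathfrak S$-normal form of $e$, if $e$ reaches one. *Matching* $p\prec u\leadsto\mathbf v$ (with $\mathbf v$ a spine for the flexible variables of $p$) is generated by: $c(\mathbf p)\prec u\leadsto\mathbf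 v$ if $c$ is term-level, $u\longrightarrow_{\mathfrak S}^*c(\mathbf u)$ and $\mathbf p\prec\mathbf u\leadsto\mathbf v$; $c(\mathbf p)\prec c(\mathbf u)\leadsto\mathbf v$ if $c$ is type-level and $\mathbf p\prec\mathbf u\leadsto\mathbf v$; $x(\mathrm{id}_{\gamma_0})\prec u\leadsto(\vec x_{\gamma_0}.u)$; $\varepsilon\prec\varepsilon\leadsto\varepsilon$; and $(\mathbf p,\vec x.p)\prec(\mathbf u,\vec x.u)\leadsto\mathbf v_1,\mathrm{nf}_{\mathfrak S}(\mathbf w_1),\mathbf v_2$ if $\mathbf p\prec\mathbf u\leadsto\mathbf v_1,\mathbf w_1$ and $p\prec u\leadsto\mathbf w_2,\mathbf v_2$ and $\mathrm{nf}_{\mathfrak S}(\mathbf w_1)=\mathrm{nf}_{\mathfrak S}(\mathbf w_2)$ (both defined), where $\mathbf w_1,\mathbf w_2$ are the parts for the shared variables $\gamma_{12}$. **Moded theories.** A *moded signature* $\Sigma^{+-}$ assigns to each constant one of the following entries, over the earlier constants: 1. $c:\Delta^-\to\square$; 2. $c^+:\Delta^-\to T$; 3. $c^-:\{\Delta'\}\Delta^-\to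 T$, with $T$ a fully applied type pattern with flexible variables $|\Delta'|$ and no rigid variables; 4. $c^+:\Delta_1^-\{\Delta'\}(x:\Gamma_x\to T)^+\Delta_2^-\to U$, with $\Delta'$ and $\Gamma_x$ contexts over $\Delta_1$, $T$ a fully applied type pattern with flexible variables $|\Delta'|$ and rigid variables $|\Gamma_x|$, $\Delta_2$ a context over $\Delta_1.\Delta',x:\Gamma_x\to T$, and $U$ a type over $\Delta_1.\Delta',x:\Gamma_x\to T,\Delta_2$. Forgetting the modes, with exactly the arguments in braces erased, gives a signature $\Sigma$. A *moded theory* is $\mathbb T^{+-}=(\Sigma^{+-},\mathcal R)$, with underlying theory $\mathbb T=(\Sigma,\mathcal R)$. It is *well-typed* if the following hold in $\mathbb T_{<c}$ for each $c$: in case 1, $\Delta\vdash$; in case 2, $\Delta\vdash T$; in case 3, $\Delta'.\Delta\vdash$ and $\Delta'\vdash T$, and $T$ is rigid; in case 4, $\Delta_1.\Delta',x:\Gamma_x\to T,\Delta_2\vdash U$ and $\Delta_1.\Gamma_x\vdash$, and $T$ is rigid. **Algorithm.** The judgments $\Gamma\vdash t\Rightarrow T$ (inference), $\Gamma\vdash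 t\Leftarrow T$ (checking), $\Gamma\vdash T\Leftrightarrow\square$ and $\Gamma\vdash\mathbf t\Leftarrow\Delta$ are generated by: - $\Gamma\vdash x(\mathbf t)\Rightarrow T[\mathbf t]$ if $x:\Delta\to T\in\Gamma$ and $\Gamma\vdash\mathbf t\Leftarrow\Delta$; - $\Gamma\vdash c(\mathbf t)\Rightarrow T[\mathbf t]$ if $c$ has entry 2 and $\Gamma\vdash\mathbf t\Leftarrow\Delta$; - $\Gamma\vdash c(\mathbf t,\vec x.t,\mathbf u)\Rightarrow U[\mathbf t,\mathbf v,\vec x.t,\mathbf u]$ if $c$ has entry 4, $\Gamma\vdash\mathbf t\Leftarrow\Delta_1$, $\Gamma.\Gamma_x[\mathbf t]\vdash t\Rightarrow V$, $T\prec V\leadsto\mathbf v$ and $\Gamma\vdash\mathbf u\Leftarrow\Delta_2[\mathbf t,\mathbf v,\vec x.t]$; - $\Gamma\vdash t\Leftarrow T$ if $t$ is not of the form $c(\mathbf t)$ with $c$ of entry 3, $\Gamma\vdash t\Rightarrow U$, and $\mathrm{nf}_{\mathfrak S}(T)=\mathrm{nf}_{\mathfrak S}(U)$ (both defined); - $\Gamma\vdash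 c(\mathbf t)\Leftarrow V$ if $c$ has entry 3, $T\prec V\leadsto\mathbf v$ and $\Gamma\vdash\mathbf t\Leftarrow\Delta[\mathbf v]$; - $\Gamma\vdash c(\mathbf t)\Leftrightarrow\square$ if $c$ has entry 1 and $\Gamma\vdash\mathbf t\Leftarrow\Delta$; - $\Gamma\vdash\varepsilon\Leftarrow()$; and $\Gamma\vdash(\mathbf t,\vec x.t)\Leftarrow(\Delta,x:\Gamma_x\to T)$ if $\Gamma\vdash\mathbf t\Leftarrow\Delta$ and $\Gamma.\Gamma_x[\mathbf t]\vdash t\Leftarrow T[\mathbf t]$. **Well-moded expressions.** The *inferable* terms $\mathrm{Tm}^+$, the *checkable* terms $\mathrm{Tm}^-$, and the well-moded spines $\mathrm{Sp}^{+-}$ and types $\mathrm{Ty}^{+-}$ are the smallest sets such that: $x(\mathbf t)\in\mathrm{Tm}^+$ if $\mathbf t\in\mathrm{Sp}^{+-}$; $c(\mathbf t)$ is in $\mathrm{Ty}^{+-}$, $\mathrm{Tm}^+$, $\mathrm{Tm}^-$ if $\mathbf t\in\mathrm{Sp}^{+-}$ and $c$ has entry 1, 2, 3 respectively; $c(\mathbf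 t,\vec x.t,\mathbf u)\in\mathrm{Tm}^+$ if $c$ has entry 4, $\mathbf t\in\mathrm{Sp}^{+-}$ has scope $|\Delta_1|$, $t\in\mathrm{Tm}^+$ and $\mathbf u\in\mathrm{Sp}^{+-}$ has scope $|\Delta_2|$; $\mathrm{Tm}^+\subseteq\mathrm{Tm}^-$; $\varepsilon\in\mathrm{Sp}^{+-}$; and $(\mathbf t,\vec x.t)\in\mathrm{Sp}^{+-}$ if $\mathbf t\in\mathrm{Sp}^{+-}$ and $t\in\mathrm{Tm}^-$. **Theorem (completeness of the bidirectional typing algorithm).** Let $\mathbb T^{+-}$ be a well-typed moded theory whose underlying theory is confluent, strongly normalising and satisfies subject reduction, and let $\mathfrak S$ be any reduction strategy for it. - If $\Gamma\vdash t:T$ and $t\in\mathrm{Tm}^+\,|\Gamma|\,|T|$, then $\Gamma\vdash t\Rightarrow T'$ for some $T'$ with $T\equiv T'$. - If $\Gamma\vdash t:T$ and $t\in\mathrm{Tm}^-\,|\Gamma|\,|T|$, then $\Gamma\vdash t\Leftarrow T$. - If $\Gamma\vdash T$ and $T\in\mathrm{Ty}^{+-}\,|\Gamma|$, then $\Gamma\vdash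 T\Leftrightarrow\square$. - If $\Gamma\vdash\mathbf t:\Delta$ and $\Gamma.\Delta\vdash$ and $\mathbf t\in\mathrm{Sp}^{+-}\,|\Gamma|\,|\Delta|$, then $\Gamma\vdash\mathbf t\Leftarrow\Delta$. Moreover, types of inferable terms are unique up to conversion: if $t\in\mathrm{Tm}^+$, $\Gamma\vdash t:T$ and $\Gamma\vdash t:U$ (with $|T|=|U|$ the sort of $t$), then $T\equiv U$. -/

import Mathlib

/-!
  The logical framework CompLF, its moded theories and its generic bidirectional typing
  algorithm.  The nameful syntax is rendered with well-scoped de Bruijn variables.  All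
  inductive-recursive definitions (types, contexts and signatures together with their erasure
  to sorts, scopes and pre-signatures) are rendered as families indexed by the erasure.
-/

namespace CompLF

universe u

/-! ## Scopes, variables, renamings -/

/-- Scopes: `γ, δ ::= () | γ, x :: δ → s`. -/
inductive Scope (S : Type u) : Type u
  | nil : Scope S
  | snoc (γ δ : Scope S) (s : S) : Scope S

/-- Concatenation of scopes. -/
def Scope.append {S : Type u} (γ : Scope S) : Scope S → Scope S
  | .nil => γ
  | .snoc δ θ s => .snoc (Scope.append γ δ) θ s

infixl:65 " ⧺ " => Scope.append

/-- `Var γ δ s` is the type of variables `x` with `x :: δ → s ∈ γ`. -/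
inductive Var {S : Type u} : Scope S → Scope S → S → Type u
  | zero {γ δ : Scope S} {s : S} : Var (γ.snoc δ s) δ s
  | succ {γ δ θ : Scope S} {s r : S} (x : Var γ δ s) : Var (γ.snoc θ r) δ s

section Variables

variable {S : Type u}

/-- A variable of `γ`, seen in `γ.θ`. -/
def Var.inl {γ δ : Scope S} {s : S} : (θ : Scope S) → Var γ δ s → Var (γ ⧺ θ) δ s
  | .nil, x => x
  | .snoc θ _ _, x => .succ (Var.inl θ x)

/-- A variable of `θ`, seen in `γ.θ`. -/
def Var.inr {γ : Scope S} : {θ δ : Scope S} → {s : S} → Var θ δ s → Var (γ ⧺ θ) δ s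
  | _, _, _, .zero => .zero
  | _, _, _, .succ x => .succ (Var.inr x)

/-- A variable of `γ.θ` is a variable of `γ` or a variable of `θ`. -/
def Var.split {γ : Scope S} :
    (θ : Scope S) → {δ : Scope S} → {s : S} → Var (γ ⧺ θ) δ s → Var γ δ s ⊕ Var θ δ s
  | .nil, _, _, x => .inl x
  | .snoc _ _ _, _, _, .zero => .inr .zero
  | .snoc θ _ _, _, _, .succ x => Sum.map id Var.succ (Var.split θ x)

/-- Arity preserving renamings. -/
def Ren (γ γ' : Scope S) : Type u := ∀ ⦃δ : Scope S⦄ ⦃s : S⦄, Var γ δ s → Var γ' δ s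

/-- Weakening from `γ` to `γ.θ`. -/
def Ren.wkl (γ θ : Scope S) : Ren γ (γ ⧺ θ) := fun _ _ x => x.inl θ

/-- Weakening from `θ` to `γ.θ`. -/
def Ren.wkr (γ θ : Scope S) : Ren θ (γ ⧺ θ) := fun _ _ x => x.inr

/-- Extension of a renaming under a binder for the variables of `θ`. -/
def Ren.lift {γ γ' : Scope S} (ρ : Ren γ γ') : (θ : Scope S) → Ren (γ ⧺ θ) (γ' ⧺ θ)
  | .nil => ρ
  | .snoc θ _ _ => fun _ _ x =>
    match x with
    | .zero => .zero
    | .succ x => .succ (Ren.lift ρ θ x)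

/-- Reassociation `(γ.δ).θ → γ.(δ.θ)`, which is the identity in a nameful presentation. -/
def Ren.assocR (γ δ : Scope S) : (θ : Scope S) → Ren ((γ ⧺ δ) ⧺ θ) (γ ⧺ (δ ⧺ θ))
  | .nil => fun _ _ x => x
  | .snoc θ _ _ => fun _ _ x =>
    match x with
    | .zero => .zero
    | .succ x => .succ (Ren.assocR γ δ θ x)

/-- Reassociation `γ.(δ.θ) → (γ.δ).θ`, which is the identity in a nameful presentation. -/
def Ren.assocL (γ δ : Scope S) : (θ : Scope S) → Ren (γ ⧺ (δ ⧺ θ)) ((γ ⧺ δ) ⧺ θ)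
  | .nil => fun _ _ x => x
  | .snoc θ _ _ => fun _ _ x =>
    match x with
    | .zero => .zero
    | .succ x => .succ (Ren.assocL γ δ θ x)

end Variables

/-! ## Pre-signatures and raw syntax -/

/-- Arities `δ → s` of term-level constants and `δ → □` of type-level constants. -/
inductive Arity (S : Type u) : Type u
  | tm (δ : Scope S) (s : S) : Arity S
  | ty (δ : Scope S) : Arity S

/-- A pre-signature declaring `n` constants.  A constant is identified with its position in the
order of declaration.  `era` is the map sending a constant `c` to the sort `‖c‖`. -/
structure PreSig (S : Type u) (n : ℕ) : Type u where
  arity : Fin n → Arity S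
  era : Fin n → S

/-- The kinds of expressions: terms of sort `s`, spines for the scope `δ`, types whose erasure
is `s`, contexts whose erasure is `δ`. -/
inductive Kind (S : Type u) : Type u
  | tm (s : S) : Kind S
  | sp (δ : Scope S) : Kind S
  | ty (s : S) : Kind S
  | ctx (δ : Scope S) : Kind S

/-- The expressions in scope `γ`.  `Ex ς γ (.tm s)` is `Tm γ s`, `Ex ς γ (.sp δ)` is `Sp γ δ`,
`Ex ς γ (.ty s)` is the set of `T ∈ Ty γ` with `|T| = s`, and `Ex ς γ (.ctx δ)` is the set of
`Γ ∈ Ctx γ` with `|Γ| = δ`. -/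
inductive Ex {S : Type u} {n : ℕ} (ς : PreSig S n) : Scope S → Kind S → Type u
  | var {γ δ : Scope S} {s : S} (x : Var γ δ s) (ts : Ex ς γ (.sp δ)) : Ex ς γ (.tm s)
  | con {γ δ : Scope S} {s : S} (c : Fin n) (h : ς.arity c = .tm δ s) (ts : Ex ς γ (.sp δ)) :
      Ex ς γ (.tm s)
  | nil {γ : Scope S} : Ex ς γ (.sp .nil)
  | snoc {γ δ θ : Scope S} {s : S} (ts : Ex ς γ (.sp δ)) (t : Ex ς (γ ⧺ θ) (.tm s)) :
      Ex ς γ (.sp (δ.snoc θ s))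
  | tcon {γ δ : Scope S} {s : S} (c : Fin n) (h : ς.arity c = .ty δ) (hs : ς.era c = s)
      (ts : Ex ς γ (.sp δ)) : Ex ς γ (.ty s)
  | cnil {γ : Scope S} : Ex ς γ (.ctx .nil)
  | csnoc {γ δ θ : Scope S} {s : S} (Γ : Ex ς γ (.ctx δ)) (Δ : Ex ς (γ ⧺ δ) (.ctx θ))
      (T : Ex ς ((γ ⧺ δ) ⧺ θ) (.ty s)) : Ex ς γ (.ctx (δ.snoc θ s))

section Raw

variable {S : Type u} {n : ℕ} {ς : PreSig S n}

abbrev Tm (ς : PreSig S n) (γ : Scope S) (s : S) : Type u := Ex ς γ (.tm s)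
abbrev Sp (ς : PreSig S n) (γ δ : Scope S) : Type u := Ex ς γ (.sp δ)
abbrev Ty (ς : PreSig S n) (γ : Scope S) (s : S) : Type u := Ex ς γ (.ty s)
abbrev Ctx (ς : PreSig S n) (γ δ : Scope S) : Type u := Ex ς γ (.ctx δ)

/-- Renaming of variables (in particular, weakening). -/
def Ex.rename : {γ γ' : Scope S} → {k : Kind S} → Ren γ γ' → Ex ς γ k → Ex ς γ' k
  | _, _, _, ρ, .var x ts => .var (ρ x) (ts.rename ρ)
  | _, _, _, ρ, .con c h ts => .con c h (ts.rename ρ)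
  | _, _, _, _, .nil => .nil
  | _, _, _, ρ, .snoc (θ := θ) ts t => .snoc (ts.rename ρ) (t.rename (ρ.lift θ))
  | _, _, _, ρ, .tcon c h hs ts => .tcon c h hs (ts.rename ρ)
  | _, _, _, _, .cnil => .cnil
  | _, _, _, ρ, .csnoc (δ := δ) (θ := θ) Γ Δ T =>
    .csnoc (Γ.rename ρ) (Δ.rename (ρ.lift δ)) (T.rename ((ρ.lift δ).lift θ))

/-- Concatenation of spines. -/
def Ex.spAppend {γ δ : Scope S} (ts : Sp ς γ δ) : {θ : Scope S} → Sp ς γ θ → Sp ς γ (δ ⧺ θ)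
  | _, .nil => ts
  | _, .snoc us u => .snoc (Ex.spAppend ts us) u

/-- The argument `t_x` of the spine `t` at the variable `x`. -/
def Ex.get {γ : Scope S} :
    {δ θ : Scope S} → {s : S} → Sp ς γ δ → Var δ θ s → Tm ς (γ ⧺ θ) s
  | _, _, _, .snoc _ t, .zero => t
  | _, _, _, .snoc ts _, .succ x => Ex.get ts x

/-- The identity spine. -/
def idSp (ς : PreSig S n) : (γ : Scope S) → Sp ς γ γ
  | .nil => .nil
  | .snoc γ δ _ =>
    .snoc ((idSp ς γ).rename (fun _ _ x => .succ x))
      (.var (Var.inl δ .zero) ((idSp ς δ).rename (Ren.wkr _ δ)))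

/-! ### Hereditary substitution -/

/-- An environment from `γ` to `γ'`, in which a variable is either sent to a variable, or
belongs to the scope `φ` of substituted variables and is sent to an argument. -/
def Env (ς : PreSig S n) (φ γ γ' : Scope S) : Type u :=
  ∀ ⦃δ : Scope S⦄ ⦃s : S⦄, Var γ δ s → Var γ' δ s ⊕ (Var φ δ s × Tm ς (γ' ⧺ δ) s)

/-- Extension of an environment under a binder. -/
def Env.lift {φ γ γ' : Scope S} (σ : Env ς φ γ γ') (β : Scope S) :
    Env ς φ (γ ⧺ β) (γ' ⧺ β) := fun δ _ x =>
  match Var.split β x with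
  | .inl y =>
    match σ y with
    | .inl z => .inl (z.inl β)
    | .inr (m, t) => .inr (m, t.rename ((Ren.wkl γ' β).lift δ))
  | .inr z => .inl z.inr

/-- For every `x :: δ → s ∈ φ`, a way to compute `t[v/δ]` for `t ∈ Tm γ.δ s`, `v ∈ Sp γ δ`. -/
def App (ς : PreSig S n) (φ : Scope S) : Type u :=
  ∀ ⦃δ : Scope S⦄ ⦃s : S⦄, Var φ δ s → ∀ γ : Scope S, Tm ς (γ ⧺ δ) s → Sp ς γ δ → Tm ς γ s

/-- Traversal of an expression along an environment, by induction on the expression. -/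
def Ex.bind {φ : Scope S} (app : App ς φ) :
    {γ γ' : Scope S} → {k : Kind S} → Env ς φ γ γ' → Ex ς γ k → Ex ς γ' k
  | _, γ', _, σ, .var x ts =>
    match σ x with
    | .inl y => .var y (ts.bind app σ)
    | .inr (m, t) => app m γ' t (ts.bind app σ)
  | _, _, _, σ, .con c h ts => .con c h (ts.bind app σ)
  | _, _, _, _, .nil => .nil
  | _, _, _, σ, .snoc (θ := θ) ts t => .snoc (ts.bind app σ) (t.bind app (σ.lift θ))
  | _, _, _, σ, .tcon c h hs ts => .tcon c h hs (ts.bind app σ)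
  | _, _, _, _, .cnil => .cnil
  | _, _, _, σ, .csnoc (δ := δ) (θ := θ) Γ Δ T =>
    .csnoc (Γ.bind app σ) (Δ.bind app (σ.lift δ)) (T.bind app ((σ.lift δ).lift θ))

/-- The environment from `γ.δ` to `γ` given by a spine. -/
def Env.ofSp {γ δ : Scope S} (ts : Sp ς γ δ) : Env ς δ (γ ⧺ δ) γ := fun _ _ x =>
  match Var.split δ x with
  | .inl y => .inl y
  | .inr z => .inr (z, ts.get z)

/-- The recursive calls of hereditary substitution, by induction on the scope. -/
def app (ς : PreSig S n) : (φ : Scope S) → App ς φ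
  | .nil => fun _ _ x => nomatch x
  | .snoc φ δ _ => fun _ _ x =>
    match x with
    | .zero => fun _ t ts => t.bind (app ς δ) (Env.ofSp ts)
    | .succ x => app ς φ x

/-- Hereditary substitution `e[t/δ]` for `e` in scope `γ.δ.θ` and `t ∈ Sp γ δ`. -/
def Ex.instUnder {γ δ : Scope S} (θ : Scope S) {k : Kind S} (e : Ex ς ((γ ⧺ δ) ⧺ θ) k)
    (ts : Sp ς γ δ) : Ex ς (γ ⧺ θ) k :=
  e.bind (app ς δ) ((Env.ofSp ts).lift θ)

/-- Hereditary substitution `e[t/δ]` for `e` in scope `γ.δ` and `t ∈ Sp γ δ`. -/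
def Ex.inst {γ δ : Scope S} {k : Kind S} (e : Ex ς (γ ⧺ δ) k) (ts : Sp ς γ δ) : Ex ς γ k :=
  e.bind (app ς δ) (Env.ofSp ts)

/-- Hereditary substitution `e[t/δ]` for `e` in scope `δ`, weakened to `γ.δ`, and
`t ∈ Sp γ δ`. -/
def Ex.subst {γ δ : Scope S} {k : Kind S} (e : Ex ς δ k) (ts : Sp ς γ δ) : Ex ς γ k :=
  (e.rename (Ren.wkr γ δ)).inst ts

/-- The recursive calls of hereditary substitution are substitutions. -/
theorem app_eq {φ : Scope S} {δ : Scope S} {s : S} (x : Var φ δ s) (γ : Scope S)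
    (t : Tm ς (γ ⧺ δ) s) (ts : Sp ς γ δ) : app ς φ x γ t ts = t.inst ts := by
  induction x with
  | zero => rfl
  | succ x ih => exact ih t ts

theorem Var.split_inl {γ δ : Scope S} {s : S} (θ : Scope S) (x : Var γ δ s) :
    Var.split θ (x.inl θ) = .inl x := by
  induction θ with
  | nil => rfl
  | snoc θ _ _ ih => simp [Var.inl, Var.split, ih]

theorem Var.split_inr {γ θ δ : Scope S} {s : S} (x : Var θ δ s) :
    Var.split θ (x.inr : Var (γ ⧺ θ) δ s) = .inr x := by
  induction x with
  | zero => rfl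
  | succ x ih => simp [Var.inr, Var.split, ih]

/-- `x(v)[u/γ₂] = u_x[v[u/γ₂]/δ]` when `x :: δ → s` is a variable of `γ₂`. -/
theorem instUnder_var_subst {γ δ θ β : Scope S} {s : S} (ts : Sp ς γ δ) (x : Var δ β s)
    (vs : Sp ς ((γ ⧺ δ) ⧺ θ) β) :
    Ex.instUnder θ (.var (Var.inl θ x.inr) vs) ts =
      ((ts.get x).rename ((Ren.wkl γ θ).lift β)).inst (vs.instUnder θ ts) := by
  simp only [Ex.instUnder, Ex.bind, Env.lift, Var.split_inl, Env.ofSp, Var.split_inr, app_eq]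

/-- `x(v)[u/γ₂] = x(v[u/γ₂])` when `x` is a variable of `γ₁`. -/
theorem instUnder_var_left {γ δ θ β : Scope S} {s : S} (ts : Sp ς γ δ) (x : Var γ β s)
    (vs : Sp ς ((γ ⧺ δ) ⧺ θ) β) :
    Ex.instUnder θ (.var (Var.inl θ (Var.inl δ x)) vs) ts =
      .var (Var.inl θ x) (vs.instUnder θ ts) := by
  simp only [Ex.instUnder, Ex.bind, Env.lift, Var.split_inl, Env.ofSp]

/-- `x(v)[u/γ₂] = x(v[u/γ₂])` when `x` is a variable of `γ₃`. -/
theorem instUnder_var_right {γ δ θ β : Scope S} {s : S} (ts : Sp ς γ δ) (x : Var θ β s)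
    (vs : Sp ς ((γ ⧺ δ) ⧺ θ) β) :
    Ex.instUnder θ (.var x.inr vs) ts = .var x.inr (vs.instUnder θ ts) := by
  simp only [Ex.instUnder, Ex.bind, Env.lift, Var.split_inr]

/-! ### Constants and variables occurring in an expression -/

/-- All the constants of the expression belong to `P`, that is, the expression lives in the
pre-signature restricted to `P`. -/
def Ex.Over (P : Set (Fin n)) : {γ : Scope S} → {k : Kind S} → Ex ς γ k → Prop
  | _, _, .var _ ts => ts.Over P
  | _, _, .con c _ ts => c ∈ P ∧ ts.Over P
  | _, _, .nil => True
  | _, _, .snoc ts t => ts.Over P ∧ t.Over P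
  | _, _, .tcon c _ _ ts => c ∈ P ∧ ts.Over P
  | _, _, .cnil => True
  | _, _, .csnoc Γ Δ T => Γ.Over P ∧ Δ.Over P ∧ T.Over P

/-- The variable `x` is free in the expression. -/
def Ex.Occurs : {γ β : Scope S} → {r : S} → {k : Kind S} → Var γ β r → Ex ς γ k → Prop
  | γ, _, _, _, x, .var y ts =>
    (⟨_, _, y⟩ : (δ : Scope S) × (s : S) × Var γ δ s) = ⟨_, _, x⟩ ∨ ts.Occurs x
  | _, _, _, _, x, .con _ _ ts => ts.Occurs x
  | _, _, _, _, _, .nil => False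
  | _, _, _, _, x, .snoc (θ := θ) ts t => ts.Occurs x ∨ t.Occurs (x.inl θ)
  | _, _, _, _, x, .tcon _ _ _ ts => ts.Occurs x
  | _, _, _, _, _, .cnil => False
  | _, _, _, _, x, .csnoc (δ := δ) (θ := θ) Γ Δ T =>
    Γ.Occurs x ∨ Δ.Occurs (x.inl δ) ∨ T.Occurs ((x.inl δ).inl θ)

/-! ## Closed contexts -/

/-- The contexts `Γ ∈ Ctx ()` with `|Γ| = γ`. -/
inductive Cx {S : Type u} {n : ℕ} (ς : PreSig S n) : Scope S → Type u
  | nil : Cx ς .nil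
  | snoc {γ δ : Scope S} {s : S} (Γ : Cx ς γ) (Δ : Ctx ς γ δ) (T : Ty ς (γ ⧺ δ) s) :
      Cx ς (γ.snoc δ s)

/-- Concatenation `Γ.Δ`. -/
def Cx.append {γ : Scope S} (Γ : Cx ς γ) : {δ : Scope S} → Ctx ς γ δ → Cx ς (γ ⧺ δ)
  | _, .cnil => Γ
  | _, .csnoc Δ Θ T => .snoc (Cx.append Γ Δ) Θ T

/-- A context `Δ ∈ Ctx ()` seen in `Ctx γ`. -/
def Cx.wk (γ : Scope S) : {δ : Scope S} → Cx ς δ → Ctx ς γ δ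
  | _, .nil => .cnil
  | _, .snoc (γ := δ) (δ := θ) Δ Θ T =>
    .csnoc (Cx.wk γ Δ) (Θ.rename (Ren.wkr γ δ)) (T.rename ((Ren.wkr γ δ).lift θ))

/-- The context `Δ` of the entry `x : Δ → T` of `Γ`. -/
def Cx.dom : {γ δ : Scope S} → {s : S} → Cx ς γ → Var γ δ s → Ctx ς γ δ
  | _, _, _, .snoc _ Δ _, .zero => Δ.rename (fun _ _ x => .succ x)
  | _, _, _, .snoc Γ _ _, .succ x => (Cx.dom Γ x).rename (fun _ _ x => .succ x)

/-- The type `T` of the entry `x : Δ → T` of `Γ`. -/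
def Cx.cod : {γ δ : Scope S} → {s : S} → Cx ς γ → Var γ δ s → Ty ς (γ ⧺ δ) s
  | _, _, _, .snoc (δ := δ) _ _ T, .zero => T.rename (Ren.lift (fun _ _ x => .succ x) δ)
  | _, δ, _, .snoc Γ _ _, .succ x => (Cx.cod Γ x).rename (Ren.lift (fun _ _ x => .succ x) δ)

def Cx.Over (P : Set (Fin n)) : {γ : Scope S} → Cx ς γ → Prop
  | _, .nil => True
  | _, .snoc Γ Δ T => Cx.Over P Γ ∧ Δ.Over P ∧ T.Over P

/-! ## Erased arguments and signatures -/

/-- `Erasure φ δ` is the set of the erasure assignments `ν` for contexts `Δ` with `|Δ| = φ`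
and `|Δ|_ν = δ`. -/
inductive Erasure {S : Type u} : Scope S → Scope S → Type u
  | nil : Erasure .nil .nil
  | keep {φ δ θ : Scope S} {s : S} (ν : Erasure φ δ) : Erasure (φ.snoc θ s) (δ.snoc θ s)
  | erase {φ δ θ : Scope S} {s : S} (ν : Erasure φ δ) : Erasure (φ.snoc θ s) δ

/-- The action `ν · t` on spines. -/
def Erasure.act {γ : Scope S} :
    {φ δ : Scope S} → Erasure φ δ → Sp ς γ φ → Sp ς γ δ
  | _, _, .nil, .nil => .nil
  | _, _, .keep ν, .snoc ts t => .snoc (ν.act ts) t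
  | _, _, .erase ν, .snoc ts _ => ν.act ts

/-- No argument is erased. -/
def Erasure.None : {φ δ : Scope S} → Erasure φ δ → Prop
  | _, _, .nil => True
  | _, _, .keep ν => ν.None
  | _, _, .erase _ => False

/-- The assignment that erases nothing. -/
def Erasure.keepAll : (φ : Scope S) → Erasure φ φ
  | .nil => .nil
  | .snoc φ _ _ => .keep (Erasure.keepAll φ)

/-- The assignment that erases everything. -/
def Erasure.eraseAll : (φ : Scope S) → Erasure φ .nil
  | .nil => .nil
  | .snoc φ _ _ => .erase (Erasure.eraseAll φ)

/-- The assignment that erases the arguments `φ` and keeps the further arguments `θ`. -/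
def Erasure.eraseKeep (φ : Scope S) : (θ : Scope S) → Erasure (φ ⧺ θ) θ
  | .nil => Erasure.eraseAll φ
  | .snoc θ _ _ => .keep (Erasure.eraseKeep φ θ)

/-- The extension of an assignment that keeps the further arguments `θ`. -/
def Erasure.keepMore {φ δ : Scope S} (ν : Erasure φ δ) :
    (θ : Scope S) → Erasure (φ ⧺ θ) (δ ⧺ θ)
  | .nil => ν
  | .snoc θ _ _ => .keep (Erasure.keepMore ν θ)

/-- The extension of an assignment that erases the further arguments `θ`. -/
def Erasure.eraseMore {φ δ : Scope S} (ν : Erasure φ δ) :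
    (θ : Scope S) → Erasure (φ ⧺ θ) δ
  | .nil => ν
  | .snoc θ _ _ => .erase (Erasure.eraseMore ν θ)

/-- Entries `Δ_ν → □` and `Δ_ν → T` of signatures. -/
inductive Entry {S : Type u} {n : ℕ} (ς : PreSig S n) : Type u
  | ty {φ δ : Scope S} (Δ : Cx ς φ) (ν : Erasure φ δ) : Entry ς
  | tm {φ δ : Scope S} {s : S} (Δ : Cx ς φ) (ν : Erasure φ δ) (T : Ty ς φ s) : Entry ς

/-- The erasure of an entry into an arity. -/
def Entry.arity : Entry ς → Arity S
  | .ty (δ := δ) _ _ => .ty δ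
  | .tm (δ := δ) (s := s) _ _ _ => .tm δ s

def Entry.Over (P : Set (Fin n)) : Entry ς → Prop
  | .ty Δ _ => Δ.Over P
  | .tm Δ _ T => Δ.Over P ∧ T.Over P

/-- The entry has no erased arguments. -/
def Entry.NoErased : Entry ς → Prop
  | .ty _ ν => ν.None
  | .tm _ ν _ => ν.None

/-- The signatures whose underlying pre-signature is `ς`.  The entry of a constant only uses
the constants that are declared before it. -/
structure Sig {S : Type u} {n : ℕ} (ς : PreSig S n) : Type u where
  era_injective : Function.Injective ς.era
  entry : Fin n → Entry ς
  arity_entry : ∀ c, (entry c).arity = ς.arity c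
  entry_over : ∀ c, (entry c).Over (Set.Iio c)

/-! ## Rewriting -/

/-- `e` is a higher-order pattern with respect to the free variables `flex`: every free variable
is applied to a list of (eta-long) distinct bound variables. -/
def Ex.PatternIn : {γ : Scope S} → {k : Kind S} →
    (∀ ⦃δ : Scope S⦄ ⦃s : S⦄, Var γ δ s → Prop) → Ex ς γ k → Prop
  | γ, _, flex, .var (δ := δ) x ts =>
    (flex x → ∃ ρ : Ren δ γ, (∀ ⦃θ : Scope S⦄ ⦃r : S⦄, Function.Injective (@ρ θ r)) ∧
      (∀ ⦃θ : Scope S⦄ ⦃r : S⦄ (y : Var δ θ r), ¬ flex (ρ y)) ∧ ts = (idSp ς δ).rename ρ) ∧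
    (¬ flex x → ts.PatternIn flex)
  | _, _, flex, .con _ _ ts => ts.PatternIn flex
  | _, _, _, .nil => True
  | _, _, flex, .snoc (θ := θ) ts t =>
    ts.PatternIn flex ∧
      t.PatternIn (fun _ _ x => Sum.elim (fun y => flex y) (fun _ => False) (Var.split θ x))
  | _, _, flex, .tcon _ _ _ ts => ts.PatternIn flex
  | _, _, _, .cnil => True
  | _, _, flex, .csnoc (δ := δ) (θ := θ) Γ Δ T =>
    Γ.PatternIn flex ∧
      Δ.PatternIn (fun _ _ x => Sum.elim (fun y => flex y) (fun _ => False) (Var.split δ x)) ∧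
      T.PatternIn (fun _ _ x => Sum.elim
        (fun y => Sum.elim (fun z => flex z) (fun _ => False) (Var.split δ y))
        (fun _ => False) (Var.split θ x))

/-- `t` is a higher-order pattern. -/
def Ex.IsPattern {γ : Scope S} {s : S} (t : Tm ς γ s) : Prop := t.PatternIn (fun _ _ _ => True)

/-- Rewrite systems over `ς`: `rule l r` means that `γ ⊩ l ⟼ r :: s` is a rule. -/
structure RewSys {S : Type u} {n : ℕ} (ς : PreSig S n) : Type u where
  rule : ∀ {γ : Scope S} {s : S}, Tm ς γ s → Tm ς γ s → Prop
  lhs_pattern : ∀ {γ : Scope S} {s : S} {l r : Tm ς γ s}, rule l r → l.IsPattern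
  free_vars : ∀ {γ : Scope S} {s : S} {l r : Tm ς γ s}, rule l r →
    ∀ {β : Scope S} {q : S} (x : Var γ β q), r.Occurs x → l.Occurs x

/-- One step of rewriting, in the pre-signature restricted to the constants in `P` and with the
rules over that pre-signature. -/
inductive RewSys.Step (R : RewSys ς) (P : Set (Fin n)) :
    {γ : Scope S} → {k : Kind S} → Ex ς γ k → Ex ς γ k → Prop
  | root {γ δ : Scope S} {s : S} {l r : Tm ς δ s} (hR : R.rule l r) (hl : l.Over P)
      (hr : r.Over P) (v : Sp ς γ δ) (hv : v.Over P) : R.Step P (l.subst v) (r.subst v)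
  | var {γ δ : Scope S} {s : S} (x : Var γ δ s) {ts us : Sp ς γ δ} :
      R.Step P ts us → R.Step P (Ex.var x ts) (Ex.var x us)
  | con {γ δ : Scope S} {s : S} (c : Fin n) (h : ς.arity c = .tm δ s) {ts us : Sp ς γ δ}
      (hc : c ∈ P) : R.Step P ts us → R.Step P (Ex.con c h ts) (Ex.con c h us)
  | snocL {γ δ θ : Scope S} {s : S} {ts us : Sp ς γ δ} (t : Tm ς (γ ⧺ θ) s) (ht : t.Over P) :
      R.Step P ts us → R.Step P (Ex.snoc ts t) (Ex.snoc us t)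
  | snocR {γ δ θ : Scope S} {s : S} (ts : Sp ς γ δ) {t u : Tm ς (γ ⧺ θ) s} (hts : ts.Over P) :
      R.Step P t u → R.Step P (Ex.snoc ts t) (Ex.snoc ts u)
  | tcon {γ δ : Scope S} {s : S} (c : Fin n) (h : ς.arity c = .ty δ) (hs : ς.era c = s)
      {ts us : Sp ς γ δ} (hc : c ∈ P) :
      R.Step P ts us → R.Step P (Ex.tcon c h hs ts) (Ex.tcon c h hs us)
  | csnoc₁ {γ δ θ : Scope S} {s : S} {Γ Γ' : Ctx ς γ δ} (Δ : Ctx ς (γ ⧺ δ) θ)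
      (T : Ty ς ((γ ⧺ δ) ⧺ θ) s) (hΔ : Δ.Over P) (hT : T.Over P) :
      R.Step P Γ Γ' → R.Step P (Ex.csnoc Γ Δ T) (Ex.csnoc Γ' Δ T)
  | csnoc₂ {γ δ θ : Scope S} {s : S} (Γ : Ctx ς γ δ) {Δ Δ' : Ctx ς (γ ⧺ δ) θ}
      (T : Ty ς ((γ ⧺ δ) ⧺ θ) s) (hΓ : Γ.Over P) (hT : T.Over P) :
      R.Step P Δ Δ' → R.Step P (Ex.csnoc Γ Δ T) (Ex.csnoc Γ Δ' T)
  | csnoc₃ {γ δ θ : Scope S} {s : S} (Γ : Ctx ς γ δ) (Δ : Ctx ς (γ ⧺ δ) θ)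
      {T T' : Ty ς ((γ ⧺ δ) ⧺ θ) s} (hΓ : Γ.Over P) (hΔ : Δ.Over P) :
      R.Step P T T' → R.Step P (Ex.csnoc Γ Δ T) (Ex.csnoc Γ Δ T')

/-- One step of rewriting. -/
abbrev RewSys.Red (R : RewSys ς) {γ : Scope S} {k : Kind S} (e e' : Ex ς γ k) : Prop :=
  R.Step Set.univ e e'

/-- Conversion, in the pre-signature restricted to `P`. -/
def RewSys.ConvIn (R : RewSys ς) (P : Set (Fin n)) {γ : Scope S} {k : Kind S}
    (e e' : Ex ς γ k) : Prop :=
  Relation.EqvGen (fun a b : Ex ς γ k => R.Step P a b) e e'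

/-- Conversion `e ≡ e'`. -/
abbrev RewSys.Conv (R : RewSys ς) {γ : Scope S} {k : Kind S} (e e' : Ex ς γ k) : Prop :=
  R.ConvIn Set.univ e e'

/-- The constant `c` is the head of a rewrite rule. -/
def RewSys.IsHead (R : RewSys ς) (c : Fin n) : Prop :=
  ∃ (γ δ : Scope S) (s : S) (h : ς.arity c = .tm δ s) (ts : Sp ς γ δ) (r : Tm ς γ s),
    R.rule (Ex.con c h ts) r

/-! ## Theories and typing -/

/-- A theory `(Σ, R)` with `|Σ| = ς`. -/
structure Theory {S : Type u} {n : ℕ} (ς : PreSig S n) : Type u where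
  sig : Sig ς
  rew : RewSys ς

/-- The judgments `Γ ⊢`, `Γ ⊢ T`, `Γ ⊢ t : T` and `Γ ⊢ t : Δ` (for a spine `t`). -/
inductive Jdg {S : Type u} {n : ℕ} (ς : PreSig S n) : Type u
  | ok {γ : Scope S} (Γ : Cx ς γ) : Jdg ς
  | ty {γ : Scope S} {s : S} (Γ : Cx ς γ) (T : Ty ς γ s) : Jdg ς
  | tm {γ : Scope S} {s : S} (Γ : Cx ς γ) (t : Tm ς γ s) (T : Ty ς γ s) : Jdg ς
  | sp {γ δ : Scope S} (Γ : Cx ς γ) (ts : Sp ς γ δ) (Δ : Ctx ς γ δ) : Jdg ς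

/-- Derivability in the theory restricted to the constants in `P` (a set that is closed under
earlier constants) and to the rewrite rules over them.  For `P = Set.univ` this is the theory
itself, and for `P = Set.Iio c` it is the theory `𝕋_{<c}` formed by what precedes `c`. -/
inductive Theory.Der (𝕋 : Theory ς) (P : Set (Fin n)) : Jdg ς → Prop
  | emptyCtx : 𝕋.Der P (.ok .nil)
  | extCtx {γ δ : Scope S} {s : S} {Γ : Cx ς γ} {Γ' : Ctx ς γ δ} {T : Ty ς (γ ⧺ δ) s} :
      𝕋.Der P (.ty (Γ.append Γ') T) → 𝕋.Der P (.ok (Γ.snoc Γ' T))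
  | type {γ φ δ : Scope S} {s : S} {Γ : Cx ς γ} {c : Fin n} {Δ : Cx ς φ} {ν : Erasure φ δ}
      {ts : Sp ς γ φ} (hc : c ∈ P) (hent : 𝕋.sig.entry c = .ty Δ ν) (h : ς.arity c = .ty δ)
      (hs : ς.era c = s) :
      𝕋.Der P (.sp Γ ts (Δ.wk γ)) → 𝕋.Der P (.ty Γ (Ex.tcon c h hs (ν.act ts)))
  | const {γ φ δ : Scope S} {s : S} {Γ : Cx ς γ} {c : Fin n} {Δ : Cx ς φ} {ν : Erasure φ δ}
      {T : Ty ς φ s} {ts : Sp ς γ φ} (hc : c ∈ P) (hent : 𝕋.sig.entry c = .tm Δ ν T)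
      (h : ς.arity c = .tm δ s) :
      𝕋.Der P (.sp Γ ts (Δ.wk γ)) → 𝕋.Der P (.tm Γ (Ex.con c h (ν.act ts)) (T.subst ts))
  | var {γ δ : Scope S} {s : S} {Γ : Cx ς γ} (x : Var γ δ s) {ts : Sp ς γ δ} :
      𝕋.Der P (.sp Γ ts (Γ.dom x)) → 𝕋.Der P (.tm Γ (Ex.var x ts) ((Γ.cod x).inst ts))
  | conv {γ : Scope S} {s : S} {Γ : Cx ς γ} {t : Tm ς γ s} {T U : Ty ς γ s} :
      𝕋.rew.ConvIn P T U → 𝕋.Der P (.tm Γ t T) → 𝕋.Der P (.ty Γ U) → 𝕋.Der P (.tm Γ t U)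
  | emptySp {γ : Scope S} {Γ : Cx ς γ} :
      𝕋.Der P (.ok Γ) → 𝕋.Der P (.sp Γ Ex.nil Ex.cnil)
  | extSp {γ δ θ : Scope S} {s : S} {Γ : Cx ς γ} {Δ : Ctx ς γ δ} {Γ' : Ctx ς (γ ⧺ δ) θ}
      {T : Ty ς ((γ ⧺ δ) ⧺ θ) s} {ts : Sp ς γ δ} {t : Tm ς (γ ⧺ θ) s}
      (hΓ' : Γ'.Over P) (hT : T.Over P) :
      𝕋.Der P (.sp Γ ts Δ) →
      𝕋.Der P (.tm (Γ.append (Γ'.inst ts)) t (T.instUnder θ ts)) →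
      𝕋.Der P (.sp Γ (Ex.snoc ts t) (Ex.csnoc Δ Γ' T))

/-- `Γ ⊢`. -/
abbrev Theory.WfCtx (𝕋 : Theory ς) {γ : Scope S} (Γ : Cx ς γ) : Prop :=
  𝕋.Der Set.univ (.ok Γ)

/-- `Γ ⊢ T`. -/
abbrev Theory.IsType (𝕋 : Theory ς) {γ : Scope S} {s : S} (Γ : Cx ς γ) (T : Ty ς γ s) : Prop :=
  𝕋.Der Set.univ (.ty Γ T)

/-- `Γ ⊢ t : T`. -/
abbrev Theory.HasType (𝕋 : Theory ς) {γ : Scope S} {s : S} (Γ : Cx ς γ) (t : Tm ς γ s)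
    (T : Ty ς γ s) : Prop :=
  𝕋.Der Set.univ (.tm Γ t T)

/-- `Γ ⊢ t : Δ` for a spine `t`. -/
abbrev Theory.HasCtx (𝕋 : Theory ς) {γ δ : Scope S} (Γ : Cx ς γ) (ts : Sp ς γ δ)
    (Δ : Ctx ς γ δ) : Prop :=
  𝕋.Der Set.univ (.sp Γ ts Δ)

/-- Confluence of the rewrite system (on terms). -/
def Theory.Confluent (𝕋 : Theory ς) : Prop :=
  ∀ {γ : Scope S} {s : S} (t₀ t₁ t₂ : Tm ς γ s),
    Relation.ReflTransGen 𝕋.rew.Red t₀ t₁ → Relation.ReflTransGen 𝕋.rew.Red t₀ t₂ →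
    ∃ t₃, Relation.ReflTransGen 𝕋.rew.Red t₁ t₃ ∧ Relation.ReflTransGen 𝕋.rew.Red t₂ t₃

/-- Strong normalisation of the well-typed terms. -/
def Theory.StronglyNormalising (𝕋 : Theory ς) : Prop :=
  ∀ {γ : Scope S} {s : S} (Γ : Cx ς γ) (t : Tm ς γ s) (T : Ty ς γ s),
    𝕋.HasType Γ t T → Acc (fun a b : Tm ς γ s => 𝕋.rew.Red b a) t

/-- Subject reduction. -/
def Theory.SubjectReduction (𝕋 : Theory ς) : Prop :=
  ∀ {γ : Scope S} {s : S} (Γ : Cx ς γ) (t t' : Tm ς γ s) (T : Ty ς γ s),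
    𝕋.HasType Γ t T → 𝕋.rew.Red t t' → 𝕋.HasType Γ t' T

/-- A reduction strategy: a functional relation, contained in the (non-empty) many-step
rewriting, with the same normal forms as rewriting. -/
structure Theory.Strategy (𝕋 : Theory ς) : Type u where
  rel : ∀ {γ : Scope S} {k : Kind S}, Ex ς γ k → Ex ς γ k → Prop
  functional : ∀ {γ : Scope S} {k : Kind S} {e e₁ e₂ : Ex ς γ k}, rel e e₁ → rel e e₂ → e₁ = e₂
  sub : ∀ {γ : Scope S} {k : Kind S} {e e' : Ex ς γ k}, rel e e' →
    Relation.TransGen 𝕋.rew.Red e e'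
  normal_iff : ∀ {γ : Scope S} {k : Kind S} (e : Ex ς γ k),
    (¬ ∃ e', rel e e') ↔ ¬ ∃ e', 𝕋.rew.Red e e'

/-- Reflexive transitive closure of the strategy. -/
abbrev Theory.Strategy.Reds {𝕋 : Theory ς} (𝔖 : 𝕋.Strategy) {γ : Scope S} {k : Kind S}
    (e e' : Ex ς γ k) : Prop :=
  Relation.ReflTransGen 𝔖.rel e e'

/-- `nf(e)` is defined and equal to `e'`. -/
def Theory.Strategy.Nf {𝕋 : Theory ς} (𝔖 : 𝕋.Strategy) {γ : Scope S} {k : Kind S}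
    (e e' : Ex ς γ k) : Prop :=
  𝔖.Reds e e' ∧ ¬ ∃ e'', 𝔖.rel e' e''

/-! ## Patterns and matching -/

/-- Fully applied patterns `Tm^P γ γ₀ s`, `Sp^P γ γ₀ δ` and `Ty^P γ γ₀`, with flexible variables
`γ` and rigid variables `γ₀`. -/
inductive Pat {S : Type u} {n : ℕ} (ς : PreSig S n) : Scope S → Scope S → Kind S → Type u
  | rigid {γ γ₀ δ : Scope S} {s : S} (c : Fin n) (h : ς.arity c = .tm δ s)
      (ts : Pat ς γ γ₀ (.sp δ)) : Pat ς γ γ₀ (.tm s)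
  | flex {γ₀ : Scope S} {s : S} : Pat ς (Scope.nil.snoc γ₀ s) γ₀ (.tm s)
  | nil {γ₀ : Scope S} : Pat ς .nil γ₀ (.sp .nil)
  | snoc {γ₁ γ₁₂ γ₂ γ₀ γₓ δ : Scope S} {s : S} (ts : Pat ς (γ₁ ⧺ γ₁₂) γ₀ (.sp δ))
      (t : Pat ς (γ₁₂ ⧺ γ₂) (γ₀ ⧺ γₓ) (.tm s)) :
      Pat ς ((γ₁ ⧺ γ₁₂) ⧺ γ₂) γ₀ (.sp (δ.snoc γₓ s))
  | type {γ γ₀ δ : Scope S} {s : S} (c : Fin n) (h : ς.arity c = .ty δ) (hs : ς.era c = s)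
      (ts : Pat ς γ γ₀ (.sp δ)) : Pat ς γ γ₀ (.ty s)

/-- The inclusion of patterns into expressions. -/
def Pat.toEx : {γ γ₀ : Scope S} → {k : Kind S} → Pat ς γ γ₀ k → Ex ς (γ ⧺ γ₀) k
  | _, _, _, .rigid c h ts => .con c h ts.toEx
  | _, _, _, .flex (γ₀ := γ₀) => .var (Var.inl γ₀ .zero) ((idSp ς γ₀).rename (Ren.wkr _ γ₀))
  | _, _, _, .nil => .nil
  | _, _, _, .snoc (γ₁ := γ₁) (γ₁₂ := γ₁₂) (γ₂ := γ₂) (γ₀ := γ₀) (γₓ := γₓ) ts t =>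
    .snoc (ts.toEx.rename ((Ren.wkl (γ₁ ⧺ γ₁₂) γ₂).lift γ₀))
      ((t.toEx.rename (((Ren.wkr γ₁ γ₁₂).lift γ₂).lift (γ₀ ⧺ γₓ))).rename
        (Ren.assocL ((γ₁ ⧺ γ₁₂) ⧺ γ₂) γ₀ γₓ))
  | _, _, _, .type c h hs ts => .tcon c h hs ts.toEx

/-- A pattern is rigid when none of its constants is the head of a rewrite rule, and all of its
constants have no erased arguments. -/
def Pat.Rigid (𝕋 : Theory ς) : {γ γ₀ : Scope S} → {k : Kind S} → Pat ς γ γ₀ k → Prop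
  | _, _, _, .rigid c _ ts => ¬ 𝕋.rew.IsHead c ∧ (𝕋.sig.entry c).NoErased ∧ ts.Rigid 𝕋
  | _, _, _, .flex => True
  | _, _, _, .nil => True
  | _, _, _, .snoc ts t => ts.Rigid 𝕋 ∧ t.Rigid 𝕋
  | _, _, _, .type c _ _ ts => ¬ 𝕋.rew.IsHead c ∧ (𝕋.sig.entry c).NoErased ∧ ts.Rigid 𝕋

/-- The matching algorithm: `Match 𝔖 p u v` means `p ≺ u ⇝ v / x_γ`. -/
inductive Match {𝕋 : Theory ς} (𝔖 : 𝕋.Strategy) :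
    {γ γ₀ γf : Scope S} → {k : Kind S} → Pat ς γ γ₀ k → Ex ς (γf ⧺ γ₀) k → Sp ς γf γ → Prop
  | rigid {γ γ₀ γf δ : Scope S} {s : S} {c : Fin n} {h : ς.arity c = .tm δ s}
      {ts : Pat ς γ γ₀ (.sp δ)} {u : Tm ς (γf ⧺ γ₀) s} {us : Sp ς (γf ⧺ γ₀) δ}
      {v : Sp ς γf γ} :
      𝔖.Reds u (Ex.con c h us) → Match 𝔖 ts us v → Match 𝔖 (Pat.rigid c h ts) u v
  | flex {γ₀ γf : Scope S} {s : S} (u : Tm ς (γf ⧺ γ₀) s) :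
      Match 𝔖 (Pat.flex (γ₀ := γ₀) (s := s)) u (Ex.snoc Ex.nil u)
  | nil {γ₀ γf : Scope S} :
      Match 𝔖 (Pat.nil (γ₀ := γ₀)) (Ex.nil (γ := γf ⧺ γ₀)) (Ex.nil (γ := γf))
  | snoc {γ₁ γ₁₂ γ₂ γ₀ γₓ γf δ : Scope S} {s : S} {ts : Pat ς (γ₁ ⧺ γ₁₂) γ₀ (.sp δ)}
      {t : Pat ς (γ₁₂ ⧺ γ₂) (γ₀ ⧺ γₓ) (.tm s)} {us : Sp ς (γf ⧺ γ₀) δ}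
      {u : Tm ς ((γf ⧺ γ₀) ⧺ γₓ) s} {v₁ : Sp ς γf γ₁} {w₁ w₂ w : Sp ς γf γ₁₂}
      {v₂ : Sp ς γf γ₂} :
      Match 𝔖 ts us (v₁.spAppend w₁) →
      Match 𝔖 t (u.rename (Ren.assocR γf γ₀ γₓ)) (w₂.spAppend v₂) →
      𝔖.Nf w₁ w → 𝔖.Nf w₂ w →
      Match 𝔖 (Pat.snoc ts t) (Ex.snoc us u) ((v₁.spAppend w).spAppend v₂)
  | type {γ γ₀ γf δ : Scope S} {s : S} {c : Fin n} {h : ς.arity c = .ty δ} {hs : ς.era c = s}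
      {ts : Pat ς γ γ₀ (.sp δ)} {us : Sp ς (γf ⧺ γ₀) δ} {v : Sp ς γf γ} :
      Match 𝔖 ts us v → Match 𝔖 (Pat.type c h hs ts) (Ex.tcon c h hs us) v

/-! ## Moded pre-signatures and well-moded expressions -/

/-- Entries of moded pre-signatures. -/
inductive MArity (S : Type u) : Type u
  /-- `c :: δ⁻ → □` -/
  | ty (δ : Scope S) : MArity S
  /-- `c⁺ :: δ⁻ → s` -/
  | pos (δ : Scope S) (s : S) : MArity S
  /-- `c⁻ :: δ⁻ → s` -/
  | neg (δ : Scope S) (s : S) : MArity S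
  /-- `c⁺ :: δ₁⁻ (x :: γ → sₓ)⁺ δ₂⁻ → s` -/
  | inf (δ₁ γₓ : Scope S) (sₓ : S) (δ₂ : Scope S) (s : S) : MArity S

/-- The arity underlying an entry of a moded pre-signature. -/
def MArity.arity : MArity S → Arity S
  | .ty δ => .ty δ
  | .pos δ s => .tm δ s
  | .neg δ s => .tm δ s
  | .inf δ₁ γₓ sₓ δ₂ s => .tm ((δ₁.snoc γₓ sₓ) ⧺ δ₂) s

/-- The families of well-moded expressions: `plus` for the inferable terms `Tm⁺`, `minus` for
the checkable terms `Tm⁻`, `both` for the spines `Sp⁺⁻` and the types `Ty⁺⁻`. -/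
inductive Mode : Type
  | plus : Mode
  | minus : Mode
  | both : Mode

/-- Well-moded terms, spines and types over the moded pre-signature `m`. -/
inductive WellModed (m : Fin n → MArity S) :
    Mode → {γ : Scope S} → {k : Kind S} → Ex ς γ k → Prop
  | var {γ δ : Scope S} {s : S} (x : Var γ δ s) {ts : Sp ς γ δ} :
      WellModed m .both ts → WellModed m .plus (Ex.var x ts)
  | const {γ δ : Scope S} {s : S} {c : Fin n} (hm : m c = .pos δ s) (h : ς.arity c = .tm δ s)
      {ts : Sp ς γ δ} : WellModed m .both ts → WellModed m .plus (Ex.con c h ts)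
  | constNeg {γ δ : Scope S} {s : S} {c : Fin n} (hm : m c = .neg δ s)
      (h : ς.arity c = .tm δ s) {ts : Sp ς γ δ} :
      WellModed m .both ts → WellModed m .minus (Ex.con c h ts)
  | constPos {γ δ₁ γₓ δ₂ : Scope S} {sₓ s : S} {c : Fin n} (hm : m c = .inf δ₁ γₓ sₓ δ₂ s)
      (h : ς.arity c = .tm ((δ₁.snoc γₓ sₓ) ⧺ δ₂) s) {ts : Sp ς γ δ₁} {t : Tm ς (γ ⧺ γₓ) sₓ}
      {us : Sp ς γ δ₂} :
      WellModed m .both ts → WellModed m .plus t → WellModed m .both us →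
      WellModed m .plus (Ex.con c h (Ex.spAppend (Ex.snoc ts t) us))
  | switch {γ : Scope S} {s : S} {t : Tm ς γ s} : WellModed m .plus t → WellModed m .minus t
  | emptySp {γ : Scope S} : WellModed m .both (Ex.nil (γ := γ))
  | extSp {γ δ θ : Scope S} {s : S} {ts : Sp ς γ δ} {t : Tm ς (γ ⧺ θ) s} :
      WellModed m .both ts → WellModed m .minus t → WellModed m .both (Ex.snoc ts t)
  | type {γ δ : Scope S} {s : S} {c : Fin n} (hm : m c = .ty δ) (h : ς.arity c = .ty δ)
      (hs : ς.era c = s) {ts : Sp ς γ δ} :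
      WellModed m .both ts → WellModed m .both (Ex.tcon c h hs ts)

/-! ## Moded signatures and moded theories -/

/-- Entries of moded signatures. -/
inductive MEntry {S : Type u} {n : ℕ} (ς : PreSig S n) : Type u
  /-- `c : Δ⁻ → □` -/
  | ty {δ : Scope S} (Δ : Cx ς δ) : MEntry ς
  /-- `c⁺ : Δ⁻ → T` -/
  | pos {δ : Scope S} {s : S} (Δ : Cx ς δ) (T : Ty ς δ s) : MEntry ς
  /-- `c⁻ : {Δ'} Δ⁻ → T` -/
  | neg {δ' δ : Scope S} {s : S} (Δ' : Cx ς δ') (Δ : Ctx ς δ' δ) (T : Pat ς δ' .nil (.ty s)) :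
      MEntry ς
  /-- `c⁺ : Δ₁⁻ {Δ'} (x : Γₓ → T)⁺ Δ₂⁻ → U` -/
  | inf {δ₁ δ' γₓ δ₂ : Scope S} {sₓ s : S} (Δ₁ : Cx ς δ₁) (Δ' : Ctx ς δ₁ δ')
      (Γₓ : Ctx ς δ₁ γₓ) (T : Pat ς δ' γₓ (.ty sₓ))
      (Δ₂ : Ctx ς ((δ₁ ⧺ δ').snoc γₓ sₓ) δ₂) (U : Ty ς (((δ₁ ⧺ δ').snoc γₓ sₓ) ⧺ δ₂) s) :
      MEntry ς

/-- The context `Δ₁.Δ', x : Γₓ → T, Δ₂`. -/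
def infCx {δ₁ δ' γₓ δ₂ : Scope S} {sₓ : S} (Δ₁ : Cx ς δ₁) (Δ' : Ctx ς δ₁ δ')
    (Γₓ : Ctx ς δ₁ γₓ) (T : Pat ς δ' γₓ (.ty sₓ)) (Δ₂ : Ctx ς ((δ₁ ⧺ δ').snoc γₓ sₓ) δ₂) :
    Cx ς (((δ₁ ⧺ δ').snoc γₓ sₓ) ⧺ δ₂) :=
  Cx.append
    (Cx.snoc (Δ₁.append Δ') (Γₓ.rename (Ren.wkl δ₁ δ'))
      (T.toEx.rename ((Ren.wkr δ₁ δ').lift γₓ)))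
    Δ₂

/-- The underlying entry of an entry of a moded signature: the modes are forgotten, the
arguments in `{Δ'}` are erased and the other ones are not. -/
def MEntry.toEntry : MEntry ς → Entry ς
  | .ty (δ := δ) Δ => .ty Δ (Erasure.keepAll δ)
  | .pos (δ := δ) Δ T => .tm Δ (Erasure.keepAll δ) T
  | .neg (δ' := δ') (δ := δ) (s := s) Δ' Δ T =>
    .tm (Δ'.append Δ) (Erasure.eraseKeep δ' δ)
      (Ex.rename (k := .ty s) (Ren.wkl δ' δ) T.toEx)
  | .inf (δ₁ := δ₁) (δ' := δ') (δ₂ := δ₂) Δ₁ Δ' Γₓ T Δ₂ U =>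
    .tm (infCx Δ₁ Δ' Γₓ T Δ₂)
      (Erasure.keepMore (.keep ((Erasure.keepAll δ₁).eraseMore δ')) δ₂) U

/-- The entry of the moded pre-signature given by an entry of a moded signature. -/
def MEntry.marity : MEntry ς → MArity S
  | .ty (δ := δ) _ => .ty δ
  | .pos (δ := δ) (s := s) _ _ => .pos δ s
  | .neg (δ := δ) (s := s) _ _ _ => .neg δ s
  | .inf (δ₁ := δ₁) (γₓ := γₓ) (δ₂ := δ₂) (sₓ := sₓ) (s := s) _ _ _ _ _ _ =>
    .inf δ₁ γₓ sₓ δ₂ s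

/-- The two ways of erasing an entry of a moded signature into an arity agree. -/
theorem MEntry.arity_toEntry (e : MEntry ς) : e.toEntry.arity = e.marity.arity := by
  cases e <;> rfl

/-- The moded signatures whose underlying pre-signature is `ς`. -/
structure MSig {S : Type u} {n : ℕ} (ς : PreSig S n) : Type u where
  era_injective : Function.Injective ς.era
  entry : Fin n → MEntry ς
  arity_entry : ∀ c, (entry c).marity.arity = ς.arity c
  entry_over : ∀ c, (entry c).toEntry.Over (Set.Iio c)

/-- The underlying signature. -/
def MSig.toSig (M : MSig ς) : Sig ς where
  era_injective := M.era_injective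
  entry c := (M.entry c).toEntry
  arity_entry c := ((M.entry c).arity_toEntry).trans (M.arity_entry c)
  entry_over := M.entry_over

/-- Moded theories. -/
structure ModedTheory {S : Type u} {n : ℕ} (ς : PreSig S n) : Type u where
  msig : MSig ς
  rew : RewSys ς

/-- The underlying theory. -/
def ModedTheory.toTheory (𝕄 : ModedTheory ς) : Theory ς where
  sig := 𝕄.msig.toSig
  rew := 𝕄.rew

/-- The underlying moded pre-signature. -/
def ModedTheory.marity (𝕄 : ModedTheory ς) (c : Fin n) : MArity S := (𝕄.msig.entry c).marity

/-- What well-typedness of the moded theory requires of the entry of the constant `c`. -/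
def ModedTheory.WellTypedEntry (𝕄 : ModedTheory ς) (c : Fin n) : MEntry ς → Prop
  | .ty Δ => 𝕄.toTheory.Der (Set.Iio c) (.ok Δ)
  | .pos Δ T => 𝕄.toTheory.Der (Set.Iio c) (.ty Δ T)
  | .neg (s := s) Δ' Δ T =>
    𝕄.toTheory.Der (Set.Iio c) (.ok (Δ'.append Δ)) ∧
      𝕄.toTheory.Der (Set.Iio c) (.ty (s := s) Δ' T.toEx) ∧ T.Rigid 𝕄.toTheory
  | .inf Δ₁ Δ' Γₓ T Δ₂ U =>
    𝕄.toTheory.Der (Set.Iio c) (.ty (infCx Δ₁ Δ' Γₓ T Δ₂) U) ∧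
      𝕄.toTheory.Der (Set.Iio c) (.ok (Δ₁.append Γₓ)) ∧ T.Rigid 𝕄.toTheory

/-- Well-typed moded theories. -/
def ModedTheory.WellTyped (𝕄 : ModedTheory ς) : Prop :=
  ∀ c, 𝕄.WellTypedEntry c (𝕄.msig.entry c)

/-! ## The bidirectional typing algorithm -/

/-- The judgments `Γ ⊢ t ⇒ T`, `Γ ⊢ t ⇐ T`, `Γ ⊢ T ⇔ □` and `Γ ⊢ t ⇐ Δ` (for a spine `t`). -/
inductive AlgJdg {S : Type u} {n : ℕ} (ς : PreSig S n) : Type u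
  | inf {γ : Scope S} {s : S} (Γ : Cx ς γ) (t : Tm ς γ s) (T : Ty ς γ s) : AlgJdg ς
  | chk {γ : Scope S} {s : S} (Γ : Cx ς γ) (t : Tm ς γ s) (T : Ty ς γ s) : AlgJdg ς
  | ty {γ : Scope S} {s : S} (Γ : Cx ς γ) (T : Ty ς γ s) : AlgJdg ς
  | sp {γ δ : Scope S} (Γ : Cx ς γ) (ts : Sp ς γ δ) (Δ : Ctx ς γ δ) : AlgJdg ς

/-- `t` is of the form `c⁻(t)`. -/
def ModedTheory.IsNeg (𝕄 : ModedTheory ς) {γ : Scope S} {s : S} (t : Tm ς γ s) : Prop :=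
  ∃ (c : Fin n) (δ : Scope S) (h : ς.arity c = .tm δ s) (ts : Sp ς γ δ),
    𝕄.marity c = .neg δ s ∧ t = Ex.con c h ts

/-- The rules of the algorithm. -/
inductive ModedTheory.Alg (𝕄 : ModedTheory ς) (𝔖 : 𝕄.toTheory.Strategy) : AlgJdg ς → Prop
  | var {γ δ : Scope S} {s : S} {Γ : Cx ς γ} (x : Var γ δ s) {ts : Sp ς γ δ} :
      𝕄.Alg 𝔖 (.sp Γ ts (Γ.dom x)) → 𝕄.Alg 𝔖 (.inf Γ (Ex.var x ts) ((Γ.cod x).inst ts))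
  | const {γ δ : Scope S} {s : S} {Γ : Cx ς γ} {c : Fin n} {Δ : Cx ς δ} {T : Ty ς δ s}
      {ts : Sp ς γ δ} (hent : 𝕄.msig.entry c = .pos Δ T) (h : ς.arity c = .tm δ s) :
      𝕄.Alg 𝔖 (.sp Γ ts (Δ.wk γ)) → 𝕄.Alg 𝔖 (.inf Γ (Ex.con c h ts) (T.subst ts))
  | constPos {γ δ₁ δ' γₓ δ₂ : Scope S} {sₓ s : S} {Γ : Cx ς γ} {c : Fin n} {Δ₁ : Cx ς δ₁}
      {Δ' : Ctx ς δ₁ δ'} {Γₓ : Ctx ς δ₁ γₓ} {T : Pat ς δ' γₓ (.ty sₓ)}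
      {Δ₂ : Ctx ς ((δ₁ ⧺ δ').snoc γₓ sₓ) δ₂} {U : Ty ς (((δ₁ ⧺ δ').snoc γₓ sₓ) ⧺ δ₂) s}
      {ts : Sp ς γ δ₁} {t : Tm ς (γ ⧺ γₓ) sₓ} {V : Ty ς (γ ⧺ γₓ) sₓ} {v : Sp ς γ δ'}
      {us : Sp ς γ δ₂} (hent : 𝕄.msig.entry c = .inf Δ₁ Δ' Γₓ T Δ₂ U)
      (h : ς.arity c = .tm ((δ₁.snoc γₓ sₓ) ⧺ δ₂) s) :
      𝕄.Alg 𝔖 (.sp Γ ts (Δ₁.wk γ)) →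
      𝕄.Alg 𝔖 (.inf (Γ.append (Γₓ.subst ts)) t V) →
      Match 𝔖 T V v →
      𝕄.Alg 𝔖 (.sp Γ us (Δ₂.subst (Ex.snoc (ts.spAppend v) t))) →
      𝕄.Alg 𝔖 (.inf Γ (Ex.con c h (Ex.spAppend (Ex.snoc ts t) us))
        (U.subst (Ex.spAppend (Ex.snoc (ts.spAppend v) t) us)))
  | switch {γ : Scope S} {s : S} {Γ : Cx ς γ} {t : Tm ς γ s} {T U W : Ty ς γ s}
      (ht : ¬ 𝕄.IsNeg t) :
      𝕄.Alg 𝔖 (.inf Γ t U) → 𝔖.Nf T W → 𝔖.Nf U W → 𝕄.Alg 𝔖 (.chk Γ t T)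
  | constNeg {γ δ' δ : Scope S} {s : S} {Γ : Cx ς γ} {c : Fin n} {Δ' : Cx ς δ'}
      {Δ : Ctx ς δ' δ} {T : Pat ς δ' .nil (.ty s)} {V : Ty ς γ s} {v : Sp ς γ δ'}
      {ts : Sp ς γ δ} (hent : 𝕄.msig.entry c = .neg Δ' Δ T) (h : ς.arity c = .tm δ s) :
      Match 𝔖 T (γ₀ := .nil) (γf := γ) V v →
      𝕄.Alg 𝔖 (.sp Γ ts (Δ.subst v)) → 𝕄.Alg 𝔖 (.chk Γ (Ex.con c h ts) V)
  | type {γ δ : Scope S} {s : S} {Γ : Cx ς γ} {c : Fin n} {Δ : Cx ς δ} {ts : Sp ς γ δ}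
      (hent : 𝕄.msig.entry c = .ty Δ) (h : ς.arity c = .ty δ) (hs : ς.era c = s) :
      𝕄.Alg 𝔖 (.sp Γ ts (Δ.wk γ)) → 𝕄.Alg 𝔖 (.ty Γ (Ex.tcon c h hs ts))
  | emptySp {γ : Scope S} {Γ : Cx ς γ} : 𝕄.Alg 𝔖 (.sp Γ Ex.nil Ex.cnil)
  | extSp {γ δ θ : Scope S} {s : S} {Γ : Cx ς γ} {Δ : Ctx ς γ δ} {Γₓ : Ctx ς (γ ⧺ δ) θ}
      {T : Ty ς ((γ ⧺ δ) ⧺ θ) s} {ts : Sp ς γ δ} {t : Tm ς (γ ⧺ θ) s} :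
      𝕄.Alg 𝔖 (.sp Γ ts Δ) →
      𝕄.Alg 𝔖 (.chk (Γ.append (Γₓ.inst ts)) t (T.instUnder θ ts)) →
      𝕄.Alg 𝔖 (.sp Γ (Ex.snoc ts t) (Ex.csnoc Δ Γₓ T))

end Raw

end CompLF

/-! The proof is an induction on the derivation that the expression is well-moded (`complete`). For
inferable terms the induction hypothesis is strengthened: the inferred type is well-formed and every
type of the term is convertible to it. Uniqueness of types is thus proved together with
completeness, which needs it: at a constant with an inferable argument, the type inferred for that
argument has to be compared with the type that the given derivation assigns to it.

The crux is to recover the erased arguments. Inversion of typing (`neg_inv`, `inf_inv`) yields some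
typed erased spine `w` such that the type `V` at hand is convertible to the pattern instance `T[w]`.
Three facts about matching the rigid pattern `T` against `V` then carry the proof. Matching succeeds
(`exists_match`): well-typedness makes `V` strongly normalising, and confluence forces the head
constants of `T` to show up in normal forms, because these constants are not heads of rules. The
result `v` is convertible to `w` (`Match.conv`), since such constants are injective up to
conversion; this is also why the two values found for a shared variable have the same normal form.
Finally `v` is well-typed (`Match.hasType` followed by `hasCtx_of_conv`): pattern and matched
expression are inverted in parallel, which loses nothing because rigid constants have no erased
arguments, until a flexible variable is reached; there the typing of the variable applied to its
bound variables determines its entry up to conversion. Since `v` and `w` are convertible, arguments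
typed over `w` are also typed over `v`.

The rest is metatheory of the framework. Hereditary substitution is controlled by the rank of
scopes: the arity of a variable has smaller rank than its scope (`Var.rank_lt`). The composition law
(`Ex.sub_sub`), compatibility with conversion (`conv_sub_aux`) and stability of typing
(`Der.stable`) are all proved by induction on a bound for the ranks of the variables that are really
replaced by terms. Confluence and strong normalisation are assumed for terms only, and extend to
spines and types because rules rewrite only terms. -/

namespace CompLF

universe u

/-! ### Ranks of scopes and equations between renamings -/

section Scopes

variable {S : Type u}

/-- The nesting depth of a scope. -/
def Scope.rank : Scope S → ℕ
  | .nil => 0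
  | .snoc γ δ _ => max γ.rank (δ.rank + 1)

/-- The measure behind hereditary substitution: replacing `x` triggers a substitution for the
variables of its arity `δ`, and this scope is of smaller rank. -/
theorem Var.rank_lt {γ δ : Scope S} {s : S} (x : Var γ δ s) : δ.rank < γ.rank := by
  induction x with
  | zero => simp [Scope.rank]
  | succ x ih => simp only [Scope.rank]; omega

theorem Var.inl_or_inr {γ : Scope S} (θ : Scope S) {δ : Scope S} {s : S} (x : Var (γ ⧺ θ) δ s) :
    (∃ y : Var γ δ s, x = y.inl θ) ∨ ∃ z : Var θ δ s, x = z.inr := by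
  induction θ with
  | nil => exact .inl ⟨x, rfl⟩
  | snoc θ _ _ ih =>
    cases x with
    | zero => exact .inr ⟨.zero, rfl⟩
    | succ x =>
      rcases ih x with ⟨y, rfl⟩ | ⟨z, rfl⟩
      · exact .inl ⟨y, rfl⟩
      · exact .inr ⟨.succ z, rfl⟩

namespace Ren

variable {γ γ' γ'' : Scope S}

@[simp] theorem lift_inl (ρ : Ren γ γ') (θ : Scope S) {δ : Scope S} {s : S} (y : Var γ δ s) :
    ρ.lift θ (y.inl θ) = (ρ y).inl θ := by
  induction θ with
  | nil => rfl
  | snoc θ _ _ ih => exact congrArg Var.succ ih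

@[simp] theorem lift_inr (ρ : Ren γ γ') {θ δ : Scope S} {s : S} (z : Var θ δ s) :
    ρ.lift θ (z.inr) = z.inr := by
  induction z with
  | zero => rfl
  | succ z ih => exact congrArg Var.succ ih

theorem ext_append {θ : Scope S} {ρ ρ' : Ren (γ ⧺ θ) γ'}
    (hl : ∀ ⦃δ s⦄ (y : Var γ δ s), ρ (y.inl θ) = ρ' (y.inl θ))
    (hr : ∀ ⦃δ s⦄ (z : Var θ δ s), ρ z.inr = ρ' z.inr) : ρ = ρ' := by
  funext δ s x
  rcases x.inl_or_inr θ with ⟨y, rfl⟩ | ⟨z, rfl⟩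
  · exact hl y
  · exact hr z

/-- Composition of renamings, in diagrammatic order. -/
def comp (ρ : Ren γ γ') (ρ' : Ren γ' γ'') : Ren γ γ'' := fun _ _ x => ρ' (ρ x)

/-- The identity renaming. -/
def id (γ : Scope S) : Ren γ γ := fun _ _ x => x

@[simp] theorem comp_apply (ρ : Ren γ γ') (ρ' : Ren γ' γ'') {δ : Scope S} {s : S}
    (x : Var γ δ s) : ρ.comp ρ' x = ρ' (ρ x) := rfl

@[simp] theorem id_apply {δ : Scope S} {s : S} (x : Var γ δ s) : Ren.id γ x = x := rfl

@[simp] theorem wkl_apply (θ : Scope S) {δ : Scope S} {s : S} (x : Var γ δ s) :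
    Ren.wkl γ θ x = x.inl θ := rfl

@[simp] theorem wkr_apply (θ : Scope S) {δ : Scope S} {s : S} (x : Var θ δ s) :
    Ren.wkr γ θ x = x.inr := rfl

theorem lift_comp (ρ : Ren γ γ') (ρ' : Ren γ' γ'') (θ : Scope S) :
    (ρ.lift θ).comp (ρ'.lift θ) = (ρ.comp ρ').lift θ :=
  ext_append (by simp) (by simp)

@[simp] theorem lift_id (θ : Scope S) : (Ren.id γ).lift θ = Ren.id (γ ⧺ θ) :=
  ext_append (by simp) (by simp)

@[simp] theorem assocR_inl_inl (γ δ θ : Scope S) {β : Scope S} {s : S} (y : Var γ β s) :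
    assocR γ δ θ ((y.inl δ).inl θ) = y.inl (δ ⧺ θ) := by
  induction θ with
  | nil => rfl
  | snoc θ _ _ ih => exact congrArg Var.succ ih

@[simp] theorem assocR_inr_inl (γ δ θ : Scope S) {β : Scope S} {s : S} (y : Var δ β s) :
    assocR γ δ θ ((y.inr).inl θ) = (y.inl θ).inr := by
  induction θ with
  | nil => rfl
  | snoc θ _ _ ih => exact congrArg Var.succ ih

@[simp] theorem assocR_inr (γ δ θ : Scope S) {β : Scope S} {s : S} (y : Var θ β s) :
    assocR γ δ θ (y.inr) = y.inr.inr := by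
  induction y with
  | zero => rfl
  | succ y ih => exact congrArg Var.succ ih

@[simp] theorem assocL_inl (γ δ θ : Scope S) {β : Scope S} {s : S} (y : Var γ β s) :
    assocL γ δ θ (y.inl (δ ⧺ θ)) = (y.inl δ).inl θ := by
  induction θ with
  | nil => rfl
  | snoc θ _ _ ih => exact congrArg Var.succ ih

@[simp] theorem assocL_inr_inl (γ δ θ : Scope S) {β : Scope S} {s : S} (y : Var δ β s) :
    assocL γ δ θ ((y.inl θ).inr) = (y.inr).inl θ := by
  induction θ with
  | nil => rfl
  | snoc θ _ _ ih => exact congrArg Var.succ ih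

@[simp] theorem assocL_inr_inr (γ δ θ : Scope S) {β : Scope S} {s : S} (y : Var θ β s) :
    assocL γ δ θ (y.inr.inr) = y.inr := by
  induction y with
  | zero => rfl
  | succ y ih => exact congrArg Var.succ ih

theorem ext_append₂ {δ θ : Scope S} {ρ ρ' : Ren ((γ ⧺ δ) ⧺ θ) γ'}
    (h₁ : ∀ ⦃β s⦄ (y : Var γ β s), ρ ((y.inl δ).inl θ) = ρ' ((y.inl δ).inl θ))
    (h₂ : ∀ ⦃β s⦄ (y : Var δ β s), ρ (y.inr.inl θ) = ρ' (y.inr.inl θ))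
    (h₃ : ∀ ⦃β s⦄ (z : Var θ β s), ρ z.inr = ρ' z.inr) : ρ = ρ' :=
  ext_append (fun _ _ y => by
    rcases y.inl_or_inr δ with ⟨y, rfl⟩ | ⟨z, rfl⟩
    · exact h₁ y
    · exact h₂ z) h₃

@[simp] theorem assocR_comp_assocL (γ δ θ : Scope S) :
    (assocR γ δ θ).comp (assocL γ δ θ) = Ren.id _ :=
  ext_append₂ (by simp) (by simp) (by simp)

@[simp] theorem assocL_comp_assocR (γ δ θ : Scope S) :
    (assocL γ δ θ).comp (assocR γ δ θ) = Ren.id _ :=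
  ext_append (by simp) (fun _ _ y => by
    rcases y.inl_or_inr θ with ⟨y, rfl⟩ | ⟨z, rfl⟩ <;> simp)

end Ren

end Scopes

section Raw

variable {S : Type u} {n : ℕ} {ς : PreSig S n}

/-! ### Renaming -/

theorem Ex.rename_id {γ : Scope S} {k : Kind S} (e : Ex ς γ k) : e.rename (Ren.id γ) = e := by
  induction e <;> simp_all [Ex.rename]

theorem Ex.rename_rename {γ γ' γ'' : Scope S} {k : Kind S} (ρ : Ren γ γ') (ρ' : Ren γ' γ'')
    (e : Ex ς γ k) : (e.rename ρ).rename ρ' = e.rename (ρ.comp ρ') := by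
  induction e generalizing γ' γ'' <;> simp_all [Ex.rename, Ren.lift_comp]

theorem Ex.get_rename {γ γ' δ θ : Scope S} {s : S} (ρ : Ren γ γ') (ts : Sp ς γ δ)
    (x : Var δ θ s) : (ts.rename ρ).get x = (ts.get x).rename (ρ.lift θ) := by
  induction x with
  | zero => cases ts; rfl
  | succ x ih => cases ts with | snoc ts t => exact ih ts

theorem Ex.sp_ext {γ δ : Scope S} {ts us : Sp ς γ δ}
    (h : ∀ ⦃θ s⦄ (x : Var δ θ s), ts.get x = us.get x) : ts = us := by
  induction δ with
  | nil => cases ts; cases us; rfl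
  | snoc δ θ s ih =>
    cases ts with | snoc ts t =>
    cases us with | snoc us u =>
    have h0 : t = u := h .zero
    have h1 : ts = us := ih fun _ _ x => h (.succ x)
    rw [h0, h1]

/-- The variable `x`, applied to the variables bound by its arguments. -/
def Var.eta (ς : PreSig S n) {γ δ : Scope S} {s : S} (x : Var γ δ s) : Tm ς (γ ⧺ δ) s :=
  .var (x.inl δ) ((idSp ς δ).rename (Ren.wkr γ δ))

theorem Var.eta_rename {γ γ' δ : Scope S} {s : S} (ρ : Ren γ γ') (x : Var γ δ s) :
    (x.eta ς).rename (ρ.lift δ) = (ρ x).eta ς := by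
  simp only [Var.eta, Ex.rename, Ren.lift_inl, Ex.rename_rename]
  congr 2
  funext _ _ z
  simp

theorem get_idSp {γ δ : Scope S} {s : S} (x : Var γ δ s) : (idSp ς γ).get x = x.eta ς := by
  induction x with
  | zero => rfl
  | @succ γ δ θ s r x ih =>
    simp only [idSp, Ex.get]
    exact (Ex.get_rename _ _ x).trans
      ((congrArg _ ih).trans (Var.eta_rename (fun _ _ x => Var.succ x) x))

/-! ### Hereditary substitution and renaming -/

theorem Env.lift_inl {φ γ γ' : Scope S} (σ : Env ς φ γ γ') (β : Scope S) {δ : Scope S} {s : S}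
    (y : Var γ δ s) :
    σ.lift β (y.inl β) = Sum.map (fun z => z.inl β)
      (fun p => (p.1, p.2.rename ((Ren.wkl γ' β).lift δ))) (σ y) := by
  simp only [Env.lift, Var.split_inl]
  rcases σ y with z | ⟨m, t⟩ <;> rfl

theorem Env.lift_inr {φ γ γ' : Scope S} (σ : Env ς φ γ γ') {β : Scope S} {δ : Scope S} {s : S}
    (z : Var β δ s) : σ.lift β (z.inr) = .inl z.inr := by
  simp only [Env.lift, Var.split_inr]

/-- A renaming followed by an environment. -/
def Ren.thenEnv {φ γ γ' γ'' : Scope S} (ρ : Ren γ γ') (σ : Env ς φ γ' γ'') : Env ς φ γ γ'' :=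
  fun _ _ x => σ (ρ x)

/-- The environment given by a renaming. -/
def Env.ofRen (ς : PreSig S n) (φ : Scope S) {γ γ' : Scope S} (ρ : Ren γ γ') : Env ς φ γ γ' :=
  fun _ _ x => .inl (ρ x)

theorem Env.lift_comp_ren {φ γ γ' γ'' : Scope S} (ρ : Ren γ γ') (σ : Env ς φ γ' γ'')
    (β : Scope S) : (ρ.lift β).thenEnv (σ.lift β) = (ρ.thenEnv σ).lift β := by
  funext δ s x
  rcases x.inl_or_inr β with ⟨y, rfl⟩ | ⟨z, rfl⟩
  · simp only [Env.lift_inl, Ren.lift_inl, Ren.thenEnv]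
  · simp only [Env.lift_inr, Ren.lift_inr, Ren.thenEnv]

theorem Ex.bind_rename {φ γ γ' γ'' : Scope S} {k : Kind S} (a : App ς φ) (ρ : Ren γ γ')
    (σ : Env ς φ γ' γ'') (e : Ex ς γ k) :
    (e.rename ρ).bind a σ = e.bind a (ρ.thenEnv σ) := by
  induction e generalizing γ' γ'' with
  | var x ts ih => simp only [Ex.rename, Ex.bind, ih]; rfl
  | _ => simp_all [Ex.rename, Ex.bind, Env.lift_comp_ren]

theorem Env.lift_ofRen {φ γ γ' : Scope S} (ρ : Ren γ γ') (β : Scope S) :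
    (Env.ofRen ς φ ρ).lift β = Env.ofRen ς φ (ρ.lift β) := by
  funext δ s x
  rcases x.inl_or_inr β with ⟨y, rfl⟩ | ⟨z, rfl⟩
  · simp only [Env.lift_inl, Ren.lift_inl, Env.ofRen, Sum.map_inl]
  · simp only [Env.lift_inr, Ren.lift_inr, Env.ofRen]

theorem Ex.bind_ofRen {φ γ γ' : Scope S} {k : Kind S} (a : App ς φ) (ρ : Ren γ γ')
    (e : Ex ς γ k) : e.bind a (Env.ofRen ς φ ρ) = e.rename ρ := by
  induction e generalizing γ' with
  | var x ts ih => simp only [Ex.rename, Ex.bind, ih]; rfl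
  | _ => simp_all [Ex.rename, Ex.bind, Env.lift_ofRen]

theorem Ex.get_bind {φ γ γ' δ θ : Scope S} {s : S} (a : App ς φ) (σ : Env ς φ γ γ')
    (ts : Sp ς γ δ) (x : Var δ θ s) : (ts.bind a σ).get x = (ts.get x).bind a (σ.lift θ) := by
  induction x with
  | zero => cases ts; rfl
  | succ x ih => cases ts with | snoc ts t => exact ih ts

theorem Env.ofSp_inl {γ δ β : Scope S} {s : S} (ts : Sp ς γ δ) (y : Var γ β s) :
    Env.ofSp ts (y.inl δ) = .inl y := by
  simp only [Env.ofSp, Var.split_inl]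

theorem Env.ofSp_inr {γ δ β : Scope S} {s : S} (ts : Sp ς γ δ) (z : Var δ β s) :
    Env.ofSp ts z.inr = .inr (z, ts.get z) := by
  simp only [Env.ofSp, Var.split_inr]

/-- Up to the identification of variables with their eta-expansions, `σ` is the identity. -/
def Env.IsId {φ γ : Scope S} (σ : Env ς φ γ γ) : Prop :=
  ∀ ⦃δ : Scope S⦄ ⦃s : S⦄ (x : Var γ δ s), σ x = .inl x ∨ ∃ m, σ x = .inr (m, x.eta ς)

theorem Env.IsId.lift {φ γ : Scope S} {σ : Env ς φ γ γ} (h : σ.IsId) (β : Scope S) :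
    (σ.lift β).IsId := by
  intro δ s x
  rcases x.inl_or_inr β with ⟨y, rfl⟩ | ⟨z, rfl⟩
  · rcases h y with h | ⟨m, h⟩
    · left; simp only [Env.lift_inl, h, Sum.map_inl]
    · right; exact ⟨m, by simp only [Env.lift_inl, h, Var.eta_rename, Ren.wkl_apply, Sum.map_inr]⟩
  · left; exact Env.lift_inr σ z

/-- Each component of the identity spine is an eta-expanded variable `x`. Substituting `ts` for it
calls a substitution of identity arguments into the component of `ts` at `x`, and that call is over
the arity of `x`, of smaller rank. -/
theorem inst_idSp_wkr_aux (N : ℕ) :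
    ∀ (δ : Scope S), δ.rank ≤ N → ∀ {γ : Scope S} (ts : Sp ς γ δ),
      ((idSp ς δ).rename (Ren.wkr γ δ)).inst ts = ts := by
  induction N using Nat.strong_induction_on with
  | _ N IH =>
  -- If a variable goes to its own eta-expansion, its image applied to `ts` is the variable applied
  -- to the identity spine instantiated at `ts`; the outer induction hypothesis at the arity of the
  -- variable turns this back into `ts`.
  have key : ∀ {φ γ : Scope S} {k : Kind S} (e : Ex ς γ k) (σ : Env ς φ γ γ), φ.rank < N →
      σ.IsId → e.bind (app ς φ) σ = e := by
    intro φ γ k e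
    induction e with
    | @var γ δ s x ts ih =>
      intro σ hφ hσ
      rcases hσ x with h | ⟨m, h⟩
      · simp only [Ex.bind, h, ih σ hφ hσ]
      · simp only [Ex.bind, h, ih σ hφ hσ, app_eq]
        simp only [Var.eta, Ex.inst, Ex.bind, Env.ofSp_inl]
        congr 1
        exact IH δ.rank (m.rank_lt.trans hφ) δ le_rfl ts
    | con c h ts ih => intro σ hφ hσ; simp only [Ex.bind, ih σ hφ hσ]
    | nil => intro σ hφ hσ; rfl
    | snoc ts t ih₁ ih₂ =>
      intro σ hφ hσ; simp only [Ex.bind, ih₁ σ hφ hσ, ih₂ _ hφ (hσ.lift _)]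
    | tcon c h hs ts ih => intro σ hφ hσ; simp only [Ex.bind, ih σ hφ hσ]
    | cnil => intro σ hφ hσ; rfl
    | csnoc Γ Δ T ih₁ ih₂ ih₃ =>
      intro σ hφ hσ
      simp only [Ex.bind, ih₁ σ hφ hσ, ih₂ _ hφ (hσ.lift _), ih₃ _ hφ ((hσ.lift _).lift _)]
  intro δ hδ γ ts
  apply Ex.sp_ext
  intro θ s x
  simp only [Ex.inst, Ex.get_bind, Ex.get_rename, get_idSp, Var.eta_rename]
  simp only [Var.eta, Ex.bind, Env.lift_inl, Ren.wkr_apply, Env.ofSp_inr, app_eq,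
    Sum.map_inr, Ex.bind_rename]
  have hr : (Ren.wkr (γ ⧺ δ) θ).thenEnv ((Env.ofSp ts).lift θ) =
      Env.ofRen ς δ (Ren.wkr γ θ) := by
    funext β r z
    exact Env.lift_inr _ z
  rw [hr, Ex.bind_ofRen]
  simp only [Ex.inst, Ex.bind_rename]
  -- What remains is the component of `ts` at `x`, in which the bound variables are replaced by
  -- their eta-expansions.
  apply key _ _ (x.rank_lt.trans_le hδ)
  intro β r y
  rcases y.inl_or_inr θ with ⟨y, rfl⟩ | ⟨z, rfl⟩
  · left; simp only [Ren.thenEnv, Ren.lift_inl, Env.ofSp_inl, Ren.wkl_apply]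
  · right
    refine ⟨z, ?_⟩
    simp only [Ren.thenEnv, Ren.lift_inr, Env.ofSp_inr, Ex.get_rename, get_idSp, Var.eta_rename,
      Ren.wkr_apply]

theorem inst_idSp_wkr {γ δ : Scope S} (ts : Sp ς γ δ) :
    ((idSp ς δ).rename (Ren.wkr γ δ)).inst ts = ts :=
  inst_idSp_wkr_aux δ.rank δ le_rfl ts

theorem Var.eta_inst {γ δ : Scope S} {s : S} (x : Var γ δ s) (ts : Sp ς γ δ) :
    (x.eta ς).inst ts = .var x ts := by
  simp only [Var.eta, Ex.inst, Ex.bind, Env.ofSp_inl]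
  congr 1
  exact inst_idSp_wkr ts

/-! ### Simultaneous substitutions -/

/-- Simultaneous substitutions from `γ` to `γ'`. -/
def Sub (ς : PreSig S n) (γ γ' : Scope S) : Type u :=
  ∀ ⦃δ : Scope S⦄ ⦃s : S⦄, Var γ δ s → Tm ς (γ' ⧺ δ) s

/-- A renaming followed by a substitution. -/
def Ren.thenSub {γ γ' γ'' : Scope S} (ρ : Ren γ γ') (σ : Sub ς γ' γ'') : Sub ς γ γ'' :=
  fun _ _ x => σ (ρ x)

/-- A substitution followed by a renaming. -/
def Sub.thenRen {γ γ' γ'' : Scope S} (σ : Sub ς γ γ') (ρ : Ren γ' γ'') : Sub ς γ γ'' :=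
  fun δ _ x => (σ x).rename (ρ.lift δ)

@[simp] theorem Ren.thenSub_apply {γ γ' γ'' : Scope S} (ρ : Ren γ γ') (σ : Sub ς γ' γ'')
    {δ : Scope S} {s : S} (x : Var γ δ s) : ρ.thenSub σ x = σ (ρ x) := rfl

@[simp] theorem Sub.thenRen_apply {γ γ' γ'' : Scope S} (σ : Sub ς γ γ') (ρ : Ren γ' γ'')
    {δ : Scope S} {s : S} (x : Var γ δ s) : σ.thenRen ρ x = (σ x).rename (ρ.lift δ) := rfl

namespace Sub

variable {γ γ' γ'' : Scope S}

/-- The substitution given by a renaming. -/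
def ofRen (ς : PreSig S n) (ρ : Ren γ γ') : Sub ς γ γ' := fun _ _ x => (ρ x).eta ς

/-- The copairing of two substitutions. -/
def append {δ : Scope S} (σ : Sub ς γ γ') (τ : Sub ς δ γ') : Sub ς (γ ⧺ δ) γ' := fun _ _ x =>
  match Var.split δ x with
  | .inl y => σ y
  | .inr z => τ z

/-- Extension of a substitution under a binder. -/
def lift (σ : Sub ς γ γ') (θ : Scope S) : Sub ς (γ ⧺ θ) (γ' ⧺ θ) :=
  append (σ.thenRen (Ren.wkl γ' θ)) (ofRen ς (Ren.wkr γ' θ))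

/-- The substitution from `δ` to `γ` given by a spine. -/
def ofSp' {δ : Scope S} (ts : Sp ς γ δ) : Sub ς δ γ := fun _ _ z => ts.get z

/-- The substitution from `γ.δ` to `γ` given by a spine. -/
def ofSp {δ : Scope S} (ts : Sp ς γ δ) : Sub ς (γ ⧺ δ) γ :=
  append (ofRen ς (Ren.id γ)) (ofSp' ts)

@[simp] theorem append_inl {δ β : Scope S} {s : S} (σ : Sub ς γ γ') (τ : Sub ς δ γ')
    (y : Var γ β s) : σ.append τ (y.inl δ) = σ y := by
  simp only [append, Var.split_inl]

@[simp] theorem append_inr {δ β : Scope S} {s : S} (σ : Sub ς γ γ') (τ : Sub ς δ γ')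
    (z : Var δ β s) : σ.append τ z.inr = τ z := by
  simp only [append, Var.split_inr]

@[simp] theorem lift_inl {θ β : Scope S} {s : S} (σ : Sub ς γ γ') (y : Var γ β s) :
    σ.lift θ (y.inl θ) = (σ y).rename ((Ren.wkl γ' θ).lift β) := by
  rw [lift, append_inl]; rfl

@[simp] theorem lift_inr {θ β : Scope S} {s : S} (σ : Sub ς γ γ') (z : Var θ β s) :
    σ.lift θ z.inr = z.inr.eta ς := by
  rw [lift, append_inr]; rfl

@[simp] theorem ofSp_inl {δ β : Scope S} {s : S} (ts : Sp ς γ δ) (y : Var γ β s) :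
    ofSp ts (y.inl δ) = y.eta ς := by
  rw [ofSp, append_inl]; rfl

@[simp] theorem ofSp_inr {δ β : Scope S} {s : S} (ts : Sp ς γ δ) (z : Var δ β s) :
    ofSp ts z.inr = ts.get z := by
  rw [ofSp, append_inr]; rfl

@[simp] theorem ofSp'_apply {δ β : Scope S} {s : S} (ts : Sp ς γ δ) (z : Var δ β s) :
    ofSp' ts z = ts.get z := rfl

@[simp] theorem ofRen_apply {β : Scope S} {s : S} (ρ : Ren γ γ') (y : Var γ β s) :
    ofRen ς ρ y = (ρ y).eta ς := rfl

theorem ext_append {δ : Scope S} {σ τ : Sub ς (γ ⧺ δ) γ'}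
    (hl : ∀ ⦃β s⦄ (y : Var γ β s), σ (y.inl δ) = τ (y.inl δ))
    (hr : ∀ ⦃β s⦄ (z : Var δ β s), σ z.inr = τ z.inr) : σ = τ := by
  funext β s x
  rcases x.inl_or_inr δ with ⟨y, rfl⟩ | ⟨z, rfl⟩
  · exact hl y
  · exact hr z

theorem ext_append₂ {δ θ : Scope S} {σ τ : Sub ς ((γ ⧺ δ) ⧺ θ) γ'}
    (h₁ : ∀ ⦃β s⦄ (y : Var γ β s), σ ((y.inl δ).inl θ) = τ ((y.inl δ).inl θ))
    (h₂ : ∀ ⦃β s⦄ (y : Var δ β s), σ (y.inr.inl θ) = τ (y.inr.inl θ))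
    (h₃ : ∀ ⦃β s⦄ (z : Var θ β s), σ z.inr = τ z.inr) : σ = τ :=
  ext_append (fun _ _ y => by
    rcases y.inl_or_inr δ with ⟨y, rfl⟩ | ⟨z, rfl⟩
    · exact h₁ y
    · exact h₂ z) h₃

theorem ofRen_lift (ρ : Ren γ γ') (θ : Scope S) : (ofRen ς ρ).lift θ = ofRen ς (ρ.lift θ) :=
  ext_append (by simp [Var.eta_rename]) (by simp)

/-- The substitution given by an environment. -/
def ofEnv {φ : Scope S} (σ : Env ς φ γ γ') : Sub ς γ γ' := fun _ _ x =>
  match σ x with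
  | .inl y => y.eta ς
  | .inr (_, t) => t

theorem ofEnv_lift {φ : Scope S} (σ : Env ς φ γ γ') (θ : Scope S) :
    ofEnv (σ.lift θ) = (ofEnv σ).lift θ := by
  apply ext_append
  · intro β s y
    simp only [lift_inl, ofEnv, Env.lift_inl]
    rcases σ y with y | ⟨m, t⟩
    · simp only [Sum.map_inl, Var.eta_rename, Ren.wkl_apply]
    · simp only [Sum.map_inr]
  · intro β s z
    simp only [lift_inr, ofEnv, Env.lift_inr]

theorem ofEnv_ofSp {δ : Scope S} (ts : Sp ς γ δ) : ofEnv (Env.ofSp ts) = ofSp ts :=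
  ext_append (by simp [ofEnv, Env.ofSp_inl]) (by simp [ofEnv, Env.ofSp_inr])

end Sub

/-- Application of a simultaneous substitution. -/
def Ex.sub : {γ γ' : Scope S} → {k : Kind S} → Ex ς γ k → Sub ς γ γ' → Ex ς γ' k
  | _, _, _, .var x ts, σ => (σ x).inst (ts.sub σ)
  | _, _, _, .con c h ts, σ => .con c h (ts.sub σ)
  | _, _, _, .nil, _ => .nil
  | _, _, _, .snoc (θ := θ) ts t, σ => .snoc (ts.sub σ) (t.sub (σ.lift θ))
  | _, _, _, .tcon c h hs ts, σ => .tcon c h hs (ts.sub σ)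
  | _, _, _, .cnil, _ => .cnil
  | _, _, _, .csnoc (δ := δ) (θ := θ) Γ Δ T, σ =>
    .csnoc (Γ.sub σ) (Δ.sub (σ.lift δ)) (T.sub ((σ.lift δ).lift θ))

/-- An environment separates variables from terms, while a substitution sees a variable as its
eta-expansion; `Var.eta_inst` shows that the two readings agree. The laws of substitution can then
be stated as equations between `Sub`s. -/
theorem Ex.bind_eq_sub {φ γ γ' : Scope S} {k : Kind S} (σ : Env ς φ γ γ') (e : Ex ς γ k) :
    e.bind (app ς φ) σ = e.sub (Sub.ofEnv σ) := by
  induction e generalizing γ' with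
  | @var γ δ s x ts ih =>
    simp only [Ex.bind, Ex.sub, Sub.ofEnv]
    rcases σ x with y | ⟨m, t⟩
    · simp only [Var.eta_inst]; rw [ih]
    · simp only [app_eq]; rw [ih]
  | con c h ts ih => simp only [Ex.bind, Ex.sub, ih]
  | nil => rfl
  | snoc ts t ih₁ ih₂ => simp only [Ex.bind, Ex.sub, ih₁, ih₂, Sub.ofEnv_lift]
  | tcon c h hs ts ih => simp only [Ex.bind, Ex.sub, ih]
  | cnil => rfl
  | csnoc Γ Δ T ih₁ ih₂ ih₃ => simp only [Ex.bind, Ex.sub, ih₁, ih₂, ih₃, Sub.ofEnv_lift]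

theorem Ex.inst_eq_sub {γ δ : Scope S} {k : Kind S} (e : Ex ς (γ ⧺ δ) k) (ts : Sp ς γ δ) :
    e.inst ts = e.sub (Sub.ofSp ts) := by
  rw [Ex.inst, Ex.bind_eq_sub, Sub.ofEnv_ofSp]

theorem Ex.instUnder_eq_sub {γ δ : Scope S} (θ : Scope S) {k : Kind S}
    (e : Ex ς ((γ ⧺ δ) ⧺ θ) k) (ts : Sp ς γ δ) :
    e.instUnder θ ts = e.sub ((Sub.ofSp ts).lift θ) := by
  rw [Ex.instUnder, Ex.bind_eq_sub, Sub.ofEnv_lift, Sub.ofEnv_ofSp]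

theorem Ex.rename_eq_sub {γ γ' : Scope S} {k : Kind S} (ρ : Ren γ γ') (e : Ex ς γ k) :
    e.rename ρ = e.sub (Sub.ofRen ς ρ) := by
  induction e generalizing γ' <;>
    simp_all [Ex.rename, Ex.sub, Sub.ofRen_lift, Var.eta_inst]

theorem Sub.lift_comp_ren {γ γ' γ'' : Scope S} (ρ : Ren γ γ') (σ : Sub ς γ' γ'') (β : Scope S) :
    (ρ.lift β).thenSub (σ.lift β) = (ρ.thenSub σ).lift β :=
  Sub.ext_append (by simp) (by simp)

theorem Ex.rename_sub {γ γ' γ'' : Scope S} {k : Kind S} (ρ : Ren γ γ') (σ : Sub ς γ' γ'')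
    (e : Ex ς γ k) : (e.rename ρ).sub σ = e.sub (ρ.thenSub σ) := by
  induction e generalizing γ' γ'' <;>
    simp_all [Ex.rename, Ex.sub, Sub.lift_comp_ren]

theorem Ex.get_sub {γ γ' δ θ : Scope S} {s : S} (σ : Sub ς γ γ') (ts : Sp ς γ δ)
    (x : Var δ θ s) : (ts.sub σ).get x = (ts.get x).sub (σ.lift θ) := by
  induction x with
  | zero => cases ts; rfl
  | succ x ih => cases ts with | snoc ts t => exact ih ts

/-- Every variable that is not sent to a variable has an arity of rank less than `N`. -/
def Sub.Bounded (N : ℕ) {γ γ' : Scope S} (σ : Sub ς γ γ') : Prop :=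
  ∀ ⦃δ : Scope S⦄ ⦃s : S⦄ (x : Var γ δ s), (∃ y : Var γ' δ s, σ x = y.eta ς) ∨ δ.rank < N

theorem Sub.Bounded.lift {N : ℕ} {γ γ' : Scope S} {σ : Sub ς γ γ'} (h : σ.Bounded N)
    (θ : Scope S) : (σ.lift θ).Bounded N := by
  intro δ s x
  rcases x.inl_or_inr θ with ⟨y, rfl⟩ | ⟨z, rfl⟩
  · rcases h y with ⟨y', h⟩ | h
    · exact .inl ⟨y'.inl θ, by simp [h, Var.eta_rename]⟩
    · exact .inr h
  · exact .inl ⟨z.inr, by simp⟩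

theorem Sub.bounded_rank {γ γ' : Scope S} (σ : Sub ς γ γ') : σ.Bounded γ.rank :=
  fun _ _ x => .inr x.rank_lt

theorem Sub.bounded_ofSp {γ δ : Scope S} (ts : Sp ς γ δ) : (Sub.ofSp ts).Bounded δ.rank := by
  intro β s x
  rcases x.inl_or_inr δ with ⟨y, rfl⟩ | ⟨z, rfl⟩
  · exact .inl ⟨y, by simp⟩
  · exact .inr z.rank_lt

/-- A variable that `σ` sends to a variable creates no new substitution. Any other variable creates
one over its arity, of rank less than `N`, to which the induction hypothesis applies. -/
theorem Ex.sub_rename_aux (N : ℕ) :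
    ∀ {γ γ' γ'' : Scope S} {k : Kind S} (e : Ex ς γ k) (σ : Sub ς γ γ') (ρ : Ren γ' γ''),
      σ.Bounded N → (e.sub σ).rename ρ = e.sub (σ.thenRen ρ) := by
  induction N using Nat.strong_induction_on with
  | _ N IH =>
  have hlift : ∀ {γ γ' γ'' : Scope S} (σ : Sub ς γ γ') (ρ : Ren γ' γ'') (θ : Scope S),
      (σ.lift θ).thenRen (ρ.lift θ) = (σ.thenRen ρ).lift θ := by
    intro γ γ' γ'' σ ρ θ
    apply Sub.ext_append
    · intro β s y
      simp only [Sub.thenRen_apply, Sub.lift_inl, Ex.rename_rename]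
      congr 1
      apply Ren.ext_append <;> simp
    · intro β s z
      simp [Var.eta_rename]
  intro γ γ' γ'' k e
  induction e generalizing γ' γ'' with
  | @var γ δ s x ts ih =>
    intro σ ρ hσ
    simp only [Ex.sub]
    rw [← ih σ ρ hσ]
    rcases hσ x with ⟨y, h⟩ | h
    · simp only [h, Sub.thenRen_apply, Var.eta_inst, Var.eta_rename, Ex.rename]
    · rw [Ex.inst_eq_sub, Ex.inst_eq_sub, IH δ.rank h _ _ ρ (Sub.bounded_ofSp _),
        Sub.thenRen_apply, Ex.rename_sub]
      congr 1
      apply Sub.ext_append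
      · intro β r y; simp [Var.eta_rename]
      · intro β r z; simp [Ex.get_rename]
  | con c h ts ih => intro σ ρ hσ; simp only [Ex.sub, Ex.rename, ih σ ρ hσ]
  | nil => intros; rfl
  | snoc ts t ih₁ ih₂ =>
    intro σ ρ hσ
    simp only [Ex.sub, Ex.rename, ih₁ σ ρ hσ, ih₂ _ _ (hσ.lift _), hlift]
  | tcon c h hs ts ih => intro σ ρ hσ; simp only [Ex.sub, Ex.rename, ih σ ρ hσ]
  | cnil => intros; rfl
  | csnoc Γ Δ T ih₁ ih₂ ih₃ =>
    intro σ ρ hσ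
    simp only [Ex.sub, Ex.rename, ih₁ σ ρ hσ, ih₂ _ _ (hσ.lift _),
      ih₃ _ _ ((hσ.lift _).lift _), hlift]

theorem Ex.sub_rename {γ γ' γ'' : Scope S} {k : Kind S} (e : Ex ς γ k) (σ : Sub ς γ γ')
    (ρ : Ren γ' γ'') :
    (e.sub σ).rename ρ = e.sub (σ.thenRen ρ) :=
  Ex.sub_rename_aux γ.rank e σ ρ σ.bounded_rank

namespace Sub

variable {γ γ' γ'' γ''' : Scope S}

/-- Composition of substitutions, in diagrammatic order. -/
def comp (σ : Sub ς γ γ') (τ : Sub ς γ' γ'') : Sub ς γ γ'' := fun δ _ x =>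
  (σ x).sub (τ.lift δ)

@[simp] theorem comp_apply (σ : Sub ς γ γ') (τ : Sub ς γ' γ'') {δ : Scope S} {s : S}
    (x : Var γ δ s) : σ.comp τ x = (σ x).sub (τ.lift δ) := rfl

/-- The identity substitution. -/
def id (ς : PreSig S n) (γ : Scope S) : Sub ς γ γ := ofRen ς (Ren.id γ)

@[simp] theorem id_apply {δ : Scope S} {s : S} (x : Var γ δ s) : id ς γ x = x.eta ς := rfl

end Sub

@[simp] theorem Ex.sub_id {γ : Scope S} {k : Kind S} (e : Ex ς γ k) : e.sub (Sub.id ς γ) = e := by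
  rw [Sub.id, ← Ex.rename_eq_sub, Ex.rename_id]

@[simp] theorem Var.eta_sub {γ γ' δ : Scope S} {s : S} (x : Var γ δ s) (τ : Sub ς γ γ') :
    (x.eta ς).sub (τ.lift δ) = τ x := by
  simp only [Var.eta, Ex.sub, Sub.lift_inl, Ex.rename_sub]
  have hr : (Ren.wkr γ δ).thenSub (τ.lift δ) = Sub.ofRen ς (Ren.wkr γ' δ) := by
    funext β r z; simp
  rw [hr, ← Ex.rename_eq_sub, Ex.inst_eq_sub, Ex.rename_sub]
  have hi : ((Ren.wkl γ' δ).lift δ).thenSub (Sub.ofSp ((idSp ς δ).rename (Ren.wkr γ' δ))) =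
      Sub.id ς (γ' ⧺ δ) := by
    apply Sub.ext_append
    · intro β r y; simp
    · intro β r z; simp [Ex.get_rename, get_idSp, Var.eta_rename]
  rw [hi, Ex.sub_id]

/-- The induction is on the sum of the two bounds because the recursive calls occur in both orders:
first the arguments of `x` and then `τ`, or first `τ` and then the substituted arguments. In both
cases the bound for `σ` has been replaced by the smaller rank of the arity of `x`. -/
theorem Ex.sub_sub_aux (N : ℕ) :
    ∀ {γ γ' γ'' : Scope S} {k : Kind S} (e : Ex ς γ k) (σ : Sub ς γ γ') (τ : Sub ς γ' γ'')
      (N₁ N₂ : ℕ), N₁ + N₂ ≤ N → σ.Bounded N₁ → τ.Bounded N₂ →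
      (e.sub σ).sub τ = e.sub (σ.comp τ) := by
  induction N using Nat.strong_induction_on with
  | _ N IH =>
  have hlift : ∀ {γ γ' γ'' : Scope S} (σ : Sub ς γ γ') (τ : Sub ς γ' γ'') (θ : Scope S),
      (σ.lift θ).comp (τ.lift θ) = (σ.comp τ).lift θ := by
    intro γ γ' γ'' σ τ θ
    apply Sub.ext_append
    · intro β s y
      simp only [Sub.comp_apply, Sub.lift_inl, Ex.rename_sub, Ex.sub_rename]
      congr 1
      apply Sub.ext_append
      · intro α r y
        simp only [Ren.thenSub_apply, Sub.thenRen_apply, Ren.lift_inl, Ren.wkl_apply,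
          Sub.lift_inl, Ex.rename_rename]
        congr 1
        apply Ren.ext_append <;> simp
      · intro α r z; simp [Var.eta_rename]
    · intro β s z
      simp
  intro γ γ' γ'' k e
  induction e generalizing γ' γ'' with
  | @var γ δ s x ts ih =>
    intro σ τ N₁ N₂ hN hσ hτ
    simp only [Ex.sub]
    rw [← ih σ τ N₁ N₂ hN hσ hτ]
    rcases hσ x with ⟨y, h⟩ | h
    · simp only [h, Var.eta_inst, Sub.comp_apply, Var.eta_sub, Ex.sub]
    · rw [Ex.inst_eq_sub, Ex.inst_eq_sub,
        IH (δ.rank + N₂) (by omega) _ _ τ _ _ le_rfl (Sub.bounded_ofSp _) hτ,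
        Sub.comp_apply,
        IH (N₂ + δ.rank) (by omega) _ _ _ _ _ le_rfl (hτ.lift _) (Sub.bounded_ofSp _)]
      congr 1
      apply Sub.ext_append
      · intro β r y
        simp only [Sub.comp_apply, Sub.ofSp_inl, Sub.lift_inl, Ex.rename_sub, Var.eta_sub]
        have hi : ((Ren.wkl γ'' δ).lift β).thenSub
            ((Sub.ofSp ((ts.sub σ).sub τ)).lift β) = Sub.id ς (γ'' ⧺ β) := by
          apply Sub.ext_append
          · intro α q y; simp [Var.eta_rename]
          · intro α q z; simp
        rw [hi, Ex.sub_id]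
      · intro β r z; simp [Ex.get_sub]
  | con c h ts ih => intro σ τ N₁ N₂ hN hσ hτ; simp only [Ex.sub, ih σ τ N₁ N₂ hN hσ hτ]
  | nil => intros; rfl
  | snoc ts t ih₁ ih₂ =>
    intro σ τ N₁ N₂ hN hσ hτ
    simp only [Ex.sub, ih₁ σ τ N₁ N₂ hN hσ hτ, ih₂ _ _ N₁ N₂ hN (hσ.lift _) (hτ.lift _), hlift]
  | tcon c h hs ts ih => intro σ τ N₁ N₂ hN hσ hτ; simp only [Ex.sub, ih σ τ N₁ N₂ hN hσ hτ]
  | cnil => intros; rfl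
  | csnoc Γ Δ T ih₁ ih₂ ih₃ =>
    intro σ τ N₁ N₂ hN hσ hτ
    simp only [Ex.sub, ih₁ σ τ N₁ N₂ hN hσ hτ, ih₂ _ _ N₁ N₂ hN (hσ.lift _) (hτ.lift _),
      ih₃ _ _ N₁ N₂ hN ((hσ.lift _).lift _) ((hτ.lift _).lift _), hlift]

theorem Ex.sub_sub {γ γ' γ'' : Scope S} {k : Kind S} (e : Ex ς γ k) (σ : Sub ς γ γ')
    (τ : Sub ς γ' γ'') : (e.sub σ).sub τ = e.sub (σ.comp τ) :=
  Ex.sub_sub_aux _ e σ τ _ _ le_rfl σ.bounded_rank τ.bounded_rank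

/-! ### The category of substitutions -/

namespace Sub

variable {γ γ' γ'' γ''' : Scope S}

theorem comp_ofRen (σ : Sub ς γ γ') (ρ : Ren γ' γ'') : σ.comp (ofRen ς ρ) = σ.thenRen ρ := by
  funext δ s x; simp [Ex.rename_eq_sub, ofRen_lift]

theorem lift_comp (σ : Sub ς γ γ') (τ : Sub ς γ' γ'') (θ : Scope S) :
    (σ.lift θ).comp (τ.lift θ) = (σ.comp τ).lift θ := by
  apply ext_append
  · intro β s y
    simp only [comp_apply, lift_inl, Ex.rename_sub, Ex.sub_rename]
    congr 1
    apply ext_append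
    · intro α r y
      simp only [Ren.thenSub_apply, thenRen_apply, Ren.lift_inl, Ren.wkl_apply, lift_inl,
        Ex.rename_rename]
      congr 1
      apply Ren.ext_append <;> simp
    · intro α r z; simp [Var.eta_rename]
  · intro β s z
    simp

@[simp] theorem lift_id (θ : Scope S) : (Sub.id ς γ).lift θ = Sub.id ς (γ ⧺ θ) := by
  rw [Sub.id, ofRen_lift, Ren.lift_id]; rfl

/-- The usual substitution lemma, as an equation between composites; `Ex.inst_sub` and
`Ex.instUnder_sub` are its instances. -/
theorem ofSp_comp {δ : Scope S} (ts : Sp ς γ δ) (σ : Sub ς γ γ') :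
    (ofSp ts).comp σ = (σ.lift δ).comp (ofSp (ts.sub σ)) := by
  apply ext_append
  · intro β r y
    simp only [comp_apply, ofSp_inl, lift_inl, Ex.rename_sub, Var.eta_sub]
    have hi : ((Ren.wkl γ' δ).lift β).thenSub ((ofSp (ts.sub σ)).lift β) = Sub.id ς (γ' ⧺ β) := by
      apply ext_append
      · intro α q y; simp [Var.eta_rename]
      · intro α q z; simp
    rw [hi, Ex.sub_id]
  · intro β r z; simp [Ex.get_sub]

theorem ofSp'_comp {δ : Scope S} (ts : Sp ς γ δ) (σ : Sub ς γ γ') :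
    (ofSp' ts).comp σ = ofSp' (ts.sub σ) := by
  funext β r z; simp [Ex.get_sub]

@[simp] theorem wkl_thenSub_ofSp {δ : Scope S} (ts : Sp ς γ δ) :
    (Ren.wkl γ δ).thenSub (ofSp ts) = Sub.id ς γ := by
  funext β r z; simp

@[simp] theorem wkr_thenSub_ofSp {δ : Scope S} (ts : Sp ς γ δ) :
    (Ren.wkr γ δ).thenSub (ofSp ts) = ofSp' ts := by
  funext β r z; simp

@[simp] theorem wkl_thenSub_lift (σ : Sub ς γ γ') (θ : Scope S) :
    (Ren.wkl γ θ).thenSub (σ.lift θ) = σ.thenRen (Ren.wkl γ' θ) := by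
  funext β r z; simp

@[simp] theorem wkr_thenSub_lift (σ : Sub ς γ γ') (θ : Scope S) :
    (Ren.wkr γ θ).thenSub (σ.lift θ) = ofRen ς (Ren.wkr γ' θ) := by
  funext β r z; simp

theorem lift_thenSub_lift (ρ : Ren γ γ') (σ : Sub ς γ' γ'') (θ : Scope S) :
    (ρ.lift θ).thenSub (σ.lift θ) = (ρ.thenSub σ).lift θ := Sub.lift_comp_ren ρ σ θ

theorem lift_thenRen_lift (σ : Sub ς γ γ') (ρ : Ren γ' γ'') (θ : Scope S) :
    (σ.lift θ).thenRen (ρ.lift θ) = (σ.thenRen ρ).lift θ := by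
  rw [← comp_ofRen, ← comp_ofRen, ← ofRen_lift, lift_comp]

end Sub

theorem Ex.subst_eq_sub {γ δ : Scope S} {k : Kind S} (e : Ex ς δ k) (ts : Sp ς γ δ) :
    e.subst ts = e.sub (Sub.ofSp' ts) := by
  rw [Ex.subst, Ex.inst_eq_sub, Ex.rename_sub, Sub.wkr_thenSub_ofSp]

@[simp] theorem idSp_sub {γ δ : Scope S} (ts : Sp ς γ δ) : (idSp ς δ).sub (Sub.ofSp' ts) = ts :=
  Ex.sp_ext fun _ _ x => by simp [Ex.get_sub, get_idSp]

theorem Ex.inst_sub {γ γ' δ : Scope S} {k : Kind S} (e : Ex ς (γ ⧺ δ) k) (ts : Sp ς γ δ)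
    (σ : Sub ς γ γ') : (e.inst ts).sub σ = (e.sub (σ.lift δ)).inst (ts.sub σ) := by
  rw [Ex.inst_eq_sub, Ex.inst_eq_sub, Ex.sub_sub, Ex.sub_sub, Sub.ofSp_comp]

theorem Ex.instUnder_sub {γ γ' δ : Scope S} (θ : Scope S) {k : Kind S}
    (e : Ex ς ((γ ⧺ δ) ⧺ θ) k) (ts : Sp ς γ δ) (σ : Sub ς γ γ') :
    (e.instUnder θ ts).sub (σ.lift θ) =
      (e.sub ((σ.lift δ).lift θ)).instUnder θ (ts.sub σ) := by
  rw [Ex.instUnder_eq_sub, Ex.instUnder_eq_sub, Ex.sub_sub, Ex.sub_sub, Sub.lift_comp,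
    Sub.lift_comp, Sub.ofSp_comp]

theorem Ex.subst_sub {γ γ' δ : Scope S} {k : Kind S} (e : Ex ς δ k) (ts : Sp ς γ δ)
    (σ : Sub ς γ γ') : (e.subst ts).sub σ = e.subst (ts.sub σ) := by
  rw [Ex.subst_eq_sub, Ex.subst_eq_sub, Ex.sub_sub, Sub.ofSp'_comp]

theorem Ex.subst_rename {γ γ' δ : Scope S} {k : Kind S} (e : Ex ς δ k) (ts : Sp ς γ δ)
    (ρ : Ren γ γ') : (e.subst ts).rename ρ = e.subst (ts.rename ρ) := by
  rw [Ex.rename_eq_sub, Ex.rename_eq_sub, Ex.subst_sub]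

theorem Ex.sub_ofSp_nil {γ : Scope S} {k : Kind S} (e : Ex ς γ k) (ts : Sp ς γ .nil) :
    e.sub (γ' := γ) (Sub.ofSp ts) = e := by
  have h : Sub.ofSp ts = Sub.id ς γ := by
    funext δ s x
    exact Sub.ofSp_inl ts x
  rw [h]; exact Ex.sub_id e

/-- Overwriting one component of a spine is used to instantiate a rule with a variable on the left
at an arbitrary term. -/
theorem Ex.exists_get_eq {γ δ θ : Scope S} {s : S} (v : Sp ς γ δ) (x : Var δ θ s)
    (t : Tm ς (γ ⧺ θ) s) : ∃ v' : Sp ς γ δ, v'.get x = t := by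
  induction x with
  | zero => cases v with | snoc v u => exact ⟨.snoc v t, rfl⟩
  | succ x ih =>
    cases v with | snoc v u =>
    obtain ⟨v', h⟩ := ih v t
    exact ⟨.snoc v' u, h⟩

theorem Ex.get_spAppend_inl {γ δ θ β : Scope S} {s : S} (ts : Sp ς γ δ) (us : Sp ς γ θ)
    (x : Var δ β s) : (ts.spAppend us).get (x.inl θ) = ts.get x := by
  induction θ with
  | nil => cases us; rfl
  | snoc θ _ _ ih => cases us with | snoc us u => exact ih us

theorem Ex.get_spAppend_inr {γ δ θ β : Scope S} {s : S} (ts : Sp ς γ δ) (us : Sp ς γ θ)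
    (x : Var θ β s) : (ts.spAppend us).get x.inr = us.get x := by
  induction x with
  | zero => cases us; rfl
  | succ x ih => cases us with | snoc us u => exact ih us

theorem Ex.exists_spAppend {γ δ θ : Scope S} (v : Sp ς γ (δ ⧺ θ)) :
    ∃ (ts : Sp ς γ δ) (us : Sp ς γ θ), v = ts.spAppend us := by
  induction θ with
  | nil => exact ⟨v, .nil, rfl⟩
  | snoc θ _ _ ih =>
    cases v with | snoc v t =>
    obtain ⟨ts, us, rfl⟩ := ih v
    exact ⟨ts, .snoc us t, rfl⟩

theorem Ex.spAppend_inj {γ δ θ : Scope S} {ts ts' : Sp ς γ δ} {us us' : Sp ς γ θ}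
    (h : ts.spAppend us = ts'.spAppend us') : ts = ts' ∧ us = us' := by
  constructor
  · apply Ex.sp_ext
    intro β s x
    rw [← Ex.get_spAppend_inl ts us x, h, Ex.get_spAppend_inl]
  · apply Ex.sp_ext
    intro β s x
    rw [← Ex.get_spAppend_inr ts us x, h, Ex.get_spAppend_inr]

theorem Sub.ofSp'_spAppend {γ δ θ : Scope S} (ts : Sp ς γ δ) (us : Sp ς γ θ) :
    Sub.ofSp' (ts.spAppend us) = (Sub.ofSp' ts).append (Sub.ofSp' us) :=
  Sub.ext_append (by simp [Ex.get_spAppend_inl]) (by simp [Ex.get_spAppend_inr])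

theorem Ex.over_univ {γ : Scope S} {k : Kind S} (e : Ex ς γ k) : e.Over Set.univ := by
  induction e <;> simp_all [Ex.Over]

/-! ### Conversion -/

namespace RewSys

open Relation

variable {R : RewSys ς}

theorem Conv.refl {γ : Scope S} {k : Kind S} (e : Ex ς γ k) : R.Conv e e := EqvGen.refl e

theorem Conv.symm {γ : Scope S} {k : Kind S} {e e' : Ex ς γ k} (h : R.Conv e e') :
    R.Conv e' e := EqvGen.symm _ _ h

theorem Conv.trans {γ : Scope S} {k : Kind S} {e e' e'' : Ex ς γ k} (h : R.Conv e e')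
    (h' : R.Conv e' e'') : R.Conv e e'' := EqvGen.trans _ _ _ h h'

theorem Red.conv {γ : Scope S} {k : Kind S} {e e' : Ex ς γ k} (h : R.Red e e') :
    R.Conv e e' := EqvGen.rel _ _ h

theorem Conv.map {γ γ' : Scope S} {k k' : Kind S} (f : Ex ς γ k → Ex ς γ' k')
    (hf : ∀ a b, R.Red a b → R.Conv (f a) (f b)) {a b : Ex ς γ k} (h : R.Conv a b) :
    R.Conv (f a) (f b) := by
  induction h with
  | rel _ _ h => exact hf _ _ h
  | refl => exact .refl _
  | symm _ _ _ ih => exact ih.symm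
  | trans _ _ _ _ _ ih₁ ih₂ => exact ih₁.trans ih₂

theorem reds_conv {γ : Scope S} {k : Kind S} {e e' : Ex ς γ k}
    (h : ReflTransGen R.Red e e') : R.Conv e e' := by
  induction h with
  | refl => exact .refl _
  | tail _ h ih => exact ih.trans (Red.conv h)

theorem Conv.var {γ δ : Scope S} {s : S} (x : Var γ δ s) {ts us : Sp ς γ δ}
    (h : R.Conv ts us) : R.Conv (Ex.var x ts) (Ex.var x us) :=
  Conv.map (Ex.var x) (fun _ _ h => Red.conv (.var x h)) h

theorem Conv.con {γ δ : Scope S} {s : S} (c : Fin n) (h : ς.arity c = .tm δ s) {ts us : Sp ς γ δ}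
    (hc : R.Conv ts us) : R.Conv (Ex.con c h ts) (Ex.con c h us) :=
  Conv.map (Ex.con c h) (fun _ _ h' => Red.conv (.con c h trivial h')) hc

theorem Conv.tcon {γ δ : Scope S} {s : S} (c : Fin n) (h : ς.arity c = .ty δ) (hs : ς.era c = s)
    {ts us : Sp ς γ δ} (hc : R.Conv ts us) : R.Conv (Ex.tcon c h hs ts) (Ex.tcon c h hs us) :=
  Conv.map (Ex.tcon c h hs) (fun _ _ h' => Red.conv (.tcon c h hs trivial h')) hc

theorem Conv.snoc {γ δ θ : Scope S} {s : S} {ts us : Sp ς γ δ} {t u : Tm ς (γ ⧺ θ) s}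
    (h₁ : R.Conv ts us) (h₂ : R.Conv t u) : R.Conv (Ex.snoc ts t) (Ex.snoc us u) :=
  (Conv.map (Ex.snoc · t) (fun _ _ h => Red.conv (.snocL t t.over_univ h)) h₁).trans
    (Conv.map (Ex.snoc us) (fun _ _ h => Red.conv (.snocR us us.over_univ h)) h₂)

theorem Conv.csnoc {γ δ θ : Scope S} {s : S} {Γ Γ' : Ctx ς γ δ} {Δ Δ' : Ctx ς (γ ⧺ δ) θ}
    {T T' : Ty ς ((γ ⧺ δ) ⧺ θ) s} (h₁ : R.Conv Γ Γ') (h₂ : R.Conv Δ Δ') (h₃ : R.Conv T T') :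
    R.Conv (Ex.csnoc Γ Δ T) (Ex.csnoc Γ' Δ' T') :=
  ((Conv.map (Ex.csnoc · Δ T)
      (fun _ _ h => Red.conv (.csnoc₁ Δ T Δ.over_univ T.over_univ h)) h₁).trans
    (Conv.map (Ex.csnoc Γ' · T)
      (fun _ _ h => Red.conv (.csnoc₂ Γ' T Γ'.over_univ T.over_univ h)) h₂)).trans
    (Conv.map (Ex.csnoc Γ' Δ')
      (fun _ _ h => Red.conv (.csnoc₃ Γ' Δ' Γ'.over_univ Δ'.over_univ h)) h₃)

/-- The relation of two spines whose first arguments, and whose last arguments, are related. -/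
theorem conv_snoc_iff {γ δ θ : Scope S} {s : S} {ts us : Sp ς γ δ} {t u : Tm ς (γ ⧺ θ) s} :
    R.Conv (Ex.snoc ts t) (Ex.snoc us u) ↔ R.Conv ts us ∧ R.Conv t u := by
  refine ⟨fun h => ?_, fun h => h.1.snoc h.2⟩
  -- Each projection sends a step to a step or to an equality.
  let tl : Sp ς γ (δ.snoc θ s) → Sp ς γ δ := fun e => match e with | .snoc ts _ => ts
  let hd : Sp ς γ (δ.snoc θ s) → Tm ς (γ ⧺ θ) s := fun e => match e with | .snoc _ t => t
  refine ⟨Conv.map tl ?_ h, Conv.map hd ?_ h⟩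
  · intro a b h
    cases h with
    | snocL t ht h => exact Red.conv h
    | snocR ts hts h => exact .refl _
  · intro a b h
    cases h with
    | snocL t ht h => exact .refl _
    | snocR ts hts h => exact Red.conv h

theorem Conv.get {γ δ θ : Scope S} {s : S} {ts us : Sp ς γ δ} (h : R.Conv ts us)
    (x : Var δ θ s) : R.Conv (ts.get x) (us.get x) := by
  induction x with
  | zero =>
    cases ts with | snoc ts t =>
    cases us with | snoc us u => exact (conv_snoc_iff.1 h).2
  | succ x ih =>
    cases ts with | snoc ts t =>
    cases us with | snoc us u => exact ih (conv_snoc_iff.1 h).1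

theorem conv_sp_of_get {γ δ : Scope S} {ts us : Sp ς γ δ}
    (h : ∀ ⦃θ s⦄ (x : Var δ θ s), R.Conv (ts.get x) (us.get x)) : R.Conv ts us := by
  induction δ with
  | nil => cases ts; cases us; exact .refl _
  | snoc δ θ s ih =>
    cases ts with | snoc ts t =>
    cases us with | snoc us u =>
    exact (ih fun _ _ x => h (.succ x)).snoc (h .zero)

theorem red_rename {γ γ' : Scope S} {k : Kind S} {a b : Ex ς γ k} (h : R.Red a b)
    (ρ : Ren γ γ') : R.Red (a.rename ρ) (b.rename ρ) := by
  induction h generalizing γ' with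
  | root hR hl hr v hv =>
    rw [Ex.subst_rename, Ex.subst_rename]
    exact .root hR hl hr _ (Ex.over_univ _)
  | var x _ ih => exact .var _ (ih ρ)
  | con c h hc _ ih => exact .con c h hc (ih ρ)
  | snocL t ht _ ih => exact .snocL _ (Ex.over_univ _) (ih ρ)
  | snocR ts hts _ ih => exact .snocR _ (Ex.over_univ _) (ih _)
  | tcon c h hs hc _ ih => exact .tcon c h hs hc (ih ρ)
  | csnoc₁ Δ T hΔ hT _ ih => exact .csnoc₁ _ _ (Ex.over_univ _) (Ex.over_univ _) (ih _)
  | csnoc₂ Γ T hΓ hT _ ih => exact .csnoc₂ _ _ (Ex.over_univ _) (Ex.over_univ _) (ih _)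
  | csnoc₃ Γ Δ hΓ hΔ _ ih => exact .csnoc₃ _ _ (Ex.over_univ _) (Ex.over_univ _) (ih _)

theorem Conv.rename {γ γ' : Scope S} {k : Kind S} {a b : Ex ς γ k} (h : R.Conv a b)
    (ρ : Ren γ γ') : R.Conv (a.rename ρ) (b.rename ρ) :=
  Conv.map (Ex.rename ρ) (fun _ _ h => Red.conv (red_rename h ρ)) h

/-- Convertible substitutions that agree on the variables that they send to variables and whose
other variables have arities of rank less than `N`. -/
def ConvBounded (R : RewSys ς) (N : ℕ) {γ γ' : Scope S} (σ τ : Sub ς γ γ') : Prop :=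
  ∀ ⦃δ : Scope S⦄ ⦃s : S⦄ (x : Var γ δ s),
    (∃ y : Var γ' δ s, σ x = y.eta ς ∧ τ x = y.eta ς) ∨ δ.rank < N ∧ R.Conv (σ x) (τ x)

theorem ConvBounded.lift {N : ℕ} {γ γ' : Scope S} {σ τ : Sub ς γ γ'} (h : R.ConvBounded N σ τ)
    (θ : Scope S) : R.ConvBounded N (σ.lift θ) (τ.lift θ) := by
  intro δ s x
  rcases x.inl_or_inr θ with ⟨y, rfl⟩ | ⟨z, rfl⟩
  · rcases h y with ⟨y', h₁, h₂⟩ | ⟨h₁, h₂⟩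
    · exact .inl ⟨y'.inl θ, by simp [h₁, Var.eta_rename], by simp [h₂, Var.eta_rename]⟩
    · exact .inr ⟨h₁, by simpa using h₂.rename _⟩
  · exact .inl ⟨z.inr, by simp, by simp⟩

theorem convBounded_ofSp {γ δ : Scope S} {ts us : Sp ς γ δ} (h : R.Conv ts us) :
    R.ConvBounded δ.rank (Sub.ofSp ts) (Sub.ofSp us) := by
  intro β s x
  rcases x.inl_or_inr δ with ⟨y, rfl⟩ | ⟨z, rfl⟩
  · exact .inl ⟨y, by simp, by simp⟩
  · exact .inr ⟨z.rank_lt, by simpa using h.get z⟩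

/-- The two halves need each other. A step inside the arguments of a replaced variable becomes a
change of the substituted spine, which is the second half at the arity of that variable; changing
both the image of a variable and its arguments needs the two halves there. The first half yields a
conversion and not a step, because hereditary substitution may copy or discard the arguments. -/
theorem conv_sub_aux (N : ℕ) :
    (∀ {γ γ' : Scope S} {k : Kind S} {a b : Ex ς γ k} (σ : Sub ς γ γ'), σ.Bounded N →
      R.Red a b → R.Conv (a.sub σ) (b.sub σ)) ∧
    (∀ {γ γ' : Scope S} {k : Kind S} (e : Ex ς γ k) (σ τ : Sub ς γ γ'), R.ConvBounded N σ τ →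
      R.Conv (e.sub σ) (e.sub τ)) := by
  induction N using Nat.strong_induction_on with
  | _ N IH =>
  constructor
  · intro γ γ' k a b σ hσ h
    induction h generalizing γ' with
    | root hR hl hr v hv =>
      rw [Ex.subst_sub, Ex.subst_sub]
      exact Red.conv (.root hR hl hr _ (Ex.over_univ _))
    | @var γ δ s x ts us _ ih =>
      simp only [Ex.sub]
      rcases hσ x with ⟨y, h⟩ | h
      · rw [h, Var.eta_inst, Var.eta_inst]
        exact (ih σ hσ).var y
      · rw [Ex.inst_eq_sub, Ex.inst_eq_sub]
        exact (IH _ h).2 _ _ _ (convBounded_ofSp (ih σ hσ))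
    | con c h hc _ ih => exact (ih σ hσ).con c h
    | snocL t ht _ ih => exact (ih σ hσ).snoc (.refl _)
    | snocR ts hts _ ih => exact (Conv.refl _).snoc (ih _ (hσ.lift _))
    | tcon c h hs hc _ ih => exact (ih σ hσ).tcon c h hs
    | csnoc₁ Δ T hΔ hT _ ih => exact (ih σ hσ).csnoc (.refl _) (.refl _)
    | csnoc₂ Γ T hΓ hT _ ih => exact (Conv.refl _).csnoc (ih _ (hσ.lift _)) (.refl _)
    | csnoc₃ Γ Δ hΓ hΔ _ ih => exact (Conv.refl _).csnoc (.refl _) (ih _ ((hσ.lift _).lift _))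
  · intro γ γ' k e σ τ h
    induction e generalizing γ' with
    | @var γ δ s x ts ih =>
      simp only [Ex.sub]
      rcases h x with ⟨y, h₁, h₂⟩ | ⟨h₁, h₂⟩
      · rw [h₁, h₂, Var.eta_inst, Var.eta_inst]
        exact (ih σ τ h).var y
      · rw [Ex.inst_eq_sub, Ex.inst_eq_sub]
        exact (Conv.map (fun e => e.sub (Sub.ofSp (ts.sub σ)))
          (fun a b hab => (IH _ h₁).1 _ (Sub.bounded_ofSp _) hab) h₂).trans
          ((IH _ h₁).2 _ _ _ (convBounded_ofSp (ih σ τ h)))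
    | con c hc ts ih => exact (ih σ τ h).con c hc
    | nil => exact .refl _
    | snoc ts t ih₁ ih₂ => exact (ih₁ σ τ h).snoc (ih₂ _ _ (h.lift _))
    | tcon c hc hs ts ih => exact (ih σ τ h).tcon c hc hs
    | cnil => exact .refl _
    | csnoc Γ Δ T ih₁ ih₂ ih₃ =>
      exact (ih₁ σ τ h).csnoc (ih₂ _ _ (h.lift _)) (ih₃ _ _ ((h.lift _).lift _))

/-- Convertible substitutions. -/
def SubConv (R : RewSys ς) {γ γ' : Scope S} (σ τ : Sub ς γ γ') : Prop :=
  ∀ ⦃δ : Scope S⦄ ⦃s : S⦄ (x : Var γ δ s), R.Conv (σ x) (τ x)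

theorem Conv.sub_left {γ γ' : Scope S} {k : Kind S} {a b : Ex ς γ k} (h : R.Conv a b)
    (σ : Sub ς γ γ') : R.Conv (a.sub σ) (b.sub σ) :=
  Conv.map (fun e => e.sub σ) (fun _ _ h => (conv_sub_aux γ.rank).1 σ σ.bounded_rank h) h

theorem Conv.sub_right {γ γ' : Scope S} {k : Kind S} (e : Ex ς γ k) {σ τ : Sub ς γ γ'}
    (h : R.SubConv σ τ) : R.Conv (e.sub σ) (e.sub τ) :=
  (conv_sub_aux γ.rank).2 e σ τ fun _ _ x => .inr ⟨x.rank_lt, h x⟩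

theorem SubConv.lift {γ γ' : Scope S} {σ τ : Sub ς γ γ'} (h : R.SubConv σ τ) (θ : Scope S) :
    R.SubConv (σ.lift θ) (τ.lift θ) := by
  intro δ s x
  rcases x.inl_or_inr θ with ⟨y, rfl⟩ | ⟨z, rfl⟩
  · simpa using (h y).rename _
  · simpa using Conv.refl _

theorem SubConv.ofSp {γ δ : Scope S} {ts us : Sp ς γ δ} (h : R.Conv ts us) :
    R.SubConv (Sub.ofSp ts) (Sub.ofSp us) := by
  intro β s x
  rcases x.inl_or_inr δ with ⟨y, rfl⟩ | ⟨z, rfl⟩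
  · simpa using Conv.refl _
  · simpa using h.get z

theorem SubConv.ofSp' {γ δ : Scope S} {ts us : Sp ς γ δ} (h : R.Conv ts us) :
    R.SubConv (Sub.ofSp' ts) (Sub.ofSp' us) := fun _ _ x => h.get x

/-! ### Inversion of reduction and conversion -/

theorem red_tcon_inv {γ δ : Scope S} {s : S} {c : Fin n} {h : ς.arity c = .ty δ}
    {hs : ς.era c = s} {ts : Sp ς γ δ} {e : Ty ς γ s} (hr : R.Red (Ex.tcon c h hs ts) e) :
    ∃ us, e = Ex.tcon c h hs us ∧ R.Red ts us := by
  cases hr with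
  | tcon _ _ _ _ hr => exact ⟨_, rfl, hr⟩

theorem red_tcon_inv' {γ δ : Scope S} {s : S} {c : Fin n} {h : ς.arity c = .ty δ}
    {hs : ς.era c = s} {ts : Sp ς γ δ} {e : Ty ς γ s} (hr : R.Red e (Ex.tcon c h hs ts)) :
    ∃ us, e = Ex.tcon c h hs us ∧ R.Red us ts := by
  cases hr with
  | tcon _ _ _ _ hr => exact ⟨_, rfl, hr⟩

/-- Rules relate terms, so no step touches the head of a type. No confluence is involved. -/
theorem conv_tcon_inv {γ δ : Scope S} {s : S} {c : Fin n} {h : ς.arity c = .ty δ}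
    {hs : ς.era c = s} {ts : Sp ς γ δ} {e : Ty ς γ s} (hr : R.Conv (Ex.tcon c h hs ts) e) :
    ∃ us, e = Ex.tcon c h hs us ∧ R.Conv ts us := by
  -- Both directions are carried through the induction to cope with the symmetric closure.
  have key : ∀ {e e' : Ty ς γ s}, R.Conv e e' →
      (∀ ts, e = Ex.tcon c h hs ts → ∃ us, e' = Ex.tcon c h hs us ∧ R.Conv ts us) ∧
      (∀ ts, e' = Ex.tcon c h hs ts → ∃ us, e = Ex.tcon c h hs us ∧ R.Conv ts us) := by
    intro e e' he
    induction he with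
    | rel a b hab =>
      constructor
      · rintro ts rfl
        obtain ⟨us, rfl, h'⟩ := red_tcon_inv hab
        exact ⟨us, rfl, Red.conv h'⟩
      · rintro ts rfl
        obtain ⟨us, rfl, h'⟩ := red_tcon_inv' hab
        exact ⟨us, rfl, (Red.conv h').symm⟩
    | refl a => exact ⟨fun ts h => ⟨ts, h, .refl _⟩, fun ts h => ⟨ts, h, .refl _⟩⟩
    | symm a b _ ih => exact ⟨ih.2, ih.1⟩
    | trans a b d _ _ ih₁ ih₂ =>
      constructor
      · intro ts hts
        obtain ⟨us, hus, h₁⟩ := ih₁.1 ts hts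
        obtain ⟨vs, hvs, h₂⟩ := ih₂.1 us hus
        exact ⟨vs, hvs, h₁.trans h₂⟩
      · intro ts hts
        obtain ⟨us, hus, h₁⟩ := ih₂.2 ts hts
        obtain ⟨vs, hvs, h₂⟩ := ih₁.2 us hus
        exact ⟨vs, hvs, h₁.trans h₂⟩
  exact (key hr).1 ts rfl

/-- A step of a term `c(t)` takes place in `t`, unless `c` is the head of a rule, or a rule
rewrites a variable, and hence any term of the same scope and sort. -/
theorem red_con_inv {γ δ : Scope S} {s : S} {c : Fin n} {h : ς.arity c = .tm δ s}
    {ts : Sp ς γ δ} {e : Tm ς γ s} (hr : R.Red (Ex.con c h ts) e) :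
    (∃ us, e = Ex.con c h us ∧ R.Red ts us) ∨ R.IsHead c ∨
      ∀ t : Tm ς γ s, ∃ t', R.Red t t' := by
  generalize ha : Ex.con c h ts = a at hr
  cases hr with
  | con c' h' hc hr =>
    cases ha
    exact .inl ⟨_, rfl, hr⟩
  | var x hr => cases ha
  | @root _ δ' _ l r hR hl hr v hv =>
    cases l with
    | con c' h' us =>
      right; left
      rw [Ex.subst_eq_sub, Ex.sub] at ha
      cases ha
      exact ⟨_, _, _, h', us, r, hR⟩
    | @var _ θ _ x us =>
      right; right
      -- At the root of a pattern every variable counts as flexible, whereas the arguments of a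
      -- flexible variable must not be; hence the head variable has no arguments.
      obtain ⟨ρ, -, hρ, -⟩ := (R.lhs_pattern hR).1 trivial
      cases θ with
      | snoc θ β q => exact absurd trivial (hρ .zero)
      | nil =>
        intro t
        -- The left-hand side is a bare variable, so instantiating it by `t` turns the rule into a
        -- step from `t`.
        obtain ⟨v', hv'⟩ := Ex.exists_get_eq v x t
        refine ⟨r.subst v', ?_⟩
        have : (Ex.var x us).subst v' = t := by
          rw [Ex.subst_eq_sub, Ex.sub, Sub.ofSp'_apply, hv']
          exact (Ex.inst_eq_sub (δ := .nil) _ _).trans (Ex.sub_ofSp_nil _ _)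
        have hs := Step.root (P := Set.univ) hR hl hr v' v'.over_univ
        rwa [this] at hs

/-! ### Strong normalisation -/

/-- The expression has no infinite reduction sequence. -/
def SN (R : RewSys ς) {γ : Scope S} {k : Kind S} (e : Ex ς γ k) : Prop :=
  Acc (fun a b : Ex ς γ k => R.Red b a) e

theorem SN.red {γ : Scope S} {k : Kind S} {e e' : Ex ς γ k} (h : R.SN e) (hr : R.Red e e') :
    R.SN e' := Acc.inv h hr

theorem SN.reds {γ : Scope S} {k : Kind S} {e e' : Ex ς γ k} (h : R.SN e)
    (hr : ReflTransGen R.Red e e') : R.SN e' := by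
  induction hr with
  | refl => exact h
  | tail _ hr ih => exact ih.red hr

/-- An infinite reduction from `e` would be carried by `f` to one from its image. -/
theorem SN.of_map {γ γ' : Scope S} {k k' : Kind S} (f : Ex ς γ k → Ex ς γ' k')
    (hf : ∀ a b, R.Red a b → R.Red (f a) (f b)) {e : Ex ς γ k} (h : R.SN (f e)) : R.SN e := by
  generalize he : f e = e' at h
  induction h generalizing e with
  | intro e' _ ih =>
    subst he
    exact Acc.intro _ fun a ha => ih (f a) (hf _ _ ha) rfl

/-- This excludes the degenerate alternative of `red_con_inv`: a rule that rewrites every term of a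
scope and sort leaves no strongly normalising term there. -/
theorem SN.exists_normal {γ : Scope S} {k : Kind S} {e : Ex ς γ k} (h : R.SN e) :
    ¬ ∀ t : Ex ς γ k, ∃ t', R.Red t t' := by
  intro hall
  induction h with
  | intro e _ ih =>
    obtain ⟨t', ht'⟩ := hall e
    exact ih t' ht'

theorem sn_nil {γ : Scope S} : R.SN (Ex.nil : Sp ς γ .nil) :=
  Acc.intro _ fun a ha => by cases ha

/-- The components of a spine reduce independently, so nested inductions on the two accessibility
proofs suffice. -/
theorem sn_snoc_iff {γ δ θ : Scope S} {s : S} {ts : Sp ς γ δ} {t : Tm ς (γ ⧺ θ) s} :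
    R.SN (Ex.snoc ts t) ↔ R.SN ts ∧ R.SN t := by
  constructor
  · intro h
    exact ⟨SN.of_map (Ex.snoc · t) (fun _ _ h => .snocL t t.over_univ h) h,
      SN.of_map (Ex.snoc ts) (fun _ _ h => .snocR ts ts.over_univ h) h⟩
  · rintro ⟨h₁, h₂⟩
    induction h₁ generalizing t with
    | intro ts hts ih₁ =>
      induction h₂ with
      | intro t ht ih₂ =>
        refine Acc.intro _ fun a ha => ?_
        cases ha with
        | snocL _ _ h => exact ih₁ _ h (Acc.intro _ ht)
        | snocR _ _ h => exact ih₂ _ h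

theorem sn_spAppend_iff {γ δ θ : Scope S} {ts : Sp ς γ δ} {us : Sp ς γ θ} :
    R.SN (ts.spAppend us) ↔ R.SN ts ∧ R.SN us := by
  induction θ with
  | nil => cases us; exact ⟨fun h => ⟨h, sn_nil⟩, fun h => h.1⟩
  | snoc θ _ _ ih =>
    cases us with | snoc us u =>
    have h : R.SN (ts.spAppend (.snoc us u)) ↔ R.SN (ts.spAppend us) ∧ R.SN u := sn_snoc_iff
    rw [h, ih, sn_snoc_iff, and_assoc]

theorem sn_tcon_iff {γ δ : Scope S} {s : S} {c : Fin n} {h : ς.arity c = .ty δ}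
    {hs : ς.era c = s} {ts : Sp ς γ δ} : R.SN (Ex.tcon c h hs ts) ↔ R.SN ts := by
  constructor
  · exact SN.of_map (Ex.tcon c h hs) (fun _ _ h' => .tcon c h hs trivial h')
  · intro h'
    induction h' with
    | intro ts _ ih =>
      refine Acc.intro _ fun a ha => ?_
      obtain ⟨us, rfl, hus⟩ := red_tcon_inv ha
      exact ih _ hus

theorem SN.of_con {γ δ : Scope S} {s : S} {c : Fin n} {h : ς.arity c = .tm δ s}
    {ts : Sp ς γ δ} : R.SN (Ex.con c h ts) → R.SN ts :=
  SN.of_map (Ex.con c h) (fun _ _ h' => .con c h trivial h')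

/-- Reductions of the renamed expression are pulled back along `ρ'`. In use, `ρ` is a reassociation
of scopes. -/
theorem SN.rename_of_inverse {γ γ' : Scope S} {k : Kind S} {e : Ex ς γ k} (h : R.SN e)
    {ρ : Ren γ γ'} {ρ' : Ren γ' γ} (hρ : ρ.comp ρ' = Ren.id γ) :
    R.SN (e.rename ρ) := by
  apply SN.of_map (Ex.rename ρ') (fun _ _ h => red_rename h ρ')
  rwa [Ex.rename_rename, hρ, Ex.rename_id]

/-- The term `u` need not be related to the reduction: it only witnesses that some term of this
scope and sort is strongly normalising, which rules out rules with a variable on the left. -/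
theorem reds_con_inv {γ δ : Scope S} {s : S} {c : Fin n} {h : ς.arity c = .tm δ s}
    {ts : Sp ς γ δ} {e u : Tm ς γ s} (hc : ¬ R.IsHead c) (hu : R.SN u)
    (hr : ReflTransGen R.Red (Ex.con c h ts) e) :
    ∃ us, e = Ex.con c h us ∧ ReflTransGen R.Red ts us := by
  induction hr with
  | refl => exact ⟨ts, rfl, .refl⟩
  | tail _ hr ih =>
    obtain ⟨us, rfl, hus⟩ := ih
    rcases red_con_inv hr with ⟨vs, rfl, hvs⟩ | h | h
    · exact ⟨vs, rfl, hus.tail hvs⟩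
    · exact absurd h hc
    · exact absurd h hu.exists_normal

end RewSys

/-! ### Consequences of confluence -/

namespace Theory

open Relation RewSys

variable {𝕋 : Theory ς}

theorem Confluent.join (hconf : 𝕋.Confluent) {γ : Scope S} {s : S} {t u : Tm ς γ s}
    (h : 𝕋.rew.Conv t u) :
    ∃ v, ReflTransGen 𝕋.rew.Red t v ∧ ReflTransGen 𝕋.rew.Red u v := by
  induction h with
  | rel a b h => exact ⟨b, .single h, .refl⟩
  | refl a => exact ⟨a, .refl, .refl⟩
  | symm a b _ ih => obtain ⟨v, h₁, h₂⟩ := ih; exact ⟨v, h₂, h₁⟩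
  | trans a b d _ _ ih₁ ih₂ =>
    obtain ⟨v, h₁, h₂⟩ := ih₁
    obtain ⟨w, h₃, h₄⟩ := ih₂
    obtain ⟨x, h₅, h₆⟩ := hconf _ _ _ h₂ h₃
    exact ⟨x, h₁.trans h₅, h₄.trans h₆⟩

theorem _root_.CompLF.RewSys.eq_of_normal_reds {R : RewSys ς} {γ : Scope S} {k : Kind S}
    {e e' : Ex ς γ k} (hn : ¬ ∃ e', R.Red e e') (h : ReflTransGen R.Red e e') : e = e' := by
  rcases h.cases_head with h | ⟨e'', h, -⟩
  · exact h
  · exact absurd ⟨e'', h⟩ hn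

theorem Confluent.normal_tm (hconf : 𝕋.Confluent) {γ : Scope S} {s : S} {t u : Tm ς γ s}
    (ht : ¬ ∃ e', 𝕋.rew.Red t e') (hu : ¬ ∃ e', 𝕋.rew.Red u e') (h : 𝕋.rew.Conv t u) : t = u := by
  obtain ⟨v, h₁, h₂⟩ := hconf.join h
  rw [eq_of_normal_reds ht h₁, eq_of_normal_reds hu h₂]

/-- Conversion of spines is componentwise, so confluence on terms is enough; types then follow from
`conv_tcon_inv`. -/
theorem Confluent.normal_sp (hconf : 𝕋.Confluent) {γ δ : Scope S} {t u : Sp ς γ δ}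
    (ht : ¬ ∃ e', 𝕋.rew.Red t e') (hu : ¬ ∃ e', 𝕋.rew.Red u e') (h : 𝕋.rew.Conv t u) : t = u := by
  induction δ with
  | nil => cases t; cases u; rfl
  | snoc δ θ s ih =>
    cases t with | snoc ts t =>
    cases u with | snoc us u =>
    obtain ⟨h₁, h₂⟩ := conv_snoc_iff.1 h
    rw [ih (fun ⟨e, he⟩ => ht ⟨_, .snocL t t.over_univ he⟩)
      (fun ⟨e, he⟩ => hu ⟨_, .snocL u u.over_univ he⟩) h₁,
      hconf.normal_tm (fun ⟨e, he⟩ => ht ⟨_, .snocR ts ts.over_univ he⟩)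
      (fun ⟨e, he⟩ => hu ⟨_, .snocR us us.over_univ he⟩) h₂]

theorem Confluent.normal_ty (hconf : 𝕋.Confluent) {γ : Scope S} {s : S} {t u : Ty ς γ s}
    (ht : ¬ ∃ e', 𝕋.rew.Red t e') (hu : ¬ ∃ e', 𝕋.rew.Red u e') (h : 𝕋.rew.Conv t u) : t = u := by
  cases t with | tcon c hc hs ts =>
  obtain ⟨us, rfl, hus⟩ := conv_tcon_inv h
  rw [hconf.normal_sp (fun ⟨e, he⟩ => ht ⟨_, .tcon c hc hs trivial he⟩)
    (fun ⟨e, he⟩ => hu ⟨_, .tcon c hc hs trivial he⟩) hus]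

namespace Strategy

variable {𝔖 : 𝕋.Strategy}

theorem Reds.reds {γ : Scope S} {k : Kind S} {e e' : Ex ς γ k} (h : 𝔖.Reds e e') :
    ReflTransGen 𝕋.rew.Red e e' := by
  induction h with
  | refl => exact .refl
  | tail _ h ih => exact ih.trans (𝔖.sub h).to_reflTransGen

theorem Nf.reds {γ : Scope S} {k : Kind S} {e e' : Ex ς γ k} (h : 𝔖.Nf e e') :
    ReflTransGen 𝕋.rew.Red e e' := Reds.reds h.1

theorem Nf.conv {γ : Scope S} {k : Kind S} {e e' : Ex ς γ k} (h : 𝔖.Nf e e') :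
    𝕋.rew.Conv e e' := reds_conv h.reds

theorem Nf.normal {γ : Scope S} {k : Kind S} {e e' : Ex ς γ k} (h : 𝔖.Nf e e') :
    ¬ ∃ e'', 𝕋.rew.Red e' e'' := (𝔖.normal_iff e').1 h.2

theorem exists_nf (𝔖 : 𝕋.Strategy) {γ : Scope S} {k : Kind S} {e : Ex ς γ k}
    (h : 𝕋.rew.SN e) : ∃ e', 𝔖.Nf e e' := by
  -- One step of the strategy may be several steps of rewriting, hence the induction along the
  -- transitive closure.
  have h' : Acc (TransGen fun a b : Ex ς γ k => 𝕋.rew.Red b a) e := Acc.transGen h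
  induction h' with
  | intro e _ ih =>
    by_cases hn : ∃ e', 𝔖.rel e e'
    · obtain ⟨e₁, he₁⟩ := hn
      have ht := 𝔖.sub he₁
      obtain ⟨e', he'⟩ := ih e₁ (transGen_swap.1 ht) (h.reds ht.to_reflTransGen)
      exact ⟨e', he'.1.head he₁, he'.2⟩
    · exact ⟨e, .refl, hn⟩

theorem nf_eq_sp (hconf : 𝕋.Confluent) {γ δ : Scope S} {e₁ e₂ w₁ w₂ : Sp ς γ δ}
    (h₁ : 𝔖.Nf e₁ w₁) (h₂ : 𝔖.Nf e₂ w₂) (h : 𝕋.rew.Conv e₁ e₂) : w₁ = w₂ :=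
  hconf.normal_sp h₁.normal h₂.normal ((h₁.conv.symm.trans h).trans h₂.conv)

theorem nf_eq_ty (hconf : 𝕋.Confluent) {γ : Scope S} {s : S} {e₁ e₂ w₁ w₂ : Ty ς γ s}
    (h₁ : 𝔖.Nf e₁ w₁) (h₂ : 𝔖.Nf e₂ w₂) (h : 𝕋.rew.Conv e₁ e₂) : w₁ = w₂ :=
  hconf.normal_ty h₁.normal h₂.normal ((h₁.conv.symm.trans h).trans h₂.conv)

end Strategy

/-- Both sides reach a common reduct, and reductions from a constant that is not the head of a rule
stay within its arguments. -/
theorem Confluent.con_inj (hconf : 𝕋.Confluent) {γ δ : Scope S} {s : S} {c : Fin n}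
    {h : ς.arity c = .tm δ s} {ts us : Sp ς γ δ} (hc : ¬ 𝕋.rew.IsHead c)
    (hsn : 𝕋.rew.SN (Ex.con c h us)) (hcv : 𝕋.rew.Conv (Ex.con c h us) (Ex.con c h ts)) :
    𝕋.rew.Conv us ts := by
  obtain ⟨q, h₁, h₂⟩ := hconf.join hcv
  obtain ⟨qs, rfl, hq⟩ := reds_con_inv hc hsn h₁
  obtain ⟨qs', he, hq'⟩ := reds_con_inv hc hsn h₂
  cases he
  exact (reds_conv hq).trans (reds_conv hq').symm

/-- The normal form of `u` is a common reduct with `c(ts)`, and every reduct of the latter still has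
head `c`. This is what exposes the head required by matching, whatever the strategy. -/
theorem Confluent.nf_con (hconf : 𝕋.Confluent) (𝔖 : 𝕋.Strategy) {γ δ : Scope S} {s : S}
    {c : Fin n} {h : ς.arity c = .tm δ s} {ts : Sp ς γ δ} {u : Tm ς γ s}
    (hc : ¬ 𝕋.rew.IsHead c) (hsn : 𝕋.rew.SN u) (hcv : 𝕋.rew.Conv u (Ex.con c h ts)) :
    ∃ us, 𝔖.Reds u (Ex.con c h us) := by
  obtain ⟨u', hu'⟩ := 𝔖.exists_nf hsn
  obtain ⟨q, h₁, h₂⟩ := hconf.join (hu'.conv.symm.trans hcv)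
  obtain ⟨qs, rfl, hq⟩ := reds_con_inv hc hsn h₂
  have := eq_of_normal_reds hu'.normal h₁
  exact ⟨qs, this ▸ hu'.1⟩

end Theory

/-! ### Weakening by one variable -/

/-- Weakening by one variable. -/
def Ren.succ (γ θ : Scope S) (s : S) : Ren γ (γ.snoc θ s) := fun _ _ x => .succ x

/-- Weakening by one variable, under the variables of `δ`. -/
def Ren.wks (γ δ θ : Scope S) (s : S) : Ren (γ ⧺ δ) (γ ⧺ δ.snoc θ s) := fun _ _ x => Var.succ x

@[simp] theorem Ren.wks_inl {γ δ θ β : Scope S} {s r : S} (y : Var γ β r) :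
    Ren.wks γ δ θ s (y.inl δ) = y.inl (δ.snoc θ s) := rfl

@[simp] theorem Ren.wks_inr {γ δ θ β : Scope S} {s r : S} (z : Var δ β r) :
    Ren.wks γ δ θ s z.inr = (Var.succ z : Var (δ.snoc θ s) β r).inr := rfl

theorem Sub.wks_thenSub_lift {γ γ' : Scope S} (σ : Sub ς γ γ') (δ θ : Scope S) (s : S) :
    (Ren.wks γ δ θ s).thenSub (σ.lift (δ.snoc θ s)) = (σ.lift δ).thenRen (Ren.wks γ' δ θ s) := by
  apply Sub.ext_append
  · intro β r y
    simp only [Ren.thenSub_apply, Ren.wks_inl, Sub.lift_inl, Sub.thenRen_apply, Ex.rename_rename]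
    congr 1
    apply Ren.ext_append <;> simp
  · intro β r z
    simp [Var.eta_rename]

theorem Sub.wks_thenSub_ofSp {γ δ θ : Scope S} {s : S} (ts : Sp ς γ δ) (t : Tm ς (γ ⧺ θ) s) :
    (Ren.wks γ δ θ s).thenSub (Sub.ofSp (Ex.snoc ts t)) = Sub.ofSp ts :=
  Sub.ext_append (by simp) (by simp [Ex.get])

theorem Sub.wkl_lift_thenSub_ofSp_id (γ δ : Scope S) :
    ((Ren.wkl γ δ).lift δ).thenSub (Sub.ofSp ((idSp ς δ).rename (Ren.wkr γ δ))) =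
      Sub.id ς (γ ⧺ δ) := by
  apply Sub.ext_append
  · intro β r y; simp
  · intro β r z; simp [Ex.get_rename, get_idSp, Var.eta_rename]

/-! ### The entries of contexts -/

/-- The context `Θ` of the entry `x : Θ → T` of `Δ`. -/
def Ex.cdom : {γ δ θ : Scope S} → {s : S} → Ctx ς γ δ → Var δ θ s → Ctx ς (γ ⧺ δ) θ
  | _, _, _, _, .csnoc _ Θ _, .zero => Θ.rename (Ren.wks _ _ _ _)
  | _, _, _, _, .csnoc Δ _ _, .succ x => (Ex.cdom Δ x).rename (Ren.wks _ _ _ _)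

/-- The type `T` of the entry `x : Θ → T` of `Δ`. -/
def Ex.ccod : {γ δ θ : Scope S} → {s : S} → Ctx ς γ δ → Var δ θ s → Ty ς ((γ ⧺ δ) ⧺ θ) s
  | _, _, _, _, .csnoc (θ := θ) _ _ T, .zero => T.rename ((Ren.wks _ _ _ _).lift θ)
  | _, _, θ, _, .csnoc Δ _ _, .succ x => (Ex.ccod Δ x).rename ((Ren.wks _ _ _ _).lift θ)

theorem Cx.dom_append_inr {γ δ θ : Scope S} {s : S} (Γ : Cx ς γ) (Δ : Ctx ς γ δ)
    (x : Var δ θ s) : (Γ.append Δ).dom x.inr = Δ.cdom x := by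
  induction x with
  | zero => cases Δ; rfl
  | succ x ih => cases Δ with | csnoc Δ Θ T => exact congrArg (Ex.rename (Ren.wks _ _ _ _)) (ih Δ)

theorem Cx.cod_append_inr {γ δ θ : Scope S} {s : S} (Γ : Cx ς γ) (Δ : Ctx ς γ δ)
    (x : Var δ θ s) : (Γ.append Δ).cod x.inr = Δ.ccod x := by
  induction x with
  | zero => cases Δ; rfl
  | succ x ih =>
    cases Δ with | csnoc Δ Θ T =>
    exact congrArg (Ex.rename ((Ren.wks _ _ _ _).lift _)) (ih Δ)

theorem Cx.dom_append_inl {γ δ θ : Scope S} {s : S} (Γ : Cx ς γ) (Δ : Ctx ς γ δ)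
    (x : Var γ θ s) : (Γ.append Δ).dom (x.inl δ) = (Γ.dom x).rename (Ren.wkl γ δ) := by
  induction δ with
  | nil => cases Δ; exact (Ex.rename_id _).symm
  | snoc δ _ _ ih =>
    cases Δ with | csnoc Δ Θ T =>
    exact (congrArg (Ex.rename (Ren.wks _ _ _ _)) (ih Δ)).trans (Ex.rename_rename _ _ _)

theorem Cx.cod_append_inl {γ δ θ : Scope S} {s : S} (Γ : Cx ς γ) (Δ : Ctx ς γ δ)
    (x : Var γ θ s) : (Γ.append Δ).cod (x.inl δ) = (Γ.cod x).rename ((Ren.wkl γ δ).lift θ) := by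
  induction δ with
  | nil =>
    cases Δ
    have h : (Ren.wkl γ .nil).lift θ = Ren.id (γ ⧺ θ) := Ren.lift_id θ
    exact ((congrArg (fun ρ => Ex.rename ρ (Γ.cod x)) h).trans (Ex.rename_id _)).symm
  | snoc δ _ _ ih =>
    cases Δ with | csnoc Δ Θ T =>
    refine (congrArg (Ex.rename ((Ren.wks _ _ _ _).lift _)) (ih Δ)).trans
      ((Ex.rename_rename _ _ _).trans ?_)
    rw [Ren.lift_comp]; rfl

theorem Ex.cdom_sub {γ γ' δ θ : Scope S} {s : S} (Δ : Ctx ς γ δ) (σ : Sub ς γ γ')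
    (x : Var δ θ s) : (Δ.sub σ).cdom x = (Δ.cdom x).sub (σ.lift δ) := by
  induction x with
  | zero =>
    cases Δ with | csnoc Δ Θ T =>
    simp only [Ex.sub, Ex.cdom, Ex.rename_sub, Sub.wks_thenSub_lift, Ex.sub_rename]
  | succ x ih =>
    cases Δ with | csnoc Δ Θ T =>
    simp only [Ex.sub, Ex.cdom, Ex.rename_sub, Sub.wks_thenSub_lift, Ex.sub_rename, ih]

theorem Ex.ccod_sub {γ γ' δ θ : Scope S} {s : S} (Δ : Ctx ς γ δ) (σ : Sub ς γ γ')
    (x : Var δ θ s) : (Δ.sub σ).ccod x = (Δ.ccod x).sub ((σ.lift δ).lift θ) := by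
  induction x with
  | zero =>
    cases Δ with | csnoc Δ Θ T =>
    simp only [Ex.sub, Ex.ccod, Ex.rename_sub, Sub.lift_thenSub_lift, Sub.wks_thenSub_lift,
      Ex.sub_rename, Sub.lift_thenRen_lift]
  | succ x ih =>
    cases Δ with | csnoc Δ Θ T =>
    simp only [Ex.sub, Ex.ccod, Ex.rename_sub, Sub.lift_thenSub_lift, Sub.wks_thenSub_lift,
      Ex.sub_rename, Sub.lift_thenRen_lift, ih]

theorem Ex.cdom_rename {γ γ' δ θ : Scope S} {s : S} (Δ : Ctx ς γ δ) (ρ : Ren γ γ')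
    (x : Var δ θ s) : (Δ.rename ρ).cdom x = (Δ.cdom x).rename (ρ.lift δ) := by
  rw [Ex.rename_eq_sub, Ex.cdom_sub, Sub.ofRen_lift, ← Ex.rename_eq_sub]

theorem Ex.ccod_rename {γ γ' δ θ : Scope S} {s : S} (Δ : Ctx ς γ δ) (ρ : Ren γ γ')
    (x : Var δ θ s) : (Δ.rename ρ).ccod x = (Δ.ccod x).rename ((ρ.lift δ).lift θ) := by
  rw [Ex.rename_eq_sub, Ex.ccod_sub, Sub.ofRen_lift, Sub.ofRen_lift, ← Ex.rename_eq_sub]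

theorem Cx.cdom_wk {γ δ θ : Scope S} {s : S} (Δ : Cx ς δ) (x : Var δ θ s) :
    (Δ.wk γ).cdom x = (Δ.dom x).rename (Ren.wkr γ δ) := by
  induction x with
  | @zero δ θ s =>
    cases Δ with | snoc Δ Θ T =>
    change (Ex.rename (Ren.wkr γ δ) Θ).rename (Ren.wks γ δ θ s) =
      (Θ.rename (Ren.succ δ θ s)).rename (Ren.wkr γ (δ.snoc θ s))
    rw [Ex.rename_rename, Ex.rename_rename]; rfl
  | @succ δ θ β s r x ih =>
    cases Δ with | snoc Δ Θ T =>
    change Ex.rename (Ren.wks γ δ β r) ((Δ.wk γ).cdom x) =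
      ((Δ.dom x).rename (Ren.succ δ β r)).rename (Ren.wkr γ (δ.snoc β r))
    rw [ih, Ex.rename_rename, Ex.rename_rename]; rfl

theorem Cx.ccod_wk {γ δ θ : Scope S} {s : S} (Δ : Cx ς δ) (x : Var δ θ s) :
    (Δ.wk γ).ccod x = (Δ.cod x).rename ((Ren.wkr γ δ).lift θ) := by
  induction x with
  | @zero δ θ s =>
    cases Δ with | snoc Δ Θ T =>
    change (Ex.rename ((Ren.wkr γ δ).lift θ) T).rename ((Ren.wks γ δ θ s).lift θ) =
      (T.rename ((Ren.succ δ θ s).lift θ)).rename ((Ren.wkr γ (δ.snoc θ s)).lift θ)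
    rw [Ex.rename_rename, Ex.rename_rename, Ren.lift_comp, Ren.lift_comp]; rfl
  | @succ δ θ β s r x ih =>
    cases Δ with | snoc Δ Θ T =>
    change Ex.rename ((Ren.wks γ δ β r).lift θ) ((Δ.wk γ).ccod x) =
      ((Δ.cod x).rename ((Ren.succ δ β r).lift θ)).rename ((Ren.wkr γ (δ.snoc β r)).lift θ)
    rw [ih, Ex.rename_rename, Ex.rename_rename, Ren.lift_comp, Ren.lift_comp]; rfl

theorem Cx.wk_sub {γ γ' δ : Scope S} (Δ : Cx ς δ) (σ : Sub ς γ γ') :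
    (Δ.wk γ).sub σ = Δ.wk γ' := by
  induction Δ with
  | nil => rfl
  | snoc Δ Θ T ih =>
    simp only [Cx.wk, Ex.sub, ih, Ex.rename_sub, Sub.lift_thenSub_lift, Sub.wkr_thenSub_lift,
      Sub.ofRen_lift, ← Ex.rename_eq_sub]

theorem Erasure.act_sub {γ γ' φ δ : Scope S} (ν : Erasure φ δ) (ts : Sp ς γ φ)
    (σ : Sub ς γ γ') : (ν.act ts).sub σ = ν.act (ts.sub σ) := by
  induction ν with
  | nil => cases ts; rfl
  | keep ν ih => cases ts with | snoc ts t => simp only [Erasure.act, Ex.sub, ih]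
  | erase ν ih => cases ts with | snoc ts t => simp only [Erasure.act, Ex.sub, ih]

/-! ### Typed substitutions -/

namespace Theory

variable {𝕋 : Theory ς}

/-- The rule for spines types each argument over the preceding ones. Instantiating the entry,
weakened to the full scope, at the whole spine gives the same result, because the later variables do
not occur in it. -/
theorem HasCtx.get {γ δ θ : Scope S} {s : S} {Γ : Cx ς γ} {ts : Sp ς γ δ} {Δ : Ctx ς γ δ}
    (h : 𝕋.HasCtx Γ ts Δ) (x : Var δ θ s) :
    𝕋.HasType (Γ.append ((Δ.cdom x).inst ts)) (ts.get x) ((Δ.ccod x).instUnder θ ts) := by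
  induction x with
  | zero =>
    cases h with | extSp _ _ h₁ h₂ =>
    simpa only [Ex.cdom, Ex.ccod, Ex.get, Ex.inst_eq_sub, Ex.instUnder_eq_sub, Ex.rename_sub,
      Sub.lift_thenSub_lift, Sub.wks_thenSub_ofSp] using h₂
  | succ x ih =>
    cases h with | extSp _ _ h₁ h₂ =>
    simpa only [Ex.cdom, Ex.ccod, Ex.get, Ex.inst_eq_sub, Ex.instUnder_eq_sub, Ex.rename_sub,
      Sub.lift_thenSub_lift, Sub.wks_thenSub_ofSp] using ih h₁

theorem hasCtx_of_get {γ δ : Scope S} {Γ : Cx ς γ} {ts : Sp ς γ δ} {Δ : Ctx ς γ δ}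
    (hΓ : 𝕋.WfCtx Γ)
    (h : ∀ ⦃θ s⦄ (x : Var δ θ s),
      𝕋.HasType (Γ.append ((Δ.cdom x).inst ts)) (ts.get x) ((Δ.ccod x).instUnder θ ts)) :
    𝕋.HasCtx Γ ts Δ := by
  induction δ with
  | nil => cases ts; cases Δ; exact .emptySp hΓ
  | snoc δ θ s ih =>
    cases ts with | snoc ts t =>
    cases Δ with | csnoc Δ Θ T =>
    refine .extSp (Ex.over_univ _) (Ex.over_univ _) (ih fun θ s x => ?_) ?_
    · simpa only [Ex.cdom, Ex.ccod, Ex.get, Ex.inst_eq_sub, Ex.instUnder_eq_sub, Ex.rename_sub,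
        Sub.lift_thenSub_lift, Sub.wks_thenSub_ofSp] using h x.succ
    · simpa only [Ex.cdom, Ex.ccod, Ex.get, Ex.inst_eq_sub, Ex.instUnder_eq_sub, Ex.rename_sub,
        Sub.lift_thenSub_lift, Sub.wks_thenSub_ofSp] using h .zero

/-- `σ` sends `x` to a variable of the same context and type. -/
def MorVar {γ γ' : Scope S} (Γ : Cx ς γ) (Γ' : Cx ς γ') (σ : Sub ς γ γ') {δ : Scope S} {s : S}
    (x : Var γ δ s) : Prop :=
  ∃ y : Var γ' δ s, σ x = y.eta ς ∧ Γ'.dom y = (Γ.dom x).sub σ ∧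
    Γ'.cod y = (Γ.cod x).sub (σ.lift δ)

/-- `σ` sends `x` to a term of the same context and type. -/
def MorTm (𝕋 : Theory ς) {γ γ' : Scope S} (Γ : Cx ς γ) (Γ' : Cx ς γ') (σ : Sub ς γ γ')
    {δ : Scope S} {s : S} (x : Var γ δ s) : Prop :=
  𝕋.HasType (Γ'.append ((Γ.dom x).sub σ)) (σ x) ((Γ.cod x).sub (σ.lift δ))

/-- Typed substitutions in which only variables with arities of rank less than `N` are sent to
terms. -/
def BMor (𝕋 : Theory ς) (N : ℕ) {γ γ' : Scope S} (Γ : Cx ς γ) (Γ' : Cx ς γ') (σ : Sub ς γ γ') :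
    Prop :=
  ∀ ⦃δ : Scope S⦄ ⦃s : S⦄ (x : Var γ δ s), MorVar Γ Γ' σ x ∨ δ.rank < N ∧ 𝕋.MorTm Γ Γ' σ x

/-- Well-formedness of a context, in any context into which there is a typed substitution. -/
def OkStable (𝕋 : Theory ς) (N : ℕ) : {γ : Scope S} → Cx ς γ → Prop
  | _, .nil => True
  | _, .snoc (γ := γ) (δ := δ) Γ Δ T => 𝕋.OkStable N Γ ∧
    ∀ ⦃γ' : Scope S⦄ (Γ' : Cx ς γ') (σ : Sub ς γ γ'), 𝕋.BMor N Γ Γ' σ → 𝕋.WfCtx Γ' →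
      𝕋.WfCtx (Γ'.snoc (Δ.sub σ) (T.sub (σ.lift δ)))

/-- Stability of a judgment under typed substitutions. -/
def Stable (𝕋 : Theory ς) (N : ℕ) : Jdg ς → Prop
  | .ok Γ => 𝕋.OkStable N Γ
  | .ty (γ := γ) Γ T => 𝕋.OkStable N Γ ∧
    ∀ ⦃γ' : Scope S⦄ (Γ' : Cx ς γ') (σ : Sub ς γ γ'), 𝕋.BMor N Γ Γ' σ → 𝕋.WfCtx Γ' →
      𝕋.IsType Γ' (T.sub σ)
  | .tm (γ := γ) Γ t T => 𝕋.OkStable N Γ ∧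
    ∀ ⦃γ' : Scope S⦄ (Γ' : Cx ς γ') (σ : Sub ς γ γ'), 𝕋.BMor N Γ Γ' σ → 𝕋.WfCtx Γ' →
      𝕋.HasType Γ' (t.sub σ) (T.sub σ)
  | .sp (γ := γ) Γ ts Δ => 𝕋.OkStable N Γ ∧
    ∀ ⦃γ' : Scope S⦄ (Γ' : Cx ς γ') (σ : Sub ς γ γ'), 𝕋.BMor N Γ Γ' σ → 𝕋.WfCtx Γ' →
      𝕋.HasCtx Γ' (ts.sub σ) (Δ.sub σ)

theorem MorVar.lift {γ γ' δ : Scope S} {Γ : Cx ς γ} {Γ' : Cx ς γ'} {σ : Sub ς γ γ'}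
    (Δ : Ctx ς γ δ) {θ : Scope S} {s : S} {x : Var γ θ s} (h : MorVar Γ Γ' σ x) :
    MorVar (Γ.append Δ) (Γ'.append (Δ.sub σ)) (σ.lift δ) (x.inl δ) := by
  obtain ⟨y, h₁, h₂, h₃⟩ := h
  refine ⟨y.inl δ, by simp [h₁, Var.eta_rename], ?_, ?_⟩
  · rw [Cx.dom_append_inl, Cx.dom_append_inl, h₂, Ex.rename_sub, Ex.sub_rename,
      Sub.wkl_thenSub_lift]
  · rw [Cx.cod_append_inl, Cx.cod_append_inl, h₃, Ex.rename_sub, Ex.sub_rename,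
      Sub.lift_thenSub_lift, Sub.lift_thenRen_lift, Sub.wkl_thenSub_lift]

theorem morVar_lift_inr {γ γ' δ : Scope S} (Γ : Cx ς γ) (Γ' : Cx ς γ') (σ : Sub ς γ γ')
    (Δ : Ctx ς γ δ) {θ : Scope S} {s : S} (x : Var δ θ s) :
    MorVar (Γ.append Δ) (Γ'.append (Δ.sub σ)) (σ.lift δ) x.inr := by
  refine ⟨x.inr, by simp, ?_, ?_⟩
  · rw [Cx.dom_append_inr, Cx.dom_append_inr, Ex.cdom_sub]
  · rw [Cx.cod_append_inr, Cx.cod_append_inr, Ex.ccod_sub]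

theorem bMor_zero_lift {γ γ' δ : Scope S} {Γ : Cx ς γ} {Γ' : Cx ς γ'} {σ : Sub ς γ γ'}
    (Δ : Ctx ς γ δ) (h : 𝕋.BMor 0 Γ Γ' σ) :
    𝕋.BMor 0 (Γ.append Δ) (Γ'.append (Δ.sub σ)) (σ.lift δ) := by
  intro θ s x
  rcases x.inl_or_inr δ with ⟨y, rfl⟩ | ⟨z, rfl⟩
  · rcases h y with h | ⟨h, -⟩
    · exact .inl (h.lift Δ)
    · exact absurd h (Nat.not_lt_zero _)
  · exact .inl (morVar_lift_inr Γ Γ' σ Δ z)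

theorem bMor_wkl {γ δ : Scope S} (Γ : Cx ς γ) (Δ : Ctx ς γ δ) :
    𝕋.BMor 0 Γ (Γ.append Δ) (Sub.ofRen ς (Ren.wkl γ δ)) := by
  intro θ s x
  refine .inl ⟨x.inl δ, rfl, ?_, ?_⟩
  · rw [Cx.dom_append_inl, Ex.rename_eq_sub]
  · rw [Cx.cod_append_inl, Ex.rename_eq_sub, Sub.ofRen_lift]

theorem OkStable.append_zero {γ δ : Scope S} {Γ : Cx ς γ} {Δ : Ctx ς γ δ}
    (h : 𝕋.OkStable 0 (Γ.append Δ)) {γ' : Scope S} {Γ' : Cx ς γ'} {σ : Sub ς γ γ'}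
    (hσ : 𝕋.BMor 0 Γ Γ' σ) (hΓ' : 𝕋.WfCtx Γ') : 𝕋.WfCtx (Γ'.append (Δ.sub σ)) := by
  induction δ with
  | nil => cases Δ; exact hΓ'
  | snoc δ θ s ih =>
    cases Δ with | csnoc Δ Θ T =>
    exact h.2 _ _ (bMor_zero_lift Δ hσ) (ih h.1)

/-- Weakening of judgments is enough to extend typed substitutions under binders. -/
theorem BMor.lift_of {N : ℕ} (h₀ : 0 < N → ∀ J, 𝕋.Der Set.univ J → 𝕋.Stable 0 J)
    {γ γ' δ : Scope S} {Γ : Cx ς γ} {Γ' : Cx ς γ'} {σ : Sub ς γ γ'} {Δ : Ctx ς γ δ}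
    (h : 𝕋.BMor N Γ Γ' σ) (hw : 𝕋.WfCtx (Γ'.append (Δ.sub σ))) :
    𝕋.BMor N (Γ.append Δ) (Γ'.append (Δ.sub σ)) (σ.lift δ) := by
  intro θ s x
  rcases x.inl_or_inr δ with ⟨y, rfl⟩ | ⟨z, rfl⟩
  · rcases h y with h | ⟨h, ht⟩
    · exact .inl (h.lift Δ)
    -- The image of `y` must be weakened by the new binder, underneath the binder of its own
    -- arguments. Weakening sends variables to variables, so stability with bound 0 covers it.
    · have hs := h₀ (Nat.zero_lt_of_lt h) _ ht
      have hm := bMor_zero_lift ((Γ.dom y).sub σ) (bMor_wkl (𝕋 := 𝕋) Γ' (Δ.sub σ))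
      have := hs.2 _ _ hm (hs.1.append_zero (bMor_wkl _ _) hw)
      refine .inr ⟨h, ?_⟩
      unfold MorTm
      rw [Cx.dom_append_inl, Cx.cod_append_inl, Ex.rename_sub, Ex.rename_sub,
        Sub.lift_thenSub_lift, Sub.wkl_thenSub_lift, Sub.lift_inl]
      rwa [Ex.sub_sub, Ex.sub_sub, Sub.lift_comp, Sub.comp_ofRen, Sub.ofRen_lift,
        ← Ex.rename_eq_sub] at this
  · exact .inl (morVar_lift_inr Γ Γ' σ Δ z)

theorem OkStable.of_append {N : ℕ} {γ δ : Scope S} {Γ : Cx ς γ} {Δ : Ctx ς γ δ}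
    (h : 𝕋.OkStable N (Γ.append Δ)) : 𝕋.OkStable N Γ := by
  induction δ with
  | nil => cases Δ; exact h
  | snoc δ θ s ih => cases Δ with | csnoc Δ Θ T => exact ih h.1

theorem OkStable.append {N : ℕ} (h₀ : 0 < N → ∀ J, 𝕋.Der Set.univ J → 𝕋.Stable 0 J)
    {γ δ : Scope S} {Γ : Cx ς γ} {Δ : Ctx ς γ δ}
    (h : 𝕋.OkStable N (Γ.append Δ)) {γ' : Scope S} {Γ' : Cx ς γ'} {σ : Sub ς γ γ'}
    (hσ : 𝕋.BMor N Γ Γ' σ) (hΓ' : 𝕋.WfCtx Γ') : 𝕋.WfCtx (Γ'.append (Δ.sub σ)) := by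
  induction δ with
  | nil => cases Δ; exact hΓ'
  | snoc δ θ s ih =>
    cases Δ with | csnoc Δ Θ T =>
    have hw := ih h.1
    exact h.2 _ _ (hσ.lift_of h₀ hw) hw

/-- The bound is the rank of `δ` alone, since the variables of `Γ` go to themselves. This is what
makes the induction of `Der.stable` decrease. -/
theorem bMor_ofSp {γ δ : Scope S} {Γ : Cx ς γ} {ts : Sp ς γ δ} {Δ : Ctx ς γ δ}
    (h : 𝕋.HasCtx Γ ts Δ) : 𝕋.BMor δ.rank (Γ.append Δ) Γ (Sub.ofSp ts) := by
  intro θ s x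
  rcases x.inl_or_inr δ with ⟨y, rfl⟩ | ⟨z, rfl⟩
  · refine .inl ⟨y, by simp, ?_, ?_⟩
    · rw [Cx.dom_append_inl, Ex.rename_sub, Sub.wkl_thenSub_ofSp, Ex.sub_id]
    · rw [Cx.cod_append_inl, Ex.rename_sub, Sub.lift_thenSub_lift, Sub.wkl_thenSub_ofSp,
        Sub.lift_id, Ex.sub_id]
  · refine .inr ⟨z.rank_lt, ?_⟩
    have := h.get z
    rw [Ex.inst_eq_sub, Ex.instUnder_eq_sub] at this
    unfold MorTm
    rwa [Cx.dom_append_inr, Cx.cod_append_inr, Sub.ofSp_inr]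

/-- Induction on the bound, then on the derivation. With bound 0 the substitutions are renamings,
which provides the weakening needed to go under binders for every larger bound. `OkStable`
accompanies each judgment so that the target context, extended by a substituted binder, is known to
be well-formed. -/
theorem Der.stable (N : ℕ) : ∀ {J : Jdg ς}, 𝕋.Der Set.univ J → 𝕋.Stable N J := by
  induction N using Nat.strong_induction_on with
  | _ N IH =>
  have h₀ : 0 < N → ∀ J, 𝕋.Der Set.univ J → 𝕋.Stable 0 J := fun h J hJ => IH 0 h hJ
  intro J h
  induction h with
  | emptyCtx => trivial
  | extCtx h ih =>
    refine ⟨ih.1.of_append, fun γ' Γ' σ hσ hΓ' => ?_⟩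
    have hw := ih.1.append h₀ hσ hΓ'
    exact .extCtx (ih.2 _ _ (hσ.lift_of h₀ hw) hw)
  | type hc hent h hs _ ih =>
    refine ⟨ih.1, fun γ' Γ' σ hσ hΓ' => ?_⟩
    have := ih.2 _ _ hσ hΓ'
    rw [Cx.wk_sub] at this
    simp only [Ex.sub, Erasure.act_sub]
    exact .type hc hent h hs this
  | const hc hent h _ ih =>
    refine ⟨ih.1, fun γ' Γ' σ hσ hΓ' => ?_⟩
    have := ih.2 _ _ hσ hΓ'
    rw [Cx.wk_sub] at this
    simp only [Ex.sub, Erasure.act_sub, Ex.subst_sub]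
    exact .const hc hent h this
  | @var γ δ s Γ x ts _ ih =>
    refine ⟨ih.1, fun γ' Γ' σ hσ hΓ' => ?_⟩
    have := ih.2 _ _ hσ hΓ'
    simp only [Ex.sub, Ex.inst_sub]
    rcases hσ x with ⟨y, h₁, h₂, h₃⟩ | ⟨hx, ht⟩
    · rw [h₁, Var.eta_inst, ← h₃]
      rw [← h₂] at this
      exact .var y this
    -- The result is the image of `x` instantiated at the substituted arguments: a further
    -- substitution, over the arity of `x`, of smaller rank.
    · have := (IH _ hx ht).2 _ _ (bMor_ofSp this) hΓ'
      rwa [← Ex.inst_eq_sub, ← Ex.inst_eq_sub] at this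
  | conv hc _ _ ih₁ ih₂ =>
    exact ⟨ih₁.1, fun γ' Γ' σ hσ hΓ' =>
      .conv (RewSys.Conv.sub_left hc σ) (ih₁.2 _ _ hσ hΓ') (ih₂.2 _ _ hσ hΓ')⟩
  | emptySp _ ih => exact ⟨ih, fun γ' Γ' σ hσ hΓ' => .emptySp hΓ'⟩
  | extSp _ _ _ _ ih₁ ih₂ =>
    refine ⟨ih₁.1, fun γ' Γ' σ hσ hΓ' => ?_⟩
    simp only [Ex.sub]
    refine .extSp (Ex.over_univ _) (Ex.over_univ _) (ih₁.2 _ _ hσ hΓ') ?_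
    have hw := ih₂.1.append h₀ hσ hΓ'
    have := ih₂.2 _ _ (hσ.lift_of h₀ hw) hw
    rwa [Ex.inst_sub, Ex.instUnder_sub] at this

/-- Typed substitutions from `Γ` to `Γ'`. -/
def Mor (𝕋 : Theory ς) {γ γ' : Scope S} (Γ : Cx ς γ) (Γ' : Cx ς γ') (σ : Sub ς γ γ') : Prop :=
  ∀ ⦃δ : Scope S⦄ ⦃s : S⦄ (x : Var γ δ s), MorVar Γ Γ' σ x ∨ 𝕋.MorTm Γ Γ' σ x

theorem Mor.bMor {γ γ' : Scope S} {Γ : Cx ς γ} {Γ' : Cx ς γ'} {σ : Sub ς γ γ'}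
    (h : 𝕋.Mor Γ Γ' σ) : 𝕋.BMor γ.rank Γ Γ' σ := fun _ _ x =>
  (h x).imp_right fun h => ⟨x.rank_lt, h⟩

theorem BMor.mor {N : ℕ} {γ γ' : Scope S} {Γ : Cx ς γ} {Γ' : Cx ς γ'} {σ : Sub ς γ γ'}
    (h : 𝕋.BMor N Γ Γ' σ) : 𝕋.Mor Γ Γ' σ := fun _ _ x => (h x).imp_right And.right

theorem IsType.sub {γ γ' : Scope S} {s : S} {Γ : Cx ς γ} {Γ' : Cx ς γ'} {σ : Sub ς γ γ'}
    {T : Ty ς γ s} (h : 𝕋.IsType Γ T) (hσ : 𝕋.Mor Γ Γ' σ) (hΓ' : 𝕋.WfCtx Γ') :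
    𝕋.IsType Γ' (T.sub σ) := (h.stable _).2 _ _ hσ.bMor hΓ'

theorem HasType.sub {γ γ' : Scope S} {s : S} {Γ : Cx ς γ} {Γ' : Cx ς γ'} {σ : Sub ς γ γ'}
    {t : Tm ς γ s} {T : Ty ς γ s} (h : 𝕋.HasType Γ t T) (hσ : 𝕋.Mor Γ Γ' σ) (hΓ' : 𝕋.WfCtx Γ') :
    𝕋.HasType Γ' (t.sub σ) (T.sub σ) := (h.stable _).2 _ _ hσ.bMor hΓ'

theorem HasCtx.sub {γ γ' δ : Scope S} {Γ : Cx ς γ} {Γ' : Cx ς γ'} {σ : Sub ς γ γ'}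
    {ts : Sp ς γ δ} {Δ : Ctx ς γ δ} (h : 𝕋.HasCtx Γ ts Δ) (hσ : 𝕋.Mor Γ Γ' σ)
    (hΓ' : 𝕋.WfCtx Γ') : 𝕋.HasCtx Γ' (ts.sub σ) (Δ.sub σ) := (h.stable _).2 _ _ hσ.bMor hΓ'

theorem WfCtx.append_sub {γ γ' δ : Scope S} {Γ : Cx ς γ} {Γ' : Cx ς γ'} {σ : Sub ς γ γ'}
    {Δ : Ctx ς γ δ} (h : 𝕋.WfCtx (Γ.append Δ)) (hσ : 𝕋.Mor Γ Γ' σ) (hΓ' : 𝕋.WfCtx Γ') :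
    𝕋.WfCtx (Γ'.append (Δ.sub σ)) :=
  OkStable.append (fun _ _ h => h.stable 0) (h.stable _) hσ.bMor hΓ'

theorem Mor.lift {γ γ' δ : Scope S} {Γ : Cx ς γ} {Γ' : Cx ς γ'} {σ : Sub ς γ γ'}
    {Δ : Ctx ς γ δ} (hσ : 𝕋.Mor Γ Γ' σ) (hw : 𝕋.WfCtx (Γ'.append (Δ.sub σ))) :
    𝕋.Mor (Γ.append Δ) (Γ'.append (Δ.sub σ)) (σ.lift δ) :=
  (hσ.bMor.lift_of (fun _ _ h => h.stable 0) hw).mor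

/-! ### Presuppositions -/

/-- All the prefixes of the context are well-formed. -/
def PrefixOk (𝕋 : Theory ς) : {γ : Scope S} → Cx ς γ → Prop
  | _, .nil => True
  | _, .snoc Γ Δ T => 𝕋.PrefixOk Γ ∧ 𝕋.WfCtx (Γ.snoc Δ T)

theorem PrefixOk.of_append {γ δ : Scope S} {Γ : Cx ς γ} {Δ : Ctx ς γ δ}
    (h : 𝕋.PrefixOk (Γ.append Δ)) : 𝕋.PrefixOk Γ := by
  induction δ with
  | nil => cases Δ; exact h
  | snoc δ θ s ih => cases Δ with | csnoc Δ Θ T => exact ih h.1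

theorem PrefixOk.wf {γ : Scope S} {Γ : Cx ς γ} (h : 𝕋.PrefixOk Γ) : 𝕋.WfCtx Γ := by
  cases Γ with
  | nil => exact .emptyCtx
  | snoc Γ Δ T => exact h.2

/-- All the prefixes of the context of a judgment are well-formed. -/
def CtxOk (𝕋 : Theory ς) : Jdg ς → Prop
  | .ok Γ => 𝕋.PrefixOk Γ
  | .ty Γ _ => 𝕋.PrefixOk Γ
  | .tm Γ _ _ => 𝕋.PrefixOk Γ
  | .sp Γ _ _ => 𝕋.PrefixOk Γ

/-- The rule of context extension has a premise about a type over a longer context, so the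
well-formedness of shorter contexts has to be collected along the derivation. -/
theorem Der.ctxOk {J : Jdg ς} (h : 𝕋.Der Set.univ J) : 𝕋.CtxOk J := by
  induction h with
  | emptyCtx => trivial
  | extCtx h ih => exact ⟨PrefixOk.of_append ih, .extCtx h⟩
  | type _ _ _ _ _ ih => exact ih
  | const _ _ _ _ ih => exact ih
  | var _ _ ih => exact ih
  | conv _ _ _ ih _ => exact ih
  | emptySp h ih => exact ih
  | extSp _ _ _ _ ih _ => exact ih

theorem IsType.wf {γ : Scope S} {s : S} {Γ : Cx ς γ} {T : Ty ς γ s} (h : 𝕋.IsType Γ T) :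
    𝕋.WfCtx Γ := PrefixOk.wf h.ctxOk

theorem HasType.wf {γ : Scope S} {s : S} {Γ : Cx ς γ} {t : Tm ς γ s} {T : Ty ς γ s}
    (h : 𝕋.HasType Γ t T) : 𝕋.WfCtx Γ := PrefixOk.wf h.ctxOk

theorem HasCtx.wf {γ δ : Scope S} {Γ : Cx ς γ} {ts : Sp ς γ δ} {Δ : Ctx ς γ δ}
    (h : 𝕋.HasCtx Γ ts Δ) : 𝕋.WfCtx Γ := PrefixOk.wf h.ctxOk

theorem WfCtx.isType {γ δ : Scope S} {s : S} {Γ : Cx ς γ} {Δ : Ctx ς γ δ}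
    {T : Ty ς (γ ⧺ δ) s} (h : 𝕋.WfCtx (Γ.snoc Δ T)) : 𝕋.IsType (Γ.append Δ) T := by
  cases h with | extCtx h => exact h

theorem WfCtx.of_append {γ δ : Scope S} {Γ : Cx ς γ} {Δ : Ctx ς γ δ}
    (h : 𝕋.WfCtx (Γ.append Δ)) : 𝕋.WfCtx Γ :=
  PrefixOk.wf (PrefixOk.of_append h.ctxOk)

end Theory

/-! ### Typing of identity spines, of entries and of types -/

namespace Theory

open RewSys

variable {𝕋 : Theory ς}

theorem IsType.sub_lift {γ γ' δ : Scope S} {s : S} {Γ : Cx ς γ} {Γ' : Cx ς γ'} {σ : Sub ς γ γ'}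
    {Δ : Ctx ς γ δ} {T : Ty ς (γ ⧺ δ) s} (h : 𝕋.IsType (Γ.append Δ) T) (hσ : 𝕋.Mor Γ Γ' σ)
    (hΓ' : 𝕋.WfCtx Γ') : 𝕋.IsType (Γ'.append (Δ.sub σ)) (T.sub (σ.lift δ)) :=
  have hw := WfCtx.append_sub h.wf hσ hΓ'
  h.sub (hσ.lift hw) hw

theorem mor_succ {γ δ : Scope S} {s : S} (Γ : Cx ς γ) (Δ : Ctx ς γ δ) (T : Ty ς (γ ⧺ δ) s) :
    𝕋.Mor Γ (Γ.snoc Δ T) (Sub.ofRen ς (Ren.succ γ δ s)) := by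
  intro θ r x
  refine .inl ⟨.succ x, rfl, ?_, ?_⟩
  · rw [← Ex.rename_eq_sub]; rfl
  · rw [Sub.ofRen_lift, ← Ex.rename_eq_sub]; rfl

theorem mor_wkl {γ δ : Scope S} (Γ : Cx ς γ) (Δ : Ctx ς γ δ) :
    𝕋.Mor Γ (Γ.append Δ) (Sub.ofRen ς (Ren.wkl γ δ)) := (bMor_wkl (𝕋 := 𝕋) Γ Δ).mor

theorem mor_ofSp {γ δ : Scope S} {Γ : Cx ς γ} {ts : Sp ς γ δ} {Δ : Ctx ς γ δ}
    (h : 𝕋.HasCtx Γ ts Δ) : 𝕋.Mor (Γ.append Δ) Γ (Sub.ofSp ts) := (bMor_ofSp h).mor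

theorem mor_ofSp' {γ δ : Scope S} {Γ : Cx ς γ} {ts : Sp ς γ δ} {Δ : Cx ς δ}
    (h : 𝕋.HasCtx Γ ts (Δ.wk γ)) : 𝕋.Mor Δ Γ (Sub.ofSp' ts) := by
  intro θ s x
  have := h.get x
  rw [Cx.cdom_wk, Cx.ccod_wk, Ex.inst_eq_sub, Ex.instUnder_eq_sub, Ex.rename_sub,
    Ex.rename_sub, Sub.lift_thenSub_lift, Sub.wkr_thenSub_ofSp] at this
  exact .inr this

theorem WfCtx.cod {γ θ : Scope S} {s : S} {Γ : Cx ς γ} (h : 𝕋.WfCtx Γ) (x : Var γ θ s) :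
    𝕋.IsType (Γ.append (Γ.dom x)) (Γ.cod x) := by
  induction x with
  | zero =>
    cases Γ with | snoc Γ Δ T =>
    have := h.isType.sub_lift (mor_succ Γ Δ T) h
    rwa [Sub.ofRen_lift, ← Ex.rename_eq_sub, ← Ex.rename_eq_sub] at this
  | succ x ih =>
    cases Γ with | snoc Γ Δ T =>
    have := (ih (h.isType.wf.of_append)).sub_lift (mor_succ Γ Δ T) h
    rwa [Sub.ofRen_lift, ← Ex.rename_eq_sub, ← Ex.rename_eq_sub] at this

/-- A component of the identity spine is a variable applied to the identity spine of its own arity,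
which is of smaller rank. -/
theorem hasCtx_id_aux (N : ℕ) : ∀ {γ δ : Scope S} {Γ : Cx ς γ} {Δ : Ctx ς γ δ}, δ.rank ≤ N →
    𝕋.WfCtx (Γ.append Δ) →
    𝕋.HasCtx (Γ.append Δ) ((idSp ς δ).rename (Ren.wkr γ δ)) (Δ.rename (Ren.wkl γ δ)) := by
  induction N using Nat.strong_induction_on with
  | _ N IH =>
  intro γ δ Γ Δ hN h
  apply hasCtx_of_get h
  intro θ s x
  rw [Ex.cdom_rename, Ex.ccod_rename, Ex.inst_eq_sub, Ex.instUnder_eq_sub, Ex.rename_sub,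
    Ex.rename_sub, Sub.lift_thenSub_lift, Sub.wkl_lift_thenSub_ofSp_id, Sub.lift_id, Ex.sub_id,
    Ex.sub_id, ← Cx.dom_append_inr Γ Δ x, ← Cx.cod_append_inr Γ Δ x, Ex.get_rename, get_idSp,
    Var.eta_rename, Ren.wkr_apply]
  -- Only the entry of the variable in the ambient context matters from here on, so the split of
  -- this context is forgotten.
  generalize Γ.append Δ = Λ at h
  generalize (x.inr : Var (γ ⧺ δ) θ s) = y
  have hid := IH θ.rank (x.rank_lt.trans_le hN) le_rfl (h.cod y).wf
  rw [← Cx.dom_append_inl] at hid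
  have := Der.var _ hid
  rwa [Cx.cod_append_inl, Ex.inst_eq_sub, Ex.rename_sub, Sub.wkl_lift_thenSub_ofSp_id,
    Ex.sub_id] at this

theorem hasCtx_id {γ δ : Scope S} {Γ : Cx ς γ} {Δ : Ctx ς γ δ} (h : 𝕋.WfCtx (Γ.append Δ)) :
    𝕋.HasCtx (Γ.append Δ) ((idSp ς δ).rename (Ren.wkr γ δ)) (Δ.rename (Ren.wkl γ δ)) :=
  hasCtx_id_aux δ.rank le_rfl h

/-- The entries of the signature are well-typed. -/
def SigOk (𝕋 : Theory ς) : Prop :=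
  ∀ c, match 𝕋.sig.entry c with
    | .ty Δ _ => 𝕋.WfCtx Δ
    | .tm Δ _ T => 𝕋.IsType Δ T

theorem SigOk.ty (hsig : 𝕋.SigOk) {c : Fin n} {φ δ : Scope S} {Δ : Cx ς φ} {ν : Erasure φ δ}
    (h : 𝕋.sig.entry c = .ty Δ ν) : 𝕋.WfCtx Δ := by
  have := hsig c
  rwa [h] at this

theorem SigOk.tm (hsig : 𝕋.SigOk) {c : Fin n} {φ δ : Scope S} {s : S} {Δ : Cx ς φ}
    {ν : Erasure φ δ} {T : Ty ς φ s} (h : 𝕋.sig.entry c = .tm Δ ν T) : 𝕋.IsType Δ T := by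
  have := hsig c
  rwa [h] at this

theorem IsType.subst {γ δ : Scope S} {s : S} {Γ : Cx ς γ} {Δ : Cx ς δ} {ts : Sp ς γ δ}
    {T : Ty ς δ s} (h : 𝕋.IsType Δ T) (hts : 𝕋.HasCtx Γ ts (Δ.wk γ)) :
    𝕋.IsType Γ (T.subst ts) := by
  rw [Ex.subst_eq_sub]
  exact h.sub (mor_ofSp' hts) hts.wf

theorem IsType.inst {γ δ : Scope S} {s : S} {Γ : Cx ς γ} {Δ : Ctx ς γ δ} {ts : Sp ς γ δ}
    {T : Ty ς (γ ⧺ δ) s} (h : 𝕋.IsType (Γ.append Δ) T) (hts : 𝕋.HasCtx Γ ts Δ) :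
    𝕋.IsType Γ (T.inst ts) := by
  rw [Ex.inst_eq_sub]
  exact h.sub (mor_ofSp hts) hts.wf

theorem HasType.isType (hsig : 𝕋.SigOk) {γ : Scope S} {s : S} {Γ : Cx ς γ} {t : Tm ς γ s}
    {T : Ty ς γ s} (h : 𝕋.HasType Γ t T) : 𝕋.IsType Γ T := by
  cases h with
  | const hc hent _ hts => exact (hsig.tm hent).subst hts
  | var x hts => exact ((HasCtx.wf hts).cod x).inst hts
  | conv _ _ h => exact h

/-! ### Inversion of typing -/

theorem HasType.var_inv {γ δ : Scope S} {s : S} {Γ : Cx ς γ} {x : Var γ δ s} {ts : Sp ς γ δ}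
    {T : Ty ς γ s} (h : 𝕋.HasType Γ (.var x ts) T) :
    𝕋.HasCtx Γ ts (Γ.dom x) ∧ 𝕋.rew.Conv T ((Γ.cod x).inst ts) := by
  unfold HasType at h
  generalize hJ : Jdg.tm Γ (.var x ts) T = J at h
  induction h generalizing T with
  | var x h _ => cases hJ; exact ⟨h, .refl _⟩
  | conv hc _ _ ih _ =>
    cases hJ
    obtain ⟨h₁, h₂⟩ := ih rfl
    exact ⟨h₁, (Conv.symm hc).trans h₂⟩
  | _ => cases hJ

theorem HasType.con_inv {γ δ : Scope S} {s : S} {Γ : Cx ς γ} {c : Fin n}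
    {h : ς.arity c = .tm δ s} {ts : Sp ς γ δ} {T : Ty ς γ s}
    (ht : 𝕋.HasType Γ (.con c h ts) T) :
    ∃ (φ : Scope S) (Δ : Cx ς φ) (ν : Erasure φ δ) (U : Ty ς φ s) (us : Sp ς γ φ),
      𝕋.sig.entry c = .tm Δ ν U ∧ 𝕋.HasCtx Γ us (Δ.wk γ) ∧ ts = ν.act us ∧
        𝕋.rew.Conv T (U.subst us) := by
  unfold HasType at ht
  generalize hJ : Jdg.tm Γ (.con c h ts) T = J at ht
  induction ht generalizing T with
  | const hc hent _ hts => cases hJ; exact ⟨_, _, _, _, _, hent, hts, rfl, .refl _⟩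
  | conv hc _ _ ih _ =>
    cases hJ
    obtain ⟨φ, Δ, ν, U, us, h₁, h₂, h₃, h₄⟩ := ih rfl
    exact ⟨φ, Δ, ν, U, us, h₁, h₂, h₃, (Conv.symm hc).trans h₄⟩
  | _ => cases hJ

theorem IsType.tcon_inv {γ δ : Scope S} {s : S} {Γ : Cx ς γ} {c : Fin n}
    {h : ς.arity c = .ty δ} {hs : ς.era c = s} {ts : Sp ς γ δ}
    (ht : 𝕋.IsType Γ (.tcon c h hs ts)) :
    ∃ (φ : Scope S) (Δ : Cx ς φ) (ν : Erasure φ δ) (us : Sp ς γ φ),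
      𝕋.sig.entry c = .ty Δ ν ∧ 𝕋.HasCtx Γ us (Δ.wk γ) ∧ ts = ν.act us := by
  unfold IsType at ht
  generalize hJ : Jdg.ty Γ (.tcon c h hs ts) = J at ht
  cases ht with
  | type hc hent _ _ hts => cases hJ; exact ⟨_, _, _, _, hent, hts, rfl⟩
  | _ => cases hJ

end Theory

theorem Erasure.None.act_eq {φ δ : Scope S} {ν : Erasure φ δ} (h : ν.None) :
    ∃ h : φ = δ, ∀ {γ : Scope S} (ts : Sp ς γ φ), ν.act ts = h ▸ ts := by
  induction ν with
  | nil => exact ⟨rfl, fun ts => by cases ts; rfl⟩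
  | keep ν ih =>
    obtain ⟨rfl, h'⟩ := ih h
    refine ⟨rfl, fun ts => ?_⟩
    cases ts with | snoc ts t => simp only [Erasure.act, h']
  | erase ν ih => exact absurd h id

/-! ### Convertible contexts -/

/-- Two contexts whose entries are convertible in the scope of all of their variables. -/
inductive CtxEq (R : RewSys ς) : {γ δ : Scope S} → Ctx ς γ δ → Ctx ς γ δ → Prop
  | mk {γ δ : Scope S} {Δ Δ' : Ctx ς γ δ}
      (hd : ∀ ⦃θ : Scope S⦄ ⦃s : S⦄ (x : Var δ θ s), CtxEq R (Δ.cdom x) (Δ'.cdom x))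
      (hc : ∀ ⦃θ : Scope S⦄ ⦃s : S⦄ (x : Var δ θ s), R.Conv (Δ.ccod x) (Δ'.ccod x)) :
      CtxEq R Δ Δ'

namespace CtxEq

open RewSys

variable {R : RewSys ς}

theorem symm {γ δ : Scope S} {Δ Δ' : Ctx ς γ δ} (h : CtxEq R Δ Δ') : CtxEq R Δ' Δ := by
  induction h with
  | mk hd hc ih => exact .mk ih fun _ _ x => (hc x).symm

theorem sub {γ γ' δ : Scope S} {Δ Δ' : Ctx ς γ δ} (h : CtxEq R Δ Δ') (σ : Sub ς γ γ') :
    CtxEq R (Δ.sub σ) (Δ'.sub σ) := by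
  induction h generalizing γ' with
  | mk hd hc ih =>
    refine .mk (fun _ _ x => ?_) fun _ _ x => ?_
    · rw [Ex.cdom_sub, Ex.cdom_sub]; exact ih x _
    · rw [Ex.ccod_sub, Ex.ccod_sub]; exact (hc x).sub_left _

end CtxEq

namespace RewSys

variable {R : RewSys ς}

theorem conv_csnoc_inv {γ δ θ : Scope S} {s : S} {Γ Γ' : Ctx ς γ δ} {Δ Δ' : Ctx ς (γ ⧺ δ) θ}
    {T T' : Ty ς ((γ ⧺ δ) ⧺ θ) s} (h : R.Conv (Ex.csnoc Γ Δ T) (Ex.csnoc Γ' Δ' T')) :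
    R.Conv Γ Γ' ∧ R.Conv Δ Δ' ∧ R.Conv T T' := by
  let p₁ : Ctx ς γ (δ.snoc θ s) → Ctx ς γ δ := fun e => match e with | .csnoc Γ _ _ => Γ
  let p₂ : Ctx ς γ (δ.snoc θ s) → Ctx ς (γ ⧺ δ) θ := fun e => match e with | .csnoc _ Δ _ => Δ
  let p₃ : Ctx ς γ (δ.snoc θ s) → Ty ς ((γ ⧺ δ) ⧺ θ) s := fun e =>
    match e with | .csnoc _ _ T => T
  refine ⟨Conv.map p₁ ?_ h, Conv.map p₂ ?_ h, Conv.map p₃ ?_ h⟩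
  · intro a b h
    cases h with
    | csnoc₁ _ _ _ _ h => exact Red.conv h
    | csnoc₂ _ _ _ _ h => exact .refl _
    | csnoc₃ _ _ _ _ h => exact .refl _
  · intro a b h
    cases h with
    | csnoc₁ _ _ _ _ h => exact .refl _
    | csnoc₂ _ _ _ _ h => exact Red.conv h
    | csnoc₃ _ _ _ _ h => exact .refl _
  · intro a b h
    cases h with
    | csnoc₁ _ _ _ _ h => exact .refl _
    | csnoc₂ _ _ _ _ h => exact .refl _
    | csnoc₃ _ _ _ _ h => exact Red.conv h

theorem Conv.entry {γ δ θ : Scope S} {s : S} {Δ Δ' : Ctx ς γ δ} (h : R.Conv Δ Δ')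
    (x : Var δ θ s) : R.Conv (Δ.cdom x) (Δ'.cdom x) ∧ R.Conv (Δ.ccod x) (Δ'.ccod x) := by
  induction x with
  | zero =>
    cases Δ with | csnoc Δ Θ T =>
    cases Δ' with | csnoc Δ' Θ' T' =>
    obtain ⟨-, h₂, h₃⟩ := conv_csnoc_inv h
    exact ⟨h₂.rename _, h₃.rename _⟩
  | succ x ih =>
    cases Δ with | csnoc Δ Θ T =>
    cases Δ' with | csnoc Δ' Θ' T' =>
    obtain ⟨h₁, h₂⟩ := ih (conv_csnoc_inv h).1
    exact ⟨h₁.rename _, h₂.rename _⟩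

theorem Conv.ctxEq {γ δ : Scope S} {Δ Δ' : Ctx ς γ δ} (h : R.Conv Δ Δ') : CtxEq R Δ Δ' := by
  generalize hN : δ.rank = N
  induction N using Nat.strong_induction_on generalizing γ δ with
  | _ N IH =>
    subst hN
    exact .mk (fun _ _ x => IH _ x.rank_lt (h.entry x).1 rfl) fun _ _ x => (h.entry x).2

end RewSys

/-! ### Transport of typing along convertible contexts -/

namespace Theory

open RewSys

variable {𝕋 : Theory ς}

/-- Entries are compared only after renaming into one fixed context `M`, in which all variables are
available, so that no conversion ever has to be strengthened to a shorter scope. The context is then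
built up entry by entry, with `ρ` restricted to the prefix reached so far. -/
theorem mor_ofRen_aux {N : ℕ}
    (IH : ∀ M < N, ∀ {γ δ : Scope S} {Γ : Cx ς γ} {Δ Δ' : Ctx ς γ δ}, δ.rank = M →
      CtxEq 𝕋.rew Δ Δ' → 𝕋.WfCtx (Γ.append Δ) → 𝕋.WfCtx (Γ.append Δ') →
      𝕋.Mor (Γ.append Δ') (Γ.append Δ) (Sub.id ς (γ ⧺ δ)))
    {γ δ : Scope S} {Γ : Cx ς γ} {Δ Δ' : Ctx ς γ δ} (hN : δ.rank ≤ N)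
    (hw' : 𝕋.WfCtx (Γ.append Δ'))
    {μ : Scope S} {M : Cx ς μ} (hM : 𝕋.WfCtx M) (ρ : Ren (γ ⧺ δ) μ)
    (hρ : ∀ ⦃θ : Scope S⦄ ⦃s : S⦄ (x : Var (γ ⧺ δ) θ s),
      M.dom (ρ x) = ((Γ.append Δ).dom x).rename ρ ∧
        M.cod (ρ x) = ((Γ.append Δ).cod x).rename (ρ.lift θ))
    (hd : ∀ ⦃θ : Scope S⦄ ⦃s : S⦄ (x : Var δ θ s),
      CtxEq 𝕋.rew ((Δ.cdom x).rename ρ) ((Δ'.cdom x).rename ρ))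
    (hc : ∀ ⦃θ : Scope S⦄ ⦃s : S⦄ (x : Var δ θ s),
      𝕋.rew.Conv ((Δ.ccod x).rename (ρ.lift θ)) ((Δ'.ccod x).rename (ρ.lift θ))) :
    𝕋.Mor (Γ.append Δ') M (Sub.ofRen ς ρ) := by
  induction δ with
  | nil =>
    cases Δ; cases Δ'
    intro θ s x
    refine .inl ⟨ρ x, rfl, ?_, ?_⟩
    · rw [← Ex.rename_eq_sub]; exact (hρ x).1
    · rw [Sub.ofRen_lift, ← Ex.rename_eq_sub]; exact (hρ x).2
  | snoc δ θ s ih =>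
    cases Δ with | csnoc Δ Θ T =>
    cases Δ' with | csnoc Δ' Θ' T' =>
    have hT' : 𝕋.IsType ((Γ.append Δ').append Θ') T' := WfCtx.isType hw'
    have hr : ∀ {k : Kind S} (e : Ex ς (γ ⧺ δ) k),
        (e.rename (Ren.wks γ δ θ s)).rename ρ = e.rename ((Ren.wks γ δ θ s).comp ρ) :=
      fun e => Ex.rename_rename _ _ _
    have hr' : ∀ {k : Kind S} {β : Scope S} (e : Ex ς ((γ ⧺ δ) ⧺ β) k),
        (e.rename ((Ren.wks γ δ θ s).lift β)).rename (ρ.lift β) =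
          e.rename (((Ren.wks γ δ θ s).comp ρ).lift β) := fun e => by
      rw [Ex.rename_rename, Ren.lift_comp]
    have hpre := ih (Δ := Δ) (Δ' := Δ') ((le_max_left _ _).trans hN) hT'.wf.of_append
      ((Ren.wks γ δ θ s).comp ρ)
      (fun β r x => ⟨(hρ (.succ x)).1.trans (hr _), (hρ (.succ x)).2.trans (hr' _)⟩)
      (fun β r x => by
        have := hd (.succ x)
        simp only [Ex.cdom] at this
        rwa [hr, hr] at this)
      (fun β r x => by
        have := hc (.succ x)
        simp only [Ex.ccod] at this
        rwa [hr', hr'] at this)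
    intro β r x
    cases x with
    | succ x =>
      rcases hpre x with ⟨y, h₁, h₂, h₃⟩ | h
      · refine .inl ⟨y, h₁, h₂.trans ?_, h₃.trans ?_⟩
        · rw [← Ex.rename_eq_sub, ← Ex.rename_eq_sub]; exact (hr _).symm
        · rw [Sub.ofRen_lift, Sub.ofRen_lift, ← Ex.rename_eq_sub, ← Ex.rename_eq_sub]
          exact (hr' _).symm
      · right
        unfold MorTm at h ⊢
        rw [Sub.ofRen_lift, ← Ex.rename_eq_sub, ← Ex.rename_eq_sub] at h ⊢
        have e₁ := hr ((Γ.append Δ').dom x)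
        have e₂ := hr' ((Γ.append Δ').cod x)
        rw [← e₁, ← e₂] at h
        exact h
    | zero =>
      right
      have hw₁ := WfCtx.append_sub hT'.wf hpre hM
      have ht₁ := hT'.sub_lift hpre hM
      rw [Sub.ofRen_lift, ← Ex.rename_eq_sub, ← Ex.rename_eq_sub] at ht₁
      rw [← Ex.rename_eq_sub] at hw₁
      have hz := hρ (Var.zero : Var (γ ⧺ δ.snoc θ s) θ s)
      have hz₁ : M.dom (ρ (.zero : Var (γ ⧺ δ.snoc θ s) θ s)) =
        Θ.rename ((Ren.wks γ δ θ s).comp ρ) := hz.1.trans (hr _)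
      have hz₂ : M.cod (ρ (.zero : Var (γ ⧺ δ.snoc θ s) θ s)) =
        T.rename (((Ren.wks γ δ θ s).comp ρ).lift θ) := hz.2.trans (hr' _)
      have hd₀ := hd (.zero : Var (δ.snoc θ s) θ s)
      have hc₀ := hc (.zero : Var (δ.snoc θ s) θ s)
      simp only [Ex.cdom, Ex.ccod] at hd₀ hc₀
      rw [hr, hr] at hd₀
      rw [hr', hr'] at hc₀
      have hw₂ := (hM.cod (ρ (.zero : Var (γ ⧺ δ.snoc θ s) θ s))).wf
      -- In `M` the last variable has the entry with context `Θ` and type `T`, but is wanted with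
      -- `Θ'` and `T'`. By the hypothesis at the smaller rank, the identity spine over `Θ'` is also
      -- typed by `Θ`; the variable can be applied to it, and the resulting type `T` converted to
      -- `T'`.
      have hmor := IH θ.rank ((lt_of_lt_of_le (Nat.lt_succ_self _) (le_max_right _ _)).trans_le hN)
        (Γ := M) rfl hd₀.symm hw₁ (hz₁ ▸ hw₂)
      have hid := (hasCtx_id (hz₁ ▸ hw₂)).sub hmor hw₁
      rw [Ex.sub_id, Ex.sub_id, ← hz₁, ← Cx.dom_append_inl] at hid
      have hv := Der.var _ hid
      rw [Cx.cod_append_inl, Ex.inst_eq_sub, Ex.rename_sub, Sub.wkl_lift_thenSub_ofSp_id,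
        Ex.sub_id, hz₂] at hv
      have hres := Der.conv hc₀ hv ht₁
      unfold MorTm
      rw [Sub.ofRen_lift, ← Ex.rename_eq_sub, ← Ex.rename_eq_sub]
      have e₁ := hr Θ'
      have e₂ := hr' T'
      rw [← e₁, ← e₂] at hres
      exact hres

theorem mor_id_of_ctxEq {γ δ : Scope S} {Γ : Cx ς γ} {Δ Δ' : Ctx ς γ δ}
    (h : CtxEq 𝕋.rew Δ Δ') (hw : 𝕋.WfCtx (Γ.append Δ)) (hw' : 𝕋.WfCtx (Γ.append Δ')) :
    𝕋.Mor (Γ.append Δ') (Γ.append Δ) (Sub.id ς (γ ⧺ δ)) := by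
  generalize hN : δ.rank = N
  induction N using Nat.strong_induction_on generalizing γ δ with
  | _ N IH =>
    cases h with | mk hd hc =>
    refine mor_ofRen_aux (fun M hM _ _ _ _ _ hδ h hw hw' => IH M hM h hw hw' hδ) hN.le hw' hw
      (Δ := Δ) (Ren.id _) (fun θ s x => ⟨?_, ?_⟩) (fun θ s x => ?_) fun θ s x => ?_
    · rw [Ex.rename_id]; rfl
    · rw [Ren.lift_id, Ex.rename_id]; rfl
    · rw [Ex.rename_id, Ex.rename_id]; exact hd x
    · rw [Ren.lift_id, Ex.rename_id, Ex.rename_id]; exact hc x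

theorem HasType.ctx_conv {γ δ : Scope S} {s : S} {Γ : Cx ς γ} {Δ Δ' : Ctx ς γ δ}
    {t : Tm ς (γ ⧺ δ) s} {T : Ty ς (γ ⧺ δ) s} (ht : 𝕋.HasType (Γ.append Δ) t T)
    (h : CtxEq 𝕋.rew Δ Δ') (hw' : 𝕋.WfCtx (Γ.append Δ')) : 𝕋.HasType (Γ.append Δ') t T := by
  have := ht.sub (mor_id_of_ctxEq h.symm hw' ht.wf) hw'
  rwa [Ex.sub_id, Ex.sub_id] at this

/-- The identity spine of `Δ'` is transported to `Γ.Δ` and then instantiated at `ts`, which gives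
back `ts`. -/
theorem HasCtx.conv {γ δ : Scope S} {Γ : Cx ς γ} {Δ Δ' : Ctx ς γ δ} {ts : Sp ς γ δ}
    (hts : 𝕋.HasCtx Γ ts Δ) (h : CtxEq 𝕋.rew Δ Δ') (hw : 𝕋.WfCtx (Γ.append Δ))
    (hw' : 𝕋.WfCtx (Γ.append Δ')) : 𝕋.HasCtx Γ ts Δ' := by
  have := ((hasCtx_id hw').sub (mor_id_of_ctxEq h hw hw') hw).sub (mor_ofSp hts) hts.wf
  rwa [Ex.sub_id, Ex.sub_id, Ex.rename_sub, Ex.rename_sub, Sub.wkl_thenSub_ofSp, Ex.sub_id,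
    Sub.wkr_thenSub_ofSp, idSp_sub] at this

/-- If a list of variables is typed by a context, its entries are those of the variables. -/
theorem HasCtx.entries_of_id {γ δ : Scope S} {Γ : Cx ς γ} {ρ : Ren δ γ} {Δ : Ctx ς γ δ}
    (h : 𝕋.HasCtx Γ ((idSp ς δ).rename ρ) Δ) {θ : Scope S} {s : S} (x : Var δ θ s) :
    CtxEq 𝕋.rew (Γ.dom (ρ x)) ((Δ.cdom x).inst ((idSp ς δ).rename ρ)) ∧
      𝕋.rew.Conv (Γ.cod (ρ x)) ((Δ.ccod x).instUnder θ ((idSp ς δ).rename ρ)) := by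
  generalize hN : δ.rank = N
  induction N using Nat.strong_induction_on generalizing γ δ θ s with
  | _ N IH =>
    subst hN
    have hx := h.get x
    rw [Ex.get_rename, get_idSp, Var.eta_rename] at hx
    obtain ⟨h₁, h₂⟩ := hx.var_inv
    refine ⟨CtxEq.symm (.mk (fun β r y => ?_) fun β r y => ?_), ?_⟩
    · have := (IH _ x.rank_lt h₁ y rfl).1
      rwa [Ren.wkr_apply, Cx.dom_append_inr, Cx.dom_append_inl, Ex.cdom_rename,
        Ex.inst_eq_sub _ ((idSp ς θ).rename _), Ex.rename_sub, Sub.wkl_lift_thenSub_ofSp_id,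
        Ex.sub_id] at this
    · have := (IH _ x.rank_lt h₁ y rfl).2
      rwa [Ren.wkr_apply, Cx.cod_append_inr, Cx.dom_append_inl, Ex.ccod_rename,
        Ex.instUnder_eq_sub _ _ ((idSp ς θ).rename _), Ex.rename_sub, Sub.lift_thenSub_lift,
        Sub.wkl_lift_thenSub_ofSp_id, Sub.lift_id, Ex.sub_id] at this
    · rw [Cx.cod_append_inl, Ex.inst_eq_sub _ ((idSp ς θ).rename _), Ex.rename_sub,
        Sub.wkl_lift_thenSub_ofSp_id, Ex.sub_id] at h₂
      exact h₂.symm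

/-- A spine that is convertible to a typed one, and the arguments of which are typed by the
entries of the context at the latter, is typed. -/
theorem hasCtx_of_conv {γ δ : Scope S} {Γ : Cx ς γ} {Δ : Ctx ς γ δ} {v w : Sp ς γ δ}
    (hw : 𝕋.HasCtx Γ w Δ) (hΔ : 𝕋.WfCtx (Γ.append Δ)) (hvw : 𝕋.rew.Conv v w)
    (hv : ∀ ⦃θ s⦄ (x : Var δ θ s),
      𝕋.HasType (Γ.append ((Δ.cdom x).inst w)) (v.get x) ((Δ.ccod x).instUnder θ w)) :
    𝕋.HasCtx Γ v Δ := by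
  induction δ with
  | nil => cases v; cases w; exact hw
  | snoc δ θ s ih =>
    cases v with | snoc v t =>
    cases w with | snoc w u =>
    cases Δ with | csnoc Δ Θ T =>
    cases hw with | extSp _ _ hw hu =>
    have hT : 𝕋.IsType ((Γ.append Δ).append Θ) T := WfCtx.isType hΔ
    obtain ⟨hvw, -⟩ := conv_snoc_iff.1 hvw
    have hts := ih hw hT.wf.of_append hvw fun θ s x => by
      simpa only [Ex.cdom, Ex.ccod, Ex.get, Ex.inst_eq_sub, Ex.instUnder_eq_sub, Ex.rename_sub,
        Sub.lift_thenSub_lift, Sub.wks_thenSub_ofSp] using hv x.succ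
    refine .extSp (Ex.over_univ _) (Ex.over_univ _) hts ?_
    -- The hypothesis types the last argument over `w`, while the rule wants it over `v`. The prefix
    -- of `v` is already typed, so context and type can be converted from one to the other.
    have ht := hv .zero
    simp only [Ex.cdom, Ex.ccod, Ex.get, Ex.inst_eq_sub, Ex.instUnder_eq_sub, Ex.rename_sub,
      Sub.lift_thenSub_lift, Sub.wks_thenSub_ofSp] at ht
    rw [Ex.inst_eq_sub, Ex.instUnder_eq_sub]
    have hs := SubConv.ofSp hvw.symm
    have hT' := hT.sub_lift (mor_ofSp hts) hts.wf
    exact .conv (Conv.sub_right T (hs.lift θ)) (ht.ctx_conv (Conv.sub_right Θ hs).ctxEq hT'.wf) hT'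

end Theory

/-! ### Reassociation and substitution -/

namespace Sub

variable {γ γ' : Scope S}

theorem assocL_thenSub_lift_lift (σ : Sub ς γ γ') (δ θ : Scope S) :
    (Ren.assocL γ δ θ).thenSub ((σ.lift δ).lift θ) =
      (σ.lift (δ ⧺ θ)).thenRen (Ren.assocL γ' δ θ) := by
  apply ext_append
  · intro β s y
    simp only [Ren.thenSub_apply, thenRen_apply, Ren.assocL_inl, lift_inl, Ex.rename_rename,
      Ren.lift_comp]
    congr 2
    funext α r z
    simp
  · intro β s y
    rcases y.inl_or_inr θ with ⟨y, rfl⟩ | ⟨z, rfl⟩ <;> simp [Var.eta_rename]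

theorem assocR_thenSub_lift (σ : Sub ς γ γ') (δ θ : Scope S) :
    (Ren.assocR γ δ θ).thenSub (σ.lift (δ ⧺ θ)) =
      ((σ.lift δ).lift θ).thenRen (Ren.assocR γ' δ θ) := by
  apply ext_append₂
  · intro β s y
    simp only [Ren.thenSub_apply, thenRen_apply, Ren.assocR_inl_inl, lift_inl, Ex.rename_rename,
      Ren.lift_comp]
    congr 2
    funext α r z
    simp
  · intro β s y; simp [Var.eta_rename]
  · intro β s y; simp [Var.eta_rename]

end Sub

theorem Ex.rename_assocL_sub_rename_assocR {γ γ' δ θ : Scope S} {k : Kind S}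
    (e : Ex ς (γ ⧺ (δ ⧺ θ)) k) (σ : Sub ς γ γ') :
    ((e.rename (Ren.assocL γ δ θ)).sub ((σ.lift δ).lift θ)).rename (Ren.assocR γ' δ θ) =
      e.sub (σ.lift (δ ⧺ θ)) := by
  rw [Ex.rename_sub, Sub.assocL_thenSub_lift_lift, ← Ex.sub_rename, Ex.rename_rename,
    Ren.assocL_comp_assocR, Ex.rename_id]

theorem Ex.rename_assocL_rename_assocR {γ γ' δ θ : Scope S} {k : Kind S}
    (e : Ex ς (γ ⧺ (δ ⧺ θ)) k) (ρ : Ren γ γ') :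
    ((e.rename (Ren.assocL γ δ θ)).rename ((ρ.lift δ).lift θ)).rename (Ren.assocR γ' δ θ) =
      e.rename (ρ.lift (δ ⧺ θ)) := by
  rw [Ex.rename_eq_sub ((ρ.lift δ).lift θ), ← Sub.ofRen_lift, ← Sub.ofRen_lift,
    Ex.rename_assocL_sub_rename_assocR, Sub.ofRen_lift, ← Ex.rename_eq_sub]

/-! ### Strong normalisation, conversion and reduction of spines -/

namespace RewSys

open Relation

variable {R : RewSys ς}

theorem SN.act {γ φ δ : Scope S} (ν : Erasure φ δ) {ts : Sp ς γ φ} (h : R.SN ts) :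
    R.SN (ν.act ts) := by
  induction ν with
  | nil => cases ts; exact h
  | keep ν ih =>
    cases ts with | snoc ts t =>
    obtain ⟨h₁, h₂⟩ := sn_snoc_iff.1 h
    exact sn_snoc_iff.2 ⟨ih h₁, h₂⟩
  | erase ν ih => cases ts with | snoc ts t => exact ih (sn_snoc_iff.1 h).1

theorem conv_spAppend {γ δ θ : Scope S} {ts ts' : Sp ς γ δ} {us us' : Sp ς γ θ}
    (h : R.Conv ts ts') (h' : R.Conv us us') : R.Conv (ts.spAppend us) (ts'.spAppend us') := by
  apply conv_sp_of_get
  intro β s x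
  rcases x.inl_or_inr θ with ⟨y, rfl⟩ | ⟨z, rfl⟩
  · rw [Ex.get_spAppend_inl, Ex.get_spAppend_inl]; exact h.get y
  · rw [Ex.get_spAppend_inr, Ex.get_spAppend_inr]; exact h'.get z

theorem reds_snoc_inv {γ δ θ : Scope S} {s : S} {ts us : Sp ς γ δ} {t u : Tm ς (γ ⧺ θ) s}
    (h : ReflTransGen R.Red (Ex.snoc ts t) (Ex.snoc us u)) :
    ReflTransGen R.Red ts us ∧ ReflTransGen R.Red t u := by
  generalize he : Ex.snoc us u = e at h
  induction h generalizing us u with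
  | refl => cases he; exact ⟨.refl, .refl⟩
  | @tail b _ _ hr ih =>
    subst he
    cases b with | snoc ts' t' =>
    obtain ⟨h₁, h₂⟩ := ih rfl
    cases hr with
    | snocL _ _ hr => exact ⟨h₁.tail hr, h₂⟩
    | snocR _ _ hr => exact ⟨h₁, h₂.tail hr⟩

theorem reds_get {γ δ θ : Scope S} {s : S} {ts us : Sp ς γ δ} (h : ReflTransGen R.Red ts us)
    (x : Var δ θ s) : ReflTransGen R.Red (ts.get x) (us.get x) := by
  induction x with
  | zero =>
    cases ts with | snoc ts t =>
    cases us with | snoc us u => exact (reds_snoc_inv h).2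
  | succ x ih =>
    cases ts with | snoc ts t =>
    cases us with | snoc us u => exact ih (reds_snoc_inv h).1

end RewSys

namespace Theory

open Relation RewSys

variable {𝕋 : Theory ς}

theorem HasCtx.sn (hsn : 𝕋.StronglyNormalising) {γ δ : Scope S} {Γ : Cx ς γ} {ts : Sp ς γ δ}
    {Δ : Ctx ς γ δ} (h : 𝕋.HasCtx Γ ts Δ) : 𝕋.rew.SN ts := by
  induction δ with
  | nil => cases ts; exact sn_nil
  | snoc δ θ s ih =>
    cases h with | extSp _ _ h₁ h₂ => exact sn_snoc_iff.2 ⟨ih h₁, hsn _ _ _ h₂⟩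

/-- The head of a type is inert and its arguments are well-typed terms, so the assumption on terms
suffices. -/
theorem IsType.sn (hsn : 𝕋.StronglyNormalising) {γ : Scope S} {s : S} {Γ : Cx ς γ} {T : Ty ς γ s}
    (h : 𝕋.IsType Γ T) : 𝕋.rew.SN T := by
  cases T with | tcon c hc hs ts =>
  obtain ⟨φ, Δ, ν, us, -, hus, rfl⟩ := h.tcon_inv
  exact sn_tcon_iff.2 ((hus.sn hsn).act ν)

theorem SubjectReduction.reds (hsr : 𝕋.SubjectReduction) {γ : Scope S} {s : S} {Γ : Cx ς γ}
    {t t' : Tm ς γ s} {T : Ty ς γ s} (h : 𝕋.HasType Γ t T)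
    (hr : ReflTransGen 𝕋.rew.Red t t') : 𝕋.HasType Γ t' T := by
  induction hr with
  | refl => exact h
  | tail _ hr ih => exact hsr _ _ _ _ ih hr

end Theory

/-! ### Matching up to conversion -/

namespace Pat

theorem toEx_snoc_sub {γ₁ γ₁₂ γ₂ γ₀ γₓ γf δ : Scope S} {s : S} (ts : Pat ς (γ₁ ⧺ γ₁₂) γ₀ (.sp δ))
    (t : Pat ς (γ₁₂ ⧺ γ₂) (γ₀ ⧺ γₓ) (.tm s)) (σ : Sub ς ((γ₁ ⧺ γ₁₂) ⧺ γ₂) γf) :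
    ((Pat.snoc ts t).toEx).sub (σ.lift γ₀) =
      Ex.snoc (ts.toEx.sub (((Ren.wkl (γ₁ ⧺ γ₁₂) γ₂).thenSub σ).lift γ₀))
        (((t.toEx.rename (((Ren.wkr γ₁ γ₁₂).lift γ₂).lift (γ₀ ⧺ γₓ))).rename
          (Ren.assocL ((γ₁ ⧺ γ₁₂) ⧺ γ₂) γ₀ γₓ)).sub ((σ.lift γ₀).lift γₓ)) := by
  rw [Pat.toEx, Ex.sub, Ex.rename_sub, Sub.lift_thenSub_lift]

theorem conv_snoc_inv {R : RewSys ς} {γ₁ γ₁₂ γ₂ γ₀ γₓ γf δ : Scope S} {s : S}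
    {ts : Pat ς (γ₁ ⧺ γ₁₂) γ₀ (.sp δ)}
    {t : Pat ς (γ₁₂ ⧺ γ₂) (γ₀ ⧺ γₓ) (.tm s)} {us : Sp ς (γf ⧺ γ₀) δ}
    {u : Tm ς ((γf ⧺ γ₀) ⧺ γₓ) s} {σ : Sub ς ((γ₁ ⧺ γ₁₂) ⧺ γ₂) γf}
    (h : R.Conv (Ex.snoc us u) ((Pat.snoc ts t).toEx.sub (σ.lift γ₀))) :
    R.Conv us (ts.toEx.sub (((Ren.wkl (γ₁ ⧺ γ₁₂) γ₂).thenSub σ).lift γ₀)) ∧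
      R.Conv (u.rename (Ren.assocR γf γ₀ γₓ))
        (t.toEx.sub ((((Ren.wkr γ₁ γ₁₂).lift γ₂).thenSub σ).lift (γ₀ ⧺ γₓ))) := by
  rw [toEx_snoc_sub] at h
  obtain ⟨h₁, h₂⟩ := RewSys.conv_snoc_iff.1 h
  refine ⟨h₁, ?_⟩
  have := h₂.rename (Ren.assocR γf γ₀ γₓ)
  rwa [Ex.rename_assocL_sub_rename_assocR, Ex.rename_sub, Sub.lift_thenSub_lift] at this

end Pat

namespace Theory

open Relation RewSys

variable {𝕋 : Theory ς} {𝔖 : 𝕋.Strategy}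

theorem subConv_shared {R : RewSys ς} {γ₁ γ₁₂ γ₂ γf : Scope S} {v₁ : Sp ς γf γ₁}
    {w₁ w₂ w : Sp ς γf γ₁₂} {v₂ : Sp ς γf γ₂} {σ : Sub ς ((γ₁ ⧺ γ₁₂) ⧺ γ₂) γf}
    (h₁ : R.SubConv (Sub.ofSp' (v₁.spAppend w₁)) ((Ren.wkl (γ₁ ⧺ γ₁₂) γ₂).thenSub σ))
    (h₂ : R.SubConv (Sub.ofSp' (w₂.spAppend v₂)) (((Ren.wkr γ₁ γ₁₂).lift γ₂).thenSub σ))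
    (hw : R.Conv w₁ w) : R.SubConv (Sub.ofSp' ((v₁.spAppend w).spAppend v₂)) σ := by
  intro β s x
  rcases x.inl_or_inr γ₂ with ⟨y, rfl⟩ | ⟨z, rfl⟩
  · have h := h₁ y
    rcases y.inl_or_inr γ₁₂ with ⟨y, rfl⟩ | ⟨y, rfl⟩
    · simpa [Ex.get_spAppend_inl] using h
    · simp only [Sub.ofSp'_apply, Ex.get_spAppend_inl, Ex.get_spAppend_inr] at h ⊢
      exact (hw.get y).symm.trans h
  · have h := h₂ z.inr
    simpa [Ex.get_spAppend_inr] using h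

/-- Both values of the shared variables are convertible to the corresponding part of `σ`. -/
theorem conv_shared {R : RewSys ς} {γ₁ γ₁₂ γ₂ γf : Scope S} {v₁ : Sp ς γf γ₁}
    {w₁ w₂ : Sp ς γf γ₁₂} {v₂ : Sp ς γf γ₂} {σ : Sub ς ((γ₁ ⧺ γ₁₂) ⧺ γ₂) γf}
    (h₁ : R.SubConv (Sub.ofSp' (v₁.spAppend w₁)) ((Ren.wkl (γ₁ ⧺ γ₁₂) γ₂).thenSub σ))
    (h₂ : R.SubConv (Sub.ofSp' (w₂.spAppend v₂)) (((Ren.wkr γ₁ γ₁₂).lift γ₂).thenSub σ)) :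
    R.Conv w₁ w₂ := by
  apply conv_sp_of_get
  intro β s x
  have h₁ := h₁ x.inr
  have h₂ := h₂ (x.inl γ₂)
  simp only [Sub.ofSp'_apply, Ex.get_spAppend_inl, Ex.get_spAppend_inr, Ren.thenSub_apply,
    Ren.lift_inl, Ren.wkl_apply, Ren.wkr_apply] at h₁ h₂
  exact h₁.trans h₂.symm

/-- The substitution found by matching is convertible to any substitution that makes the pattern
convertible to the expression. -/
theorem Match.conv (hconf : 𝕋.Confluent) {γ γ₀ γf : Scope S} {k : Kind S} {p : Pat ς γ γ₀ k}
    {u : Ex ς (γf ⧺ γ₀) k} {v : Sp ς γf γ} (hm : Match 𝔖 p u v) (hp : p.Rigid 𝕋)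
    (hu : 𝕋.rew.SN u) {σ : Sub ς γ γf} (h : 𝕋.rew.Conv u (p.toEx.sub (σ.lift γ₀))) :
    𝕋.rew.SubConv (Sub.ofSp' v) σ := by
  induction hm with
  | rigid hr _ ih =>
    have hs := hu.reds (Strategy.Reds.reds hr)
    exact ih hp.2.2 hs.of_con
      (hconf.con_inj hp.1 hs ((reds_conv (Strategy.Reds.reds hr)).symm.trans h))
  | @flex γ₀ γf s u =>
    intro β s x
    cases x with
    | succ x => cases x
    | zero =>
      have he : (Pat.flex (ς := ς) (γ₀ := γ₀) (s := s)).toEx =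
        (Var.zero : Var (Scope.nil.snoc γ₀ s) γ₀ s).eta ς := rfl
      rw [he, Var.eta_sub] at h
      exact h
  | nil => intro β s x; cases x
  | snoc _ _ hw₁ hw₂ ih₁ ih₂ =>
    obtain ⟨h₁, h₂⟩ := Pat.conv_snoc_inv h
    obtain ⟨hs₁, hs₂⟩ := sn_snoc_iff.1 hu
    exact subConv_shared (ih₁ hp.1 hs₁ h₁)
      (ih₂ hp.2 (hs₂.rename_of_inverse (Ren.assocR_comp_assocL _ _ _)) h₂) hw₁.conv
  | type _ ih =>
    obtain ⟨us, he, h⟩ := conv_tcon_inv h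
    cases he
    exact ih hp.2.2 (sn_tcon_iff.1 hu) h

/-- The arguments found are subterms of reducts, or further reducts of these. This provides normal
forms for the shared variables before anything is known about their typing. -/
theorem Match.sn {γ γ₀ γf : Scope S} {k : Kind S} {p : Pat ς γ γ₀ k}
    {u : Ex ς (γf ⧺ γ₀) k} {v : Sp ς γf γ} (hm : Match 𝔖 p u v)
    (hu : 𝕋.rew.SN u) : 𝕋.rew.SN v := by
  induction hm with
  | rigid hr _ ih => exact ih (hu.reds (Strategy.Reds.reds hr)).of_con
  | flex u => exact sn_snoc_iff.2 ⟨sn_nil, hu⟩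
  | nil => exact sn_nil
  | snoc _ _ hw₁ hw₂ ih₁ ih₂ =>
    obtain ⟨hs₁, hs₂⟩ := sn_snoc_iff.1 hu
    have h₁ := sn_spAppend_iff.1 (ih₁ hs₁)
    have h₂ := sn_spAppend_iff.1 (ih₂ (hs₂.rename_of_inverse (Ren.assocR_comp_assocL _ _ _)))
    exact sn_spAppend_iff.2 ⟨sn_spAppend_iff.2 ⟨h₁.1, h₁.2.reds hw₁.reds⟩, h₂.2⟩
  | type _ ih => exact ih (sn_tcon_iff.1 hu)

/-- Matching succeeds on expressions that are convertible to an instance of a rigid pattern. -/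
theorem exists_match (hconf : 𝕋.Confluent) (𝔖 : 𝕋.Strategy) {γ γ₀ γf : Scope S} {k : Kind S}
    (p : Pat ς γ γ₀ k) (hp : p.Rigid 𝕋) {u : Ex ς (γf ⧺ γ₀) k} (hu : 𝕋.rew.SN u)
    {σ : Sub ς γ γf} (h : 𝕋.rew.Conv u (p.toEx.sub (σ.lift γ₀))) :
    ∃ v : Sp ς γf γ, Match 𝔖 p u v := by
  induction p with
  | rigid c hc ts ih =>
    obtain ⟨us, hr⟩ := hconf.nf_con 𝔖 hp.1 hu h
    have hs := hu.reds (Strategy.Reds.reds hr)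
    obtain ⟨v, hv⟩ := ih hp.2.2 hs.of_con
      (hconf.con_inj hp.1 hs ((reds_conv (Strategy.Reds.reds hr)).symm.trans h))
    exact ⟨v, .rigid hr hv⟩
  | flex => exact ⟨_, .flex u⟩
  | nil => cases u; exact ⟨_, .nil⟩
  | snoc ts t ih₁ ih₂ =>
    cases u with | snoc us u =>
    obtain ⟨h₁, h₂⟩ := Pat.conv_snoc_inv h
    obtain ⟨hs₁, hs₂⟩ := sn_snoc_iff.1 hu
    have hs₂ := hs₂.rename_of_inverse (Ren.assocR_comp_assocL _ _ _)
    obtain ⟨v, hv⟩ := ih₁ hp.1 hs₁ h₁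
    obtain ⟨v', hv'⟩ := ih₂ hp.2 hs₂ h₂
    obtain ⟨v₁, w₁, rfl⟩ := Ex.exists_spAppend v
    obtain ⟨w₂, v₂, rfl⟩ := Ex.exists_spAppend v'
    -- The equality test of the algorithm cannot fail: both normal forms exist, and the two values
    -- are convertible through `σ`.
    obtain ⟨w, hw⟩ := 𝔖.exists_nf (sn_spAppend_iff.1 (Match.sn hv hs₁)).2
    obtain ⟨w', hw'⟩ := 𝔖.exists_nf (sn_spAppend_iff.1 (Match.sn hv' hs₂)).1
    obtain rfl := Strategy.nf_eq_sp hconf hw hw'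
      (conv_shared (Match.conv hconf hv hp.1 hs₁ h₁) (Match.conv hconf hv' hp.2 hs₂ h₂))
    exact ⟨_, .snoc hv hv' hw hw'⟩
  | type c hc hs ts ih =>
    obtain ⟨us, rfl, hus⟩ := conv_tcon_inv h.symm
    obtain ⟨v, hv⟩ := ih hp.2.2 (sn_tcon_iff.1 hu) hus.symm
    exact ⟨v, .type hv⟩

end Theory

/-! ### Concatenation of contexts over a context -/

/-- The context `Θ.X` over `γ`. -/
def Ex.capp {γ δ : Scope S} (Θ : Ctx ς γ δ) : {ξ : Scope S} → Ctx ς (γ ⧺ δ) ξ → Ctx ς γ (δ ⧺ ξ)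
  | _, .cnil => Θ
  | _, .csnoc (δ := ξ) (θ := θ) X D T =>
    .csnoc (Ex.capp Θ X) (D.rename (Ren.assocR γ δ ξ)) (T.rename ((Ren.assocR γ δ ξ).lift θ))

theorem Ex.capp_sub {γ γ' δ ξ : Scope S} (Θ : Ctx ς γ δ) (X : Ctx ς (γ ⧺ δ) ξ)
    (σ : Sub ς γ γ') : (Θ.capp X).sub σ = (Θ.sub σ).capp (X.sub (σ.lift δ)) := by
  induction ξ with
  | nil => cases X; rfl
  | snoc ξ θ s ih =>
    cases X with | csnoc X D T =>
    have h₁ : (D.rename (Ren.assocR γ δ ξ)).sub (σ.lift (δ ⧺ ξ)) =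
        (D.sub ((σ.lift δ).lift ξ)).rename (Ren.assocR γ' δ ξ) := by
      rw [Ex.rename_sub, Sub.assocR_thenSub_lift, Ex.sub_rename]
    have h₂ : (T.rename ((Ren.assocR γ δ ξ).lift θ)).sub ((σ.lift (δ ⧺ ξ)).lift θ) =
        (T.sub (((σ.lift δ).lift ξ).lift θ)).rename ((Ren.assocR γ' δ ξ).lift θ) := by
      rw [Ex.rename_sub, Sub.lift_thenSub_lift, Sub.assocR_thenSub_lift, Ex.sub_rename,
        Sub.lift_thenRen_lift]
    change Ex.csnoc ((Θ.capp X).sub σ) _ _ = Ex.csnoc _ _ _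
    rw [ih]
    exact congrArg₂ (Ex.csnoc _) h₁ h₂

theorem Cx.dom_append_capp {γ δ ξ θ : Scope S} {s : S} (Γ : Cx ς γ) (Θ : Ctx ς γ δ)
    (X : Ctx ς (γ ⧺ δ) ξ) (x : Var ((γ ⧺ δ) ⧺ ξ) θ s) :
    (Γ.append (Θ.capp X)).dom (Ren.assocR γ δ ξ x) =
      (((Γ.append Θ).append X).dom x).rename (Ren.assocR γ δ ξ) := by
  induction ξ with
  | nil => cases X; exact (Ex.rename_id _).symm
  | snoc ξ β r ih =>
    cases X with | csnoc X D T =>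
    have h : ∀ {k : Kind S} (e : Ex ς ((γ ⧺ δ) ⧺ ξ) k),
        (e.rename (Ren.assocR γ δ ξ)).rename (Ren.wks γ (δ ⧺ ξ) β r) =
          (e.rename (Ren.wks (γ ⧺ δ) ξ β r)).rename (Ren.assocR γ δ (ξ.snoc β r)) := by
      intro k e
      rw [Ex.rename_rename]
      exact (Ex.rename_rename (Ren.wks (γ ⧺ δ) ξ β r) (Ren.assocR γ δ (ξ.snoc β r)) e).symm
    cases x with
    | zero => exact h D
    | succ x => exact (congrArg (Ex.rename (Ren.wks _ _ _ _)) (ih X x)).trans (h _)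

theorem Cx.cod_append_capp {γ δ ξ θ : Scope S} {s : S} (Γ : Cx ς γ) (Θ : Ctx ς γ δ)
    (X : Ctx ς (γ ⧺ δ) ξ) (x : Var ((γ ⧺ δ) ⧺ ξ) θ s) :
    (Γ.append (Θ.capp X)).cod (Ren.assocR γ δ ξ x) =
      (((Γ.append Θ).append X).cod x).rename ((Ren.assocR γ δ ξ).lift θ) := by
  induction ξ with
  | nil =>
    cases X
    have h : (Ren.assocR γ δ .nil).lift θ = Ren.id _ := Ren.lift_id θ
    exact ((congrArg (fun ρ => Ex.rename ρ _) h).trans (Ex.rename_id _)).symm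
  | snoc ξ β r ih =>
    cases X with | csnoc X D T =>
    have h : ∀ {k : Kind S} (θ : Scope S) (e : Ex ς (((γ ⧺ δ) ⧺ ξ) ⧺ θ) k),
        (e.rename ((Ren.assocR γ δ ξ).lift θ)).rename ((Ren.wks γ (δ ⧺ ξ) β r).lift θ) =
          (e.rename ((Ren.wks (γ ⧺ δ) ξ β r).lift θ)).rename
            ((Ren.assocR γ δ (ξ.snoc β r)).lift θ) := by
      intro k θ e
      have h := Ren.lift_comp (Ren.wks (γ ⧺ δ) ξ β r) (Ren.assocR γ δ (ξ.snoc β r)) θ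
      rw [Ex.rename_rename, Ren.lift_comp]
      exact ((Ex.rename_rename _ _ e).trans (congrArg (fun ρ => Ex.rename ρ e) h)).symm
    cases x with
    | zero => exact h _ T
    | succ x => exact (congrArg (Ex.rename ((Ren.wks _ _ _ _).lift _)) (ih X x)).trans (h _ _)

namespace Theory

open Relation RewSys

variable {𝕋 : Theory ς}

theorem mor_assocR {γ δ ξ : Scope S} (Γ : Cx ς γ) (Θ : Ctx ς γ δ) (X : Ctx ς (γ ⧺ δ) ξ) :
    𝕋.Mor ((Γ.append Θ).append X) (Γ.append (Θ.capp X)) (Sub.ofRen ς (Ren.assocR γ δ ξ)) := by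
  intro θ s x
  refine .inl ⟨_, rfl, ?_, ?_⟩
  · rw [← Ex.rename_eq_sub, Cx.dom_append_capp]
  · rw [Sub.ofRen_lift, ← Ex.rename_eq_sub, Cx.cod_append_capp]

theorem WfCtx.capp {γ δ ξ : Scope S} {Γ : Cx ς γ} {Θ : Ctx ς γ δ} {X : Ctx ς (γ ⧺ δ) ξ}
    (h : 𝕋.WfCtx ((Γ.append Θ).append X)) : 𝕋.WfCtx (Γ.append (Θ.capp X)) := by
  induction ξ with
  | nil => cases X; exact h
  | snoc ξ θ s ih =>
    cases X with | csnoc X D T =>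
    have hT : 𝕋.IsType (((Γ.append Θ).append X).append D) T := WfCtx.isType h
    have := hT.sub_lift (mor_assocR Γ Θ X) (ih hT.wf.of_append)
    rw [Sub.ofRen_lift, ← Ex.rename_eq_sub, ← Ex.rename_eq_sub] at this
    exact .extCtx this

theorem HasType.assocR {γ δ ξ : Scope S} {s : S} {Γ : Cx ς γ} {Θ : Ctx ς γ δ}
    {X : Ctx ς (γ ⧺ δ) ξ} {t : Tm ς ((γ ⧺ δ) ⧺ ξ) s} {T : Ty ς ((γ ⧺ δ) ⧺ ξ) s}
    (h : 𝕋.HasType ((Γ.append Θ).append X) t T) :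
    𝕋.HasType (Γ.append (Θ.capp X)) (t.rename (Ren.assocR γ δ ξ))
      (T.rename (Ren.assocR γ δ ξ)) := by
  rw [Ex.rename_eq_sub, Ex.rename_eq_sub]
  exact h.sub (mor_assocR Γ Θ X) (WfCtx.capp h.wf)

theorem mor_wkr {γ δ : Scope S} (Γ : Cx ς γ) (Δ : Cx ς δ) :
    𝕋.Mor Δ (Γ.append (Δ.wk γ)) (Sub.ofRen ς (Ren.wkr γ δ)) := by
  intro θ s x
  refine .inl ⟨x.inr, rfl, ?_, ?_⟩
  · rw [Cx.dom_append_inr, Cx.cdom_wk, Ex.rename_eq_sub]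
  · rw [Cx.cod_append_inr, Cx.ccod_wk, Ex.rename_eq_sub, Sub.ofRen_lift]

theorem WfCtx.append_wk {γ δ : Scope S} {Γ : Cx ς γ} {Δ : Cx ς δ} (hΓ : 𝕋.WfCtx Γ)
    (hΔ : 𝕋.WfCtx Δ) : 𝕋.WfCtx (Γ.append (Δ.wk γ)) := by
  induction Δ with
  | nil => exact hΓ
  | snoc Δ Θ T ih =>
    have hT := hΔ.isType
    have := hT.sub_lift (mor_wkr Γ Δ) (ih hT.wf.of_append)
    rw [Sub.ofRen_lift, ← Ex.rename_eq_sub, ← Ex.rename_eq_sub] at this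
    exact .extCtx this

/-! ### Typing of the substitution found by matching -/

/-- The typing of a variable applied to the variables of a context determines this context. -/
theorem HasType.eta_inv {θ δ : Scope S} {s : S} {Θ : Cx ς θ} {Δ : Ctx ς θ δ} {x : Var θ δ s}
    {A : Ty ς (θ ⧺ δ) s} (h : 𝕋.HasType (Θ.append Δ) (x.eta ς) A) :
    CtxEq 𝕋.rew Δ (Θ.dom x) ∧ 𝕋.rew.Conv A (Θ.cod x) := by
  obtain ⟨h₁, h₂⟩ := HasType.var_inv h
  constructor
  · refine .mk (fun β r y => ?_) fun β r y => ?_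
    · have := (h₁.entries_of_id y).1
      rwa [Ren.wkr_apply, Cx.dom_append_inr, Cx.dom_append_inl, Ex.cdom_rename,
        Ex.inst_eq_sub _ ((idSp ς δ).rename _), Ex.rename_sub, Sub.wkl_lift_thenSub_ofSp_id,
        Ex.sub_id] at this
    · have := (h₁.entries_of_id y).2
      rwa [Ren.wkr_apply, Cx.cod_append_inr, Cx.dom_append_inl, Ex.ccod_rename,
        Ex.instUnder_eq_sub _ _ ((idSp ς δ).rename _), Ex.rename_sub, Sub.lift_thenSub_lift,
        Sub.wkl_lift_thenSub_ofSp_id, Sub.lift_id, Ex.sub_id] at this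
  · rwa [Cx.cod_append_inl, Ex.inst_eq_sub _ ((idSp ς δ).rename _), Ex.rename_sub,
      Sub.wkl_lift_thenSub_ofSp_id, Ex.sub_id] at h₂

/-- `e` and `u` have the same type, or context, up to the substitution `τ`. -/
def SameTyping (𝕋 : Theory ς) {θ γ : Scope S} (Θ : Cx ς θ) (Γ : Cx ς γ) (τ : Sub ς θ γ) :
    {k : Kind S} → Ex ς θ k → Ex ς γ k → Prop
  | .tm s, e, u => ∃ A : Ty ς θ s, 𝕋.HasType Θ e A ∧ 𝕋.HasType Γ u (A.sub τ)
  | .sp δ, e, u => ∃ Ξ : Ctx ς θ δ,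
    𝕋.WfCtx (Θ.append Ξ) ∧ 𝕋.HasCtx Θ e Ξ ∧ 𝕋.HasCtx Γ u (Ξ.sub τ)
  | .ty _, e, u => 𝕋.IsType Θ e ∧ 𝕋.IsType Γ u
  | .ctx _, _, _ => False

/-- Without erased arguments the visible spine is the whole spine. The context `Δ` of a constant is
closed, so that its weakenings on the two sides correspond under any `τ`. -/
theorem SameTyping.of_act {θ γ φ δ : Scope S} {Θ : Cx ς θ} {Γ : Cx ς γ} {τ : Sub ς θ γ}
    {Δ : Cx ς φ} (hΔ : 𝕋.WfCtx Δ) {ν : Erasure φ δ} (hν : ν.None) {es : Sp ς θ φ} {us : Sp ς γ φ}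
    (hes : 𝕋.HasCtx Θ es (Δ.wk θ)) (hus : 𝕋.HasCtx Γ us (Δ.wk γ)) :
    𝕋.SameTyping Θ Γ τ (ν.act es) (ν.act us) := by
  obtain ⟨rfl, h⟩ := Erasure.None.act_eq hν
  rw [h, h]
  refine ⟨Δ.wk θ, WfCtx.append_wk hes.wf hΔ, hes, ?_⟩
  rw [Cx.wk_sub]
  exact hus

/-- The common type is not used: inversion types both argument spines by the context of the same
constant. -/
theorem SameTyping.con {θ γ δ : Scope S} {s : S} {Θ : Cx ς θ} {Γ : Cx ς γ} {τ : Sub ς θ γ}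
    (hsig : 𝕋.SigOk) {c : Fin n} (hc : (𝕋.sig.entry c).NoErased) {h : ς.arity c = .tm δ s}
    {es : Sp ς θ δ} {us : Sp ς γ δ}
    (ht : 𝕋.SameTyping (k := .tm s) Θ Γ τ (Ex.con c h es) (Ex.con c h us)) :
    𝕋.SameTyping (k := .sp δ) Θ Γ τ es us := by
  obtain ⟨A, h₁, h₂⟩ := ht
  obtain ⟨φ, Δ, ν, U, es, hent, hes, rfl, -⟩ := h₁.con_inv
  obtain ⟨φ', Δ', ν', U', us, hent', hus, rfl, -⟩ := h₂.con_inv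
  rw [hent] at hent' hc
  cases hent'
  exact .of_act (hsig.tm hent).wf hc hes hus

theorem SameTyping.tcon {θ γ δ : Scope S} {s : S} {Θ : Cx ς θ} {Γ : Cx ς γ} {τ : Sub ς θ γ}
    (hsig : 𝕋.SigOk) {c : Fin n} (hc : (𝕋.sig.entry c).NoErased) {h : ς.arity c = .ty δ}
    {hs : ς.era c = s} {es : Sp ς θ δ} {us : Sp ς γ δ}
    (ht : 𝕋.SameTyping (k := .ty s) Θ Γ τ (Ex.tcon c h hs es) (Ex.tcon c h hs us)) :
    𝕋.SameTyping (k := .sp δ) Θ Γ τ es us := by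
  obtain ⟨h₁, h₂⟩ := ht
  obtain ⟨φ, Δ, ν, es, hent, hes, rfl⟩ := h₁.tcon_inv
  obtain ⟨φ', Δ', ν', us, hent', hus, rfl⟩ := h₂.tcon_inv
  rw [hent] at hent' hc
  cases hent'
  exact .of_act (hsig.ty hent) hc hes hus

/-- The last arguments are typed over `es` and over `us` respectively; the conversion `hus` lets `u`
be retyped over the substituted `es`. Reassociation then moves the variables bound in the last
argument into the rigid context, which the subpattern expects. -/
theorem SameTyping.snoc {θ γ γ₀ γₓ δ : Scope S} {s : S} {Θ : Cx ς θ} {Θ₀ : Ctx ς θ γ₀}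
    {Γ : Cx ς γ} {ω : Sub ς θ γ} (hsig : 𝕋.SigOk) (hω : 𝕋.Mor Θ Γ ω) (hΓ : 𝕋.WfCtx Γ)
    {es : Sp ς (θ ⧺ γ₀) δ} {e : Tm ς ((θ ⧺ γ₀) ⧺ γₓ) s} {us : Sp ς (γ ⧺ γ₀) δ}
    {u : Tm ς ((γ ⧺ γ₀) ⧺ γₓ) s} (hus : 𝕋.rew.Conv us (es.sub (ω.lift γ₀)))
    (ht : 𝕋.SameTyping (k := .sp (δ.snoc γₓ s)) (Θ.append Θ₀) (Γ.append (Θ₀.sub ω)) (ω.lift γ₀)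
      (Ex.snoc es e) (Ex.snoc us u)) :
    𝕋.SameTyping (k := .sp δ) (Θ.append Θ₀) (Γ.append (Θ₀.sub ω)) (ω.lift γ₀) es us ∧
      ∃ Θ₁ : Ctx ς θ (γ₀ ⧺ γₓ), 𝕋.SameTyping (k := .tm s) (Θ.append Θ₁) (Γ.append (Θ₁.sub ω))
        (ω.lift (γ₀ ⧺ γₓ)) (e.rename (Ren.assocR θ γ₀ γₓ)) (u.rename (Ren.assocR γ γ₀ γₓ)) := by
  obtain ⟨Ξ, hw, h₁, h₂⟩ := ht
  cases Ξ with | csnoc Ξ X A =>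
  have hA : 𝕋.IsType (((Θ.append Θ₀).append Ξ).append X) A := WfCtx.isType hw
  cases h₁ with | extSp _ _ hes he =>
  cases h₂ with | extSp _ _ hus' hu =>
  have hwΘ := HasCtx.wf hes
  have hwΓ := WfCtx.append_sub hwΘ hω hΓ
  have hτ := hω.lift hwΓ
  refine ⟨⟨Ξ, hA.wf.of_append, hes, hus'⟩, Θ₀.capp (X.inst es), _, HasType.assocR he, ?_⟩
  have hty := (HasType.isType hsig he).sub_lift hτ hwΓ
  rw [Ex.inst_sub, Ex.instUnder_sub] at hty
  have hs := SubConv.ofSp hus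
  have hu' := HasType.ctx_conv hu (Δ' := (X.sub ((ω.lift γ₀).lift δ)).inst (es.sub (ω.lift γ₀)))
    (by rw [Ex.inst_eq_sub, Ex.inst_eq_sub]; exact (Conv.sub_right _ hs).ctxEq) hty.wf
  have hu'' := Der.conv (by
    rw [Ex.instUnder_eq_sub, Ex.instUnder_eq_sub]; exact Conv.sub_right _ (hs.lift _)) hu' hty
  rw [← Ex.inst_sub, ← Ex.instUnder_sub] at hu''
  have := HasType.assocR hu''
  rw [← Ex.capp_sub] at this
  rwa [Ex.rename_sub, Sub.assocR_thenSub_lift, ← Ex.sub_rename]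

end Theory

namespace Theory

open Relation RewSys

variable {𝕋 : Theory ς} {𝔖 : 𝕋.Strategy}

/-- The arguments found by matching are typed by the entries of the flexible variables. -/
theorem Match.hasType (hconf : 𝕋.Confluent) (hsn : 𝕋.StronglyNormalising)
    (hsr : 𝕋.SubjectReduction) (hsig : 𝕋.SigOk) {γ γ₀ γf θ : Scope S} {k : Kind S}
    {p : Pat ς γ γ₀ k} {u : Ex ς (γf ⧺ γ₀) k} {v : Sp ς γf γ} (hm : Match 𝔖 p u v)
    (hp : p.Rigid 𝕋) {Θ : Cx ς θ} {Θ₀ : Ctx ς θ γ₀} {Γ : Cx ς γf} {ω : Sub ς θ γf}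
    (hω : 𝕋.Mor Θ Γ ω) (hΓ : 𝕋.WfCtx Γ) (ρ : Ren γ θ)
    (h : 𝕋.rew.Conv u (p.toEx.sub ((ρ.thenSub ω).lift γ₀)))
    (ht : 𝕋.SameTyping (Θ.append Θ₀) (Γ.append (Θ₀.sub ω)) (ω.lift γ₀)
      (p.toEx.rename (ρ.lift γ₀)) u)
    {δ : Scope S} {s : S} (x : Var γ δ s) :
    𝕋.HasType (Γ.append ((Θ.dom (ρ x)).sub ω)) (v.get x) ((Θ.cod (ρ x)).sub (ω.lift δ)) := by
  induction hm generalizing θ δ s with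
  | rigid hr _ ih =>
    obtain ⟨A, h₁, h₂⟩ := ht
    have hr := Strategy.Reds.reds hr
    -- The matched arguments occur in a reduct of `u`, so subject reduction has to come before
    -- inversion.
    have h₂ := hsr.reds h₂ hr
    exact ih hp.2.2 hω hΓ ρ
      (hconf.con_inj hp.1 (hsn _ _ _ h₂) ((reds_conv hr).symm.trans h))
      (SameTyping.con hsig hp.2.1 ⟨A, h₁, h₂⟩) x
  | @flex γ₀ γf s u =>
    obtain ⟨A, h₁, h₂⟩ := ht
    cases x with
    | succ x => cases x
    | zero =>
      have he : (Pat.flex (ς := ς) (γ₀ := γ₀) (s := s)).toEx =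
        (Var.zero : Var (Scope.nil.snoc γ₀ s) γ₀ s).eta ς := rfl
      rw [he, Var.eta_rename] at h₁
      -- On the pattern side, the typing of the variable applied to its bound variables identifies
      -- the rigid context and the type with the entry of that variable; applying `ω` then retypes
      -- `u` accordingly.
      obtain ⟨hd, hc⟩ := h₁.eta_inv
      have hty := (h₁.wf.of_append.cod (ρ (.zero : Var (Scope.nil.snoc γ₀ s) γ₀ s))).sub_lift hω hΓ
      exact .conv (hc.sub_left _) (HasType.ctx_conv h₂ (hd.sub ω) hty.wf) hty
  | nil => cases x
  | @snoc γ₁ γ₁₂ γ₂ γ₀ γₓ γf δ' s' ts t us u v₁ w₁ w₂ w v₂ _ _ hw₁ hw₂ ih₁ ih₂ =>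
    obtain ⟨h₁, h₂⟩ := Pat.conv_snoc_inv h
    have he₁ : (ts.toEx.rename ((Ren.wkl (γ₁ ⧺ γ₁₂) γ₂).lift γ₀)).rename (ρ.lift γ₀) =
        ts.toEx.rename (((Ren.wkl (γ₁ ⧺ γ₁₂) γ₂).comp ρ).lift γ₀) := by
      rw [Ex.rename_rename, Ren.lift_comp]
    have he₂ : (((t.toEx.rename (((Ren.wkr γ₁ γ₁₂).lift γ₂).lift (γ₀ ⧺ γₓ))).rename
        (Ren.assocL ((γ₁ ⧺ γ₁₂) ⧺ γ₂) γ₀ γₓ)).rename ((ρ.lift γ₀).lift γₓ)).rename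
          (Ren.assocR θ γ₀ γₓ) =
        t.toEx.rename ((((Ren.wkr γ₁ γ₁₂).lift γ₂).comp ρ).lift (γ₀ ⧺ γₓ)) := by
      rw [Ex.rename_assocL_rename_assocR, Ex.rename_rename, Ren.lift_comp]
    obtain ⟨ht₁, Θ₁, ht₂⟩ := SameTyping.snoc hsig hω hΓ
      (by rwa [he₁, Ex.rename_sub, Sub.lift_thenSub_lift]) ht
    rw [he₁] at ht₁
    rw [he₂] at ht₂
    -- The role of `ρ`: the flexible variables of each subpattern are read in the same `Θ`, so the
    -- context need not be split along the pattern.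
    have k₁ := @ih₁ _ hp.1 _ _ _ _ hω hΓ ((Ren.wkl (γ₁ ⧺ γ₁₂) γ₂).comp ρ) h₁ ht₁
    have k₂ := @ih₂ _ hp.2 _ _ _ _ hω hΓ (((Ren.wkr γ₁ γ₁₂).lift γ₂).comp ρ) h₂ ht₂
    rcases x.inl_or_inr γ₂ with ⟨y, rfl⟩ | ⟨z, rfl⟩
    · have k := k₁ y
      rw [Ex.get_spAppend_inl]
      rcases y.inl_or_inr γ₁₂ with ⟨y, rfl⟩ | ⟨y, rfl⟩
      · rw [Ex.get_spAppend_inl] at k ⊢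
        exact k
      · rw [Ex.get_spAppend_inr] at k ⊢
        -- The value kept for a shared variable is a reduct of the one found in the first
        -- subpattern.
        exact hsr.reds k (reds_get hw₁.reds y)
    · have k := k₂ z.inr
      rw [Ren.comp_apply, Ren.lift_inr, Ex.get_spAppend_inr] at k
      rwa [Ex.get_spAppend_inr]
  | type _ ih =>
    obtain ⟨us, he, h⟩ := conv_tcon_inv h
    cases he
    exact ih hp.2.2 hω hΓ ρ h (SameTyping.tcon hsig hp.2.1 ht) x

end Theory

/-! ### Restricted theories -/

namespace RewSys

variable {R : RewSys ς} {P : Set (Fin n)}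

theorem Step.red {γ : Scope S} {k : Kind S} {e e' : Ex ς γ k} (h : R.Step P e e') :
    R.Red e e' := by
  induction h with
  | root hR _ _ v _ => exact .root hR (Ex.over_univ _) (Ex.over_univ _) v (Ex.over_univ _)
  | var x _ ih => exact .var x ih
  | con c h _ _ ih => exact .con c h trivial ih
  | snocL t _ _ ih => exact .snocL t (Ex.over_univ _) ih
  | snocR ts _ _ ih => exact .snocR ts (Ex.over_univ _) ih
  | tcon c h hs _ _ ih => exact .tcon c h hs trivial ih
  | csnoc₁ Δ T _ _ _ ih => exact .csnoc₁ Δ T (Ex.over_univ _) (Ex.over_univ _) ih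
  | csnoc₂ Γ T _ _ _ ih => exact .csnoc₂ Γ T (Ex.over_univ _) (Ex.over_univ _) ih
  | csnoc₃ Γ Δ _ _ _ ih => exact .csnoc₃ Γ Δ (Ex.over_univ _) (Ex.over_univ _) ih

theorem ConvIn.conv {γ : Scope S} {k : Kind S} {e e' : Ex ς γ k} (h : R.ConvIn P e e') :
    R.Conv e e' := by
  induction h with
  | rel _ _ h => exact Red.conv h.red
  | refl => exact .refl _
  | symm _ _ _ ih => exact ih.symm
  | trans _ _ _ _ _ ih₁ ih₂ => exact ih₁.trans ih₂

end RewSys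

/-- Entries of a moded theory are well-typed in the part that precedes them; everything else takes
place in the whole theory. -/
theorem Theory.Der.univ {𝕋 : Theory ς} {P : Set (Fin n)} {J : Jdg ς} (h : 𝕋.Der P J) :
    𝕋.Der Set.univ J := by
  induction h with
  | emptyCtx => exact .emptyCtx
  | extCtx _ ih => exact .extCtx ih
  | type _ hent h hs _ ih => exact .type (Set.mem_univ _) hent h hs ih
  | const _ hent h _ ih => exact .const (Set.mem_univ _) hent h ih
  | var x _ ih => exact .var x ih
  | conv hc _ _ ih₁ ih₂ => exact .conv hc.conv ih₁ ih₂
  | emptySp _ ih => exact .emptySp ih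
  | extSp _ _ _ _ ih₁ ih₂ => exact .extSp (Ex.over_univ _) (Ex.over_univ _) ih₁ ih₂

/-! ### The action of the erasure assignments of moded entries -/

namespace Erasure

theorem keepAll_act {γ φ : Scope S} (ts : Sp ς γ φ) : (keepAll φ).act ts = ts := by
  induction φ with
  | nil => cases ts; rfl
  | snoc φ θ s ih => cases ts with | snoc ts t => exact congrArg (Ex.snoc · t) (ih ts)

theorem eraseKeep_act {γ φ θ : Scope S} (ts : Sp ς γ φ) (us : Sp ς γ θ) :
    (eraseKeep φ θ).act (ts.spAppend us) = us := by
  induction θ with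
  | nil =>
    cases us
    -- Whatever it is, the result is a spine for the empty scope, and there is only one.
    generalize (eraseKeep φ .nil).act (ts.spAppend .nil) = vs
    cases vs; rfl
  | snoc θ _ _ ih => cases us with | snoc us u => exact congrArg (Ex.snoc · u) (ih us)

theorem keepMore_act {γ φ δ θ : Scope S} (ν : Erasure φ δ) (ts : Sp ς γ φ) (us : Sp ς γ θ) :
    (ν.keepMore θ).act (ts.spAppend us) = (ν.act ts).spAppend us := by
  induction θ with
  | nil => cases us; rfl
  | snoc θ _ _ ih => cases us with | snoc us u => exact congrArg (Ex.snoc · u) (ih us)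

theorem eraseMore_act {γ φ δ θ : Scope S} (ν : Erasure φ δ) (ts : Sp ς γ φ) (us : Sp ς γ θ) :
    (ν.eraseMore θ).act (ts.spAppend us) = ν.act ts := by
  induction θ with
  | nil => cases us; rfl
  | snoc θ _ _ ih => cases us with | snoc us u => exact ih us

end Erasure

/-! ### Typing of concatenated spines -/

theorem Sub.ofSp'_lift_comp_ofSp {γ δ θ : Scope S} (ts : Sp ς γ δ) (us : Sp ς γ θ) :
    ((Sub.ofSp' ts).lift θ).comp (Sub.ofSp us) = Sub.ofSp' (ts.spAppend us) := by
  rw [Sub.ofSp'_spAppend]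
  apply Sub.ext_append
  · intro β s y
    rw [Sub.comp_apply, Sub.lift_inl, Ex.rename_sub, Sub.lift_thenSub_lift,
      Sub.wkl_thenSub_ofSp, Sub.lift_id, Ex.sub_id, Sub.append_inl]
  · intro β s z
    simp

theorem Sub.wkl_thenSub_ofSp' {γ δ θ : Scope S} (ts : Sp ς γ δ) (us : Sp ς γ θ) :
    (Ren.wkl δ θ).thenSub (Sub.ofSp' (ts.spAppend us)) = Sub.ofSp' ts := by
  funext β s x; simp [Ex.get_spAppend_inl]

theorem Sub.wkr_thenSub_ofSp' {γ δ θ : Scope S} (ts : Sp ς γ δ) (us : Sp ς γ θ) :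
    (Ren.wkr δ θ).thenSub (Sub.ofSp' (ts.spAppend us)) = Sub.ofSp' us := by
  funext β s x; simp [Ex.get_spAppend_inr]

theorem Sub.lift_nil {γ γ' : Scope S} (σ : Sub ς γ γ') : σ.lift .nil = σ := by
  funext β s x
  have h : (Ren.wkl γ' .nil).lift β = Ren.id _ := Ren.lift_id β
  exact (Sub.lift_inl σ x).trans
    ((congrArg (fun ρ => Ex.rename ρ (σ x)) h).trans (Ex.rename_id _))

namespace Theory

open Relation RewSys

variable {𝕋 : Theory ς}

theorem hasCtx_snoc_wk_iff {γ δ θ : Scope S} {s : S} {Γ : Cx ς γ} {Δ : Cx ς δ} {X : Ctx ς δ θ}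
    {A : Ty ς (δ ⧺ θ) s} {ts : Sp ς γ δ} {t : Tm ς (γ ⧺ θ) s} :
    𝕋.HasCtx Γ (Ex.snoc ts t) ((Cx.snoc Δ X A).wk γ) ↔ 𝕋.HasCtx Γ ts (Δ.wk γ) ∧
      𝕋.HasType (Γ.append (X.subst ts)) t (A.sub ((Sub.ofSp' ts).lift θ)) := by
  have h₁ : (X.rename (Ren.wkr γ δ)).inst ts = X.subst ts := rfl
  have h₂ : (A.rename ((Ren.wkr γ δ).lift θ)).instUnder θ ts =
      A.sub ((Sub.ofSp' ts).lift θ) := by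
    rw [Ex.instUnder_eq_sub, Ex.rename_sub, Sub.lift_thenSub_lift, Sub.wkr_thenSub_ofSp]
  constructor
  · intro h
    cases h with | extSp _ _ hts ht =>
    rw [h₁, h₂] at ht
    exact ⟨hts, ht⟩
  · rintro ⟨hts, ht⟩
    rw [← h₁, ← h₂] at ht
    exact .extSp (Ex.over_univ _) (Ex.over_univ _) hts ht

theorem hasCtx_append_wk_iff {γ δ θ : Scope S} {Γ : Cx ς γ} {Δ : Cx ς δ} {Θ : Ctx ς δ θ}
    {ts : Sp ς γ δ} {us : Sp ς γ θ} :
    𝕋.HasCtx Γ (ts.spAppend us) ((Δ.append Θ).wk γ) ↔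
      𝕋.HasCtx Γ ts (Δ.wk γ) ∧ 𝕋.HasCtx Γ us (Θ.subst ts) := by
  induction θ with
  | nil =>
    cases us; cases Θ
    exact ⟨fun h => ⟨h, .emptySp (HasCtx.wf h)⟩, And.left⟩
  | snoc θ β s ih =>
    cases us with | snoc us u =>
    cases Θ with | csnoc Θ X A =>
    have h : 𝕋.HasCtx Γ (Ex.snoc (ts.spAppend us) u) ((Cx.snoc (Δ.append Θ) X A).wk γ) ↔ _ :=
      hasCtx_snoc_wk_iff
    refine h.trans ?_
    rw [ih, Ex.subst_eq_sub Θ, Ex.subst_eq_sub X, Ex.subst_eq_sub (Ex.csnoc Θ X A), and_assoc]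
    refine and_congr_right fun _ => ?_
    have h₁ : (X.sub ((Sub.ofSp' ts).lift θ)).inst us =
        X.sub (Sub.ofSp' (ts.spAppend us)) := by
      rw [Ex.inst_eq_sub, Ex.sub_sub, Sub.ofSp'_lift_comp_ofSp]
    have h₂ : (A.sub (((Sub.ofSp' ts).lift θ).lift β)).instUnder β us =
        A.sub ((Sub.ofSp' (ts.spAppend us)).lift β) := by
      rw [Ex.instUnder_eq_sub, Ex.sub_sub, Sub.lift_comp, Sub.ofSp'_lift_comp_ofSp]
    constructor
    · rintro ⟨hus, hu⟩
      rw [← h₁, ← h₂] at hu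
      exact .extSp (Ex.over_univ _) (Ex.over_univ _) hus hu
    · intro hu
      cases hu with | extSp _ _ hus hu =>
      rw [h₁, h₂] at hu
      exact ⟨hus, hu⟩

end Theory

/-! ### Well-typed moded theories -/

namespace ModedTheory

open Relation RewSys Theory

variable {𝕄 : ModedTheory ς}

theorem WellTyped.entry (hwt : 𝕄.WellTyped) {c : Fin n} {E : MEntry ς}
    (h : 𝕄.msig.entry c = E) : 𝕄.WellTypedEntry c E := h ▸ hwt c

theorem WellTyped.sigOk (hwt : 𝕄.WellTyped) : 𝕄.toTheory.SigOk := by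
  intro c
  have h := hwt c
  have he : 𝕄.toTheory.sig.entry c = (𝕄.msig.entry c).toEntry := rfl
  rw [he]
  cases hE : 𝕄.msig.entry c with
  | ty Δ => rw [hE] at h; exact h.univ
  | pos Δ T => rw [hE] at h; exact h.univ
  | neg Δ' Δ T =>
    rw [hE] at h
    -- The pattern is typed over `Δ'` only, while the underlying entry weakens it by `Δ`.
    have := IsType.sub h.2.1.univ (mor_wkl _ Δ) h.1.univ
    exact (congrArg (IsType _ (Δ'.append Δ)) (Ex.rename_eq_sub (Ren.wkl _ _) T.toEx)).mpr this
  | inf Δ₁ Δ' Γₓ T Δ₂ U => rw [hE] at h; exact h.1.univ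

theorem entry_toTheory {c : Fin n} {E : MEntry ς} (h : 𝕄.msig.entry c = E) :
    𝕄.toTheory.sig.entry c = E.toEntry := congrArg MEntry.toEntry h

theorem pos_inv {γ δ : Scope S} {s : S} {Γ : Cx ς γ} {c : Fin n} {Δ : Cx ς δ} {T : Ty ς δ s}
    (hent : 𝕄.msig.entry c = .pos Δ T) {h : ς.arity c = .tm δ s} {ts : Sp ς γ δ} {U : Ty ς γ s}
    (ht : 𝕄.toTheory.HasType Γ (.con c h ts) U) :
    𝕄.toTheory.HasCtx Γ ts (Δ.wk γ) ∧ 𝕄.rew.Conv U (T.subst ts) := by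
  obtain ⟨φ, Δ', ν, U', us, hent', hus, rfl, hc⟩ := ht.con_inv
  rw [entry_toTheory hent] at hent'
  cases hent'
  rw [Erasure.keepAll_act]
  exact ⟨hus, hc⟩

theorem ty_inv {γ δ : Scope S} {s : S} {Γ : Cx ς γ} {c : Fin n} {Δ : Cx ς δ}
    (hent : 𝕄.msig.entry c = .ty Δ) {h : ς.arity c = .ty δ} {hs : ς.era c = s} {ts : Sp ς γ δ}
    (ht : 𝕄.toTheory.IsType Γ (.tcon c h hs ts)) : 𝕄.toTheory.HasCtx Γ ts (Δ.wk γ) := by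
  obtain ⟨φ, Δ', ν, us, hent', hus, rfl⟩ := ht.tcon_inv
  rw [entry_toTheory hent] at hent'
  cases hent'
  rw [Erasure.keepAll_act]
  exact hus

/-- The erased arguments are absent from the term but present in its derivation. The `w` obtained
here is a reference solution for matching, and need not be the one that the algorithm finds. -/
theorem neg_inv {γ δ' δ : Scope S} {s : S} {Γ : Cx ς γ} {c : Fin n} {Δ' : Cx ς δ'}
    {Δ : Ctx ς δ' δ} {T : Pat ς δ' .nil (.ty s)} (hent : 𝕄.msig.entry c = .neg Δ' Δ T)
    {h : ς.arity c = .tm δ s} {ts : Sp ς γ δ} {V : Ty ς γ s}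
    (ht : 𝕄.toTheory.HasType Γ (.con c h ts) V) :
    ∃ w : Sp ς γ δ', 𝕄.toTheory.HasCtx Γ w (Δ'.wk γ) ∧ 𝕄.toTheory.HasCtx Γ ts (Δ.subst w) ∧
      𝕄.rew.Conv V (Ex.sub (γ := δ') (k := .ty s) T.toEx (Sub.ofSp' w)) := by
  obtain ⟨φ, Δ'', ν, U', us, hent', hus, rfl, hc⟩ := ht.con_inv
  rw [entry_toTheory hent] at hent'
  cases hent'
  obtain ⟨w, us, rfl⟩ := Ex.exists_spAppend us
  rw [Erasure.eraseKeep_act]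
  obtain ⟨h₁, h₂⟩ := hasCtx_append_wk_iff.1 hus
  refine ⟨w, h₁, h₂, ?_⟩
  have key : ∀ e : Ty ς δ' s, (e.rename (Ren.wkl δ' δ)).subst (w.spAppend us) =
      e.sub (Sub.ofSp' w) := fun e => by
    rw [Ex.subst_eq_sub, Ex.rename_sub, Sub.wkl_thenSub_ofSp']
  exact (congrArg (𝕄.rew.Conv V) (key T.toEx)).mp hc

theorem inf_inv {γ δ₁ δ' γₓ δ₂ : Scope S} {sₓ s : S} {Γ : Cx ς γ} {c : Fin n} {Δ₁ : Cx ς δ₁}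
    {Δ' : Ctx ς δ₁ δ'} {Γₓ : Ctx ς δ₁ γₓ} {T : Pat ς δ' γₓ (.ty sₓ)}
    {Δ₂ : Ctx ς ((δ₁ ⧺ δ').snoc γₓ sₓ) δ₂} {U : Ty ς (((δ₁ ⧺ δ').snoc γₓ sₓ) ⧺ δ₂) s}
    {ts : Sp ς γ δ₁} {t : Tm ς (γ ⧺ γₓ) sₓ} {us : Sp ς γ δ₂}
    (hent : 𝕄.msig.entry c = .inf Δ₁ Δ' Γₓ T Δ₂ U)
    {h : ς.arity c = .tm ((δ₁.snoc γₓ sₓ) ⧺ δ₂) s} {V : Ty ς γ s}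
    (ht : 𝕄.toTheory.HasType Γ (.con c h (Ex.spAppend (Ex.snoc ts t) us)) V) :
    ∃ w : Sp ς γ δ', 𝕄.toTheory.HasCtx Γ ts (Δ₁.wk γ) ∧ 𝕄.toTheory.HasCtx Γ w (Δ'.subst ts) ∧
      𝕄.toTheory.HasType (Γ.append (Γₓ.subst ts)) t (T.toEx.sub ((Sub.ofSp' w).lift γₓ)) ∧
      𝕄.toTheory.HasCtx Γ us (Δ₂.subst (Ex.snoc (ts.spAppend w) t)) ∧
      𝕄.rew.Conv V (U.subst (Ex.spAppend (Ex.snoc (ts.spAppend w) t) us)) := by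
  obtain ⟨φ, Δ'', ν, U', es, hent', hes, he, hc⟩ := ht.con_inv
  rw [entry_toTheory hent] at hent'
  cases hent'
  obtain ⟨es, us', rfl⟩ := Ex.exists_spAppend es
  cases es with | snoc es t' =>
  obtain ⟨ts', w, rfl⟩ := Ex.exists_spAppend es
  rw [Erasure.keepMore_act, Erasure.act, Erasure.eraseMore_act, Erasure.keepAll_act] at he
  obtain ⟨he', rfl⟩ := Ex.spAppend_inj he
  cases he'
  obtain ⟨h₁, hus⟩ := hasCtx_append_wk_iff.1 hes
  obtain ⟨h₁, ht⟩ := hasCtx_snoc_wk_iff.1 h₁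
  obtain ⟨hts, hw⟩ := hasCtx_append_wk_iff.1 h₁
  refine ⟨w, hts, hw, ?_, hus, hc⟩
  rw [Ex.subst_eq_sub, Ex.rename_sub, Ex.rename_sub, Sub.lift_thenSub_lift,
    Sub.wkl_thenSub_ofSp', Sub.wkr_thenSub_ofSp', ← Ex.subst_eq_sub] at ht
  exact ht

end ModedTheory

/-! ### Recovery of erased arguments and completeness -/

namespace ModedTheory

open Relation RewSys Theory

variable {𝕄 : ModedTheory ς}

/-- This discharges the side condition of the rule that switches from checking to inference. -/
theorem _root_.CompLF.WellModed.not_isNeg {γ : Scope S} {s : S} {t : Tm ς γ s}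
    (h : WellModed 𝕄.marity .plus t) : ¬ 𝕄.IsNeg t := by
  rintro ⟨c, δ, hc, ts, hm, rfl⟩
  generalize he : Ex.con c hc ts = e at h
  cases h with
  | var x h => cases he
  | const hm' _ h => cases he; rw [hm] at hm'; cases hm'
  | constPos hm' _ h₁ h₂ h₃ => cases he; rw [hm] at hm'; cases hm'

theorem entry_of_marity_ty {c : Fin n} {δ : Scope S} (h : 𝕄.marity c = .ty δ) :
    ∃ Δ : Cx ς δ, 𝕄.msig.entry c = .ty Δ := by
  unfold ModedTheory.marity at h
  generalize 𝕄.msig.entry c = E at h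
  cases E <;> cases h
  exact ⟨_, rfl⟩

theorem entry_of_marity_pos {c : Fin n} {δ : Scope S} {s : S} (h : 𝕄.marity c = .pos δ s) :
    ∃ (Δ : Cx ς δ) (T : Ty ς δ s), 𝕄.msig.entry c = .pos Δ T := by
  unfold ModedTheory.marity at h
  generalize 𝕄.msig.entry c = E at h
  cases E <;> cases h
  exact ⟨_, _, rfl⟩

theorem entry_of_marity_neg {c : Fin n} {δ : Scope S} {s : S} (h : 𝕄.marity c = .neg δ s) :
    ∃ (δ' : Scope S) (Δ' : Cx ς δ') (Δ : Ctx ς δ' δ) (T : Pat ς δ' .nil (.ty s)),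
      𝕄.msig.entry c = .neg Δ' Δ T := by
  unfold ModedTheory.marity at h
  generalize 𝕄.msig.entry c = E at h
  cases E <;> cases h
  exact ⟨_, _, _, _, rfl⟩

theorem entry_of_marity_inf {c : Fin n} {δ₁ γₓ δ₂ : Scope S} {sₓ s : S}
    (h : 𝕄.marity c = .inf δ₁ γₓ sₓ δ₂ s) :
    ∃ (δ' : Scope S) (Δ₁ : Cx ς δ₁) (Δ' : Ctx ς δ₁ δ') (Γₓ : Ctx ς δ₁ γₓ)
      (T : Pat ς δ' γₓ (.ty sₓ)) (Δ₂ : Ctx ς ((δ₁ ⧺ δ').snoc γₓ sₓ) δ₂)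
      (U : Ty ς (((δ₁ ⧺ δ').snoc γₓ sₓ) ⧺ δ₂) s),
      𝕄.msig.entry c = .inf Δ₁ Δ' Γₓ T Δ₂ U := by
  unfold ModedTheory.marity at h
  generalize 𝕄.msig.entry c = E at h
  cases E <;> cases h
  exact ⟨_, _, _, _, _, _, _, rfl⟩

/-- The missing arguments of a constant `c⁻` are found by matching. -/
theorem neg_match (hwt : 𝕄.WellTyped) (hconf : 𝕄.toTheory.Confluent)
    (hsn : 𝕄.toTheory.StronglyNormalising) (hsr : 𝕄.toTheory.SubjectReduction)
    (𝔖 : 𝕄.toTheory.Strategy) {γ δ' δ : Scope S} {s : S} {Γ : Cx ς γ} {c : Fin n} {Δ' : Cx ς δ'}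
    {Δ : Ctx ς δ' δ} {T : Pat ς δ' .nil (.ty s)} (hent : 𝕄.msig.entry c = .neg Δ' Δ T)
    {h : ς.arity c = .tm δ s} {ts : Sp ς γ δ} {V : Ty ς γ s}
    (ht : 𝕄.toTheory.HasType Γ (.con c h ts) V) :
    ∃ v : Sp ς γ δ', Match 𝔖 T (γ₀ := .nil) (γf := γ) V v ∧
      𝕄.toTheory.HasCtx Γ ts (Δ.subst v) := by
  have hsig := hwt.sigOk
  obtain ⟨hΔ, hT, hrig⟩ := hwt.entry hent
  have hΔ := hΔ.univ
  have hT := hT.univ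
  have hV := ht.isType hsig
  obtain ⟨w, hw, hts, hc⟩ := neg_inv hent ht
  -- The scope `γ ⧺ .nil` is `γ` by definition, but lifting along the empty scope is the identity
  -- only propositionally.
  have hc₀ : 𝕄.toTheory.rew.Conv (γ := γ ⧺ .nil) V (T.toEx.sub ((Sub.ofSp' w).lift .nil)) :=
    (congrArg (fun σ => 𝕄.rew.Conv V (Ex.sub (γ := δ') (γ' := γ) (k := .ty s) T.toEx σ))
      (Sub.lift_nil (Sub.ofSp' w))).mpr hc
  have hVsn : 𝕄.toTheory.rew.SN (γ := γ ⧺ .nil) V := hV.sn hsn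
  obtain ⟨v, hm⟩ := exists_match hconf 𝔖 T hrig hVsn hc₀
  have hvw : 𝕄.rew.Conv v w := conv_sp_of_get (Match.conv hconf hm hrig hVsn hc₀)
  have hω := mor_ofSp' hw
  -- For the parallel inversion to start, a type pattern and the type matched with it only have to
  -- be well-formed.
  have hst : 𝕄.toTheory.SameTyping (Δ'.append .cnil) (Γ.append (Ex.cnil.sub (Sub.ofSp' w)))
      ((Sub.ofSp' w).lift .nil) (T.toEx.rename ((Ren.id δ').lift .nil)) V := by
    refine ⟨?_, hV⟩
    rw [Ren.lift_id, Ex.rename_id]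
    exact hT
  have hv : 𝕄.toTheory.HasCtx Γ v (Δ'.wk γ) := by
    refine hasCtx_of_conv hw (.append_wk hts.wf (WfCtx.of_append hΔ)) hvw fun θ r x => ?_
    have := Match.hasType hconf hsn hsr hsig hm hrig hω hts.wf (Ren.id δ') hc₀ hst x
    rwa [Cx.cdom_wk, Cx.ccod_wk, Ex.inst_eq_sub, Ex.instUnder_eq_sub, Ex.rename_sub,
      Ex.rename_sub, Sub.lift_thenSub_lift, Sub.wkr_thenSub_ofSp]
  refine ⟨v, hm, ?_⟩
  have hwv := WfCtx.append_sub hΔ (mor_ofSp' hv) hts.wf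
  have hww := WfCtx.append_sub hΔ hω hts.wf
  rw [← Ex.subst_eq_sub] at hwv hww
  -- The visible arguments are typed over `w`, and the contexts instantiated at `w` and at `v` are
  -- convertible.
  refine hts.conv (Conv.ctxEq ?_) hww hwv
  rw [Ex.subst_eq_sub, Ex.subst_eq_sub]
  exact Conv.sub_right _ (SubConv.ofSp' (Conv.symm hvw))

/-- The missing arguments of a constant `c⁺` with an inferable argument are found by matching. -/
theorem inf_match (hwt : 𝕄.WellTyped) (hconf : 𝕄.toTheory.Confluent)
    (hsn : 𝕄.toTheory.StronglyNormalising) (hsr : 𝕄.toTheory.SubjectReduction)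
    (𝔖 : 𝕄.toTheory.Strategy) {γ δ₁ δ' γₓ δ₂ : Scope S} {sₓ s : S} {Γ : Cx ς γ} {c : Fin n}
    {Δ₁ : Cx ς δ₁} {Δ' : Ctx ς δ₁ δ'} {Γₓ : Ctx ς δ₁ γₓ} {T : Pat ς δ' γₓ (.ty sₓ)}
    {Δ₂ : Ctx ς ((δ₁ ⧺ δ').snoc γₓ sₓ) δ₂} {U : Ty ς (((δ₁ ⧺ δ').snoc γₓ sₓ) ⧺ δ₂) s}
    {ts : Sp ς γ δ₁} {t : Tm ς (γ ⧺ γₓ) sₓ} {us : Sp ς γ δ₂} {V : Ty ς (γ ⧺ γₓ) sₓ}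
    (hent : 𝕄.msig.entry c = .inf Δ₁ Δ' Γₓ T Δ₂ U) {w : Sp ς γ δ'}
    (hts : 𝕄.toTheory.HasCtx Γ ts (Δ₁.wk γ)) (hw : 𝕄.toTheory.HasCtx Γ w (Δ'.subst ts))
    (ht : 𝕄.toTheory.HasType (Γ.append (Γₓ.subst ts)) t (T.toEx.sub ((Sub.ofSp' w).lift γₓ)))
    (hus : 𝕄.toTheory.HasCtx Γ us (Δ₂.subst (Ex.snoc (ts.spAppend w) t)))
    (hV : 𝕄.toTheory.IsType (Γ.append (Γₓ.subst ts)) V)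
    (hVT : 𝕄.rew.Conv V (T.toEx.sub ((Sub.ofSp' w).lift γₓ))) :
    ∃ v : Sp ς γ δ', Match 𝔖 T V v ∧
      𝕄.toTheory.HasCtx Γ us (Δ₂.subst (Ex.snoc (ts.spAppend v) t)) ∧
      𝕄.toTheory.IsType Γ (U.subst (Ex.spAppend (Ex.snoc (ts.spAppend v) t) us)) := by
  have hsig := hwt.sigOk
  obtain ⟨hU, -, hrig⟩ := hwt.entry hent
  have hU : 𝕄.toTheory.IsType (infCx Δ₁ Δ' Γₓ T Δ₂) U := hU.univ
  have hΔ := hU.wf.of_append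
  have hT := hΔ.isType
  have hΔ' : 𝕄.toTheory.WfCtx (Δ₁.append Δ') := hT.wf.of_append
  obtain ⟨v, hm⟩ := exists_match hconf 𝔖 T hrig (hV.sn hsn) hVT
  have hvw : 𝕄.rew.Conv v w := conv_sp_of_get (Match.conv hconf hm hrig (hV.sn hsn) hVT)
  have hω := mor_ofSp' (hasCtx_append_wk_iff.2 ⟨hts, hw⟩)
  have hΓₓ : ∀ v : Sp ς γ δ',
      (Γₓ.rename (Ren.wkl δ₁ δ')).sub (Sub.ofSp' (ts.spAppend v)) = Γₓ.subst ts := fun v => by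
    rw [Ex.rename_sub, Sub.wkl_thenSub_ofSp', Ex.subst_eq_sub]
  have hTv : ∀ v : Sp ς γ δ',
      (T.toEx.rename ((Ren.wkr δ₁ δ').lift γₓ)).sub ((Sub.ofSp' (ts.spAppend v)).lift γₓ) =
        T.toEx.sub ((Sub.ofSp' v).lift γₓ) := fun v => by
    rw [Ex.rename_sub, Sub.lift_thenSub_lift, Sub.wkr_thenSub_ofSp']
  have hv : 𝕄.toTheory.HasCtx Γ v (Δ'.subst ts) := by
    have hw' := WfCtx.append_sub hΔ' (mor_ofSp' hts) hts.wf
    rw [← Ex.subst_eq_sub] at hw'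
    refine hasCtx_of_conv hw hw' hvw fun θ r x => ?_
    -- The flexible variables of `T` are the `Δ'` part of `Δ₁.Δ'`, and the rigid ones are those of
    -- `Γₓ`, which depends on `Δ₁` alone and hence has the same instance at `v` and at `w`.
    have := Match.hasType hconf hsn hsr hsig hm hrig hω hts.wf (Ren.wkr δ₁ δ')
      (Θ₀ := Γₓ.rename (Ren.wkl δ₁ δ'))
      (by rw [Sub.wkr_thenSub_ofSp']; exact hVT) ⟨hT, by rwa [hΓₓ]⟩ x
    rwa [Ren.wkr_apply, Cx.dom_append_inr, Cx.cod_append_inr, ← Sub.ofSp'_lift_comp_ofSp,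
      ← Sub.lift_comp, ← Ex.sub_sub, ← Ex.sub_sub, ← Ex.cdom_sub, ← Ex.ccod_sub,
      ← Ex.subst_eq_sub, ← Ex.inst_eq_sub, ← Ex.instUnder_eq_sub] at this
  have htv : 𝕄.toTheory.HasCtx Γ (ts.spAppend v) ((Δ₁.append Δ').wk γ) :=
    hasCtx_append_wk_iff.2 ⟨hts, hv⟩
  have hwv : 𝕄.rew.SubConv (Sub.ofSp' w) (Sub.ofSp' v) := SubConv.ofSp' (Conv.symm hvw)
  have hTv' := hT.sub_lift (mor_ofSp' htv) hts.wf
  rw [hΓₓ, hTv] at hTv'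
  -- The inferable argument is retyped at `v`, so that it can be part of the spine over which `Δ₂`
  -- and `U` are instantiated.
  have ht' : 𝕄.toTheory.HasType (Γ.append (Γₓ.subst ts)) t (T.toEx.sub ((Sub.ofSp' v).lift γₓ)) :=
    .conv (Conv.sub_right _ (hwv.lift _)) ht hTv'
  have hsnoc : ∀ v : Sp ς γ δ', 𝕄.toTheory.HasCtx Γ (ts.spAppend v) ((Δ₁.append Δ').wk γ) →
      𝕄.toTheory.HasType (Γ.append (Γₓ.subst ts)) t (T.toEx.sub ((Sub.ofSp' v).lift γₓ)) →
      𝕄.toTheory.HasCtx Γ (Ex.snoc (ts.spAppend v) t)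
        ((Cx.snoc (Δ₁.append Δ') (Γₓ.rename (Ren.wkl δ₁ δ'))
          (T.toEx.rename ((Ren.wkr δ₁ δ').lift γₓ))).wk γ) := fun v h₁ h₂ => by
    rw [hasCtx_snoc_wk_iff, Ex.subst_eq_sub, hΓₓ, hTv]
    exact ⟨h₁, h₂⟩
  have hsv := hsnoc v htv ht'
  have hsw := hsnoc w (hasCtx_append_wk_iff.2 ⟨hts, hw⟩) ht
  have hΔv := WfCtx.append_sub hU.wf (mor_ofSp' hsv) hts.wf
  have hΔw := WfCtx.append_sub hU.wf (mor_ofSp' hsw) hts.wf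
  rw [← Ex.subst_eq_sub] at hΔv hΔw
  have hus' : 𝕄.toTheory.HasCtx Γ us (Δ₂.subst (Ex.snoc (ts.spAppend v) t)) := by
    refine hus.conv (Conv.ctxEq ?_) hΔw hΔv
    rw [Ex.subst_eq_sub, Ex.subst_eq_sub]
    exact Conv.sub_right _ (SubConv.ofSp'
      (Conv.snoc (conv_spAppend (Conv.refl _) (Conv.symm hvw)) (.refl _)))
  exact ⟨v, hm, hus', hU.subst (hasCtx_append_wk_iff.2 ⟨hsv, hus'⟩)⟩

/-- Completeness of the algorithm for an expression of some mode. -/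
def Complete (𝕄 : ModedTheory ς) (𝔖 : 𝕄.toTheory.Strategy) :
    Mode → {γ : Scope S} → {k : Kind S} → Ex ς γ k → Prop
  | .plus, γ, .tm s, t => ∀ (Γ : Cx ς γ) (T : Ty ς γ s), 𝕄.toTheory.HasType Γ t T →
    ∃ T' : Ty ς γ s, 𝕄.Alg 𝔖 (.inf Γ t T') ∧ 𝕄.toTheory.IsType Γ T' ∧
      ∀ U : Ty ς γ s, 𝕄.toTheory.HasType Γ t U → 𝕄.rew.Conv U T'
  | .minus, γ, .tm s, t => ∀ (Γ : Cx ς γ) (T : Ty ς γ s), 𝕄.toTheory.HasType Γ t T →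
    𝕄.Alg 𝔖 (.chk Γ t T)
  | .both, γ, .sp δ, ts => ∀ (Γ : Cx ς γ) (Δ : Ctx ς γ δ), 𝕄.toTheory.HasCtx Γ ts Δ →
    𝕄.Alg 𝔖 (.sp Γ ts Δ)
  | .both, γ, .ty _, T => ∀ Γ : Cx ς γ, 𝕄.toTheory.IsType Γ T → 𝕄.Alg 𝔖 (.ty Γ T)
  | _, _, _, _ => True

/-- In each case inversion of typing provides the premises for the induction hypotheses, and
matching supplies the arguments that the syntax omits. The inferred type depends on the chosen
matching result only, so comparing it with an arbitrary type of the term gives uniqueness. -/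
theorem complete (hwt : 𝕄.WellTyped) (hconf : 𝕄.toTheory.Confluent)
    (hsn : 𝕄.toTheory.StronglyNormalising) (hsr : 𝕄.toTheory.SubjectReduction)
    (𝔖 : 𝕄.toTheory.Strategy) {m : Mode} {γ : Scope S} {k : Kind S} {e : Ex ς γ k}
    (h : WellModed 𝕄.marity m e) : 𝕄.Complete 𝔖 m e := by
  have hsig := hwt.sigOk
  induction h with
  | var x _ ih =>
    intro Γ T ht
    have hts := ht.var_inv.1
    exact ⟨_, .var x (ih _ _ hts), (hts.wf.cod x).inst hts, fun U hU => hU.var_inv.2⟩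
  | const hm h _ ih =>
    intro Γ T ht
    obtain ⟨Δ, T', hent⟩ := entry_of_marity_pos hm
    have hts := (pos_inv hent ht).1
    exact ⟨_, .const hent h (ih _ _ hts), (hsig.tm (entry_toTheory hent)).subst hts,
      fun U hU => (pos_inv hent hU).2⟩
  | constNeg hm h _ ih =>
    intro Γ T ht
    obtain ⟨δ', Δ', Δ, P, hent⟩ := entry_of_marity_neg hm
    obtain ⟨v, hv, hts⟩ := neg_match hwt hconf hsn hsr 𝔖 hent ht
    exact .constNeg hent h hv (ih _ _ hts)
  | constPos hm h _ _ _ ih₁ ih₂ ih₃ =>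
    intro Γ U₀ ht₀
    obtain ⟨δ', Δ₁, Δ', Γₓ, T, Δ₂, U, hent⟩ := entry_of_marity_inf hm
    obtain ⟨w, hts, hw, ht, hus, hc⟩ := inf_inv hent ht₀
    obtain ⟨V, halg, hV, hVu⟩ := ih₂ _ _ ht
    -- The inferred `V` is convertible to the pattern instance at `w` by the uniqueness part of the
    -- hypothesis on the inferable argument.
    obtain ⟨v, hm, hus', hU⟩ := inf_match hwt hconf hsn hsr 𝔖 hent hts hw ht hus hV
      (Conv.symm (hVu _ ht))
    refine ⟨_, .constPos hent h (ih₁ _ _ hts) halg hm (ih₃ _ _ hus'), hU, fun U' hU' => ?_⟩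
    -- Another typing may use other erased arguments `w'`. By uniqueness for the inferable argument,
    -- `V` is also convertible to the pattern instance at `w'`, hence `w'` is convertible to the
    -- same `v`.
    obtain ⟨w', -, -, ht', -, hc'⟩ := inf_inv hent hU'
    have hwv : 𝕄.rew.Conv w' v := Conv.symm (conv_sp_of_get
      (Match.conv hconf hm (hwt.entry hent).2.2 (hV.sn hsn) (Conv.symm (hVu _ ht'))))
    refine Conv.trans hc' ?_
    rw [Ex.subst_eq_sub, Ex.subst_eq_sub]
    exact Conv.sub_right _ (SubConv.ofSp' (conv_spAppend
      (Conv.snoc (conv_spAppend (Conv.refl _) hwv) (.refl _)) (Conv.refl _)))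
  | switch h ih =>
    intro Γ T ht
    obtain ⟨T', halg, hT', hu⟩ := ih _ _ ht
    obtain ⟨W, hW⟩ := 𝔖.exists_nf ((ht.isType hsig).sn hsn)
    obtain ⟨W', hW'⟩ := 𝔖.exists_nf (hT'.sn hsn)
    -- The expected and the inferred type are convertible and strongly normalising, so the
    -- comparison of normal forms succeeds.
    obtain rfl := Strategy.nf_eq_ty hconf hW hW' (hu _ ht)
    exact .switch h.not_isNeg halg hW hW'
  | emptySp =>
    intro Γ Δ h
    cases Δ
    exact .emptySp
  | extSp _ _ ih₁ ih₂ =>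
    intro Γ Δ h
    cases h with | extSp _ _ hts ht => exact .extSp (ih₁ _ _ hts) (ih₂ _ _ ht)
  | type hm h hs _ ih =>
    intro Γ ht
    obtain ⟨Δ, hent⟩ := entry_of_marity_ty hm
    exact .type hent h hs (ih _ _ (ty_inv hent ht))

end ModedTheory

end Raw

end CompLF

-- The theorem

universe u

open CompLF in
theorem theorem3p7 {S : Type u} {n : ℕ} {ς : PreSig S n} (𝕄 : ModedTheory ς)
    (hwt : 𝕄.WellTyped) (hconf : 𝕄.toTheory.Confluent)
    (hsn : 𝕄.toTheory.StronglyNormalising) (hsr : 𝕄.toTheory.SubjectReduction)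
    (𝔖 : 𝕄.toTheory.Strategy) :
    (∀ {γ : Scope S} {s : S} (Γ : Cx ς γ) (t : Tm ς γ s) (T : Ty ς γ s),
      𝕄.toTheory.HasType Γ t T → WellModed 𝕄.marity .plus t →
        ∃ T' : Ty ς γ s, 𝕄.Alg 𝔖 (.inf Γ t T') ∧ 𝕄.rew.Conv T T') ∧
    (∀ {γ : Scope S} {s : S} (Γ : Cx ς γ) (t : Tm ς γ s) (T : Ty ς γ s),
      𝕄.toTheory.HasType Γ t T → WellModed 𝕄.marity .minus t → 𝕄.Alg 𝔖 (.chk Γ t T)) ∧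
    (∀ {γ : Scope S} {s : S} (Γ : Cx ς γ) (T : Ty ς γ s),
      𝕄.toTheory.IsType Γ T → WellModed 𝕄.marity .both T → 𝕄.Alg 𝔖 (.ty Γ T)) ∧
    (∀ {γ δ : Scope S} (Γ : Cx ς γ) (ts : Sp ς γ δ) (Δ : Ctx ς γ δ),
      𝕄.toTheory.HasCtx Γ ts Δ → 𝕄.toTheory.WfCtx (Γ.append Δ) →
        WellModed 𝕄.marity .both ts → 𝕄.Alg 𝔖 (.sp Γ ts Δ)) ∧
    (∀ {γ : Scope S} {s : S} (Γ : Cx ς γ) (t : Tm ς γ s) (T U : Ty ς γ s),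
      WellModed 𝕄.marity .plus t → 𝕄.toTheory.HasType Γ t T → 𝕄.toTheory.HasType Γ t U →
        𝕄.rew.Conv T U) := by
  refine ⟨fun Γ t T ht hm => ?_, fun Γ t T ht hm => ?_, fun Γ T hT hm => ?_,
    fun Γ ts Δ hts _ hm => ?_, fun Γ t T U hm hT hU => ?_⟩
  · obtain ⟨T', h, -, hu⟩ := ModedTheory.complete hwt hconf hsn hsr 𝔖 hm Γ T ht
    exact ⟨T', h, hu T ht⟩
  · exact ModedTheory.complete hwt hconf hsn hsr 𝔖 hm Γ T ht
  · exact ModedTheory.complete hwt hconf hsn hsr 𝔖 hm Γ hT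
  · exact ModedTheory.complete hwt hconf hsn hsr 𝔖 hm Γ Δ hts
  · obtain ⟨T', -, -, hu⟩ := ModedTheory.complete hwt hconf hsn hsr 𝔖 hm Γ T hT
    exact RewSys.Conv.trans (hu T hT) (RewSys.Conv.symm (hu U hU))
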